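/- **Notation.** For $g:\mathbb R^2\to\mathbb R$ write $g^{(i,j)}=\partial^{i+j}g/\partial x_1^i\partial x_2^j$, $\nabla g$ and $\nabla^2g$ for gradient and Hessian, and $d^2g=(g^{(2,0)},g^{(1,1)},g^{(0,2)})^T$. Let $G:\mathbb R^3\to\mathbb R^2$ and $J:\mathbb R^3\to\mathbb R$ be $$G(u,v,w)=\begin{pmatrix}2u-2w+2v-2\sqrt{(w-u)^2+4v^2}\\ w-u+4v-\sqrt{(w-u)^2+4v^2}\end{pmatrix},\qquad J(u,v,w)=\tfrac12\Big(u+w-\sqrt{(u-w)^2+4v^2}\Big).$$ For a density $f$ put $V=G(d^2f)$, $\lambda_2=J(d^2f)$ (so $\nabla^2f\,V=\lambda_2V$ and $\lambda_2$ is the smaller eigenvalue of $\nabla^2f$), and $\tilde G(x)=\nabla G(d^2f(x))\in\mathbb R^{2\times3}$, $\tilde a'(x)=\nabla f(x)^T\nabla V(x)V(x)+\lambda_2(x)\|V(x)\|^2$. Let $\mathfrak X_{x_0}:\mathbb R\to\mathbb R^2$ solve $\mathfrak X_{x_0}'(t)=V(\mathfrak X_{x_0}(t))$, $\mathfrak X_{x_0}(0)=x_0$,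 let $\Theta_{x_0}=\{t\in\mathbb R:\langle\nabla f,V\rangle(\mathfrak X_{x_0}(t))=0,\ \lambda_2(\mathfrak X_{x_0}(t))<0\}$, and let $\theta_{x_0}$ be the minimizer of $|t|$ over $t\in\Theta_{x_0}$. For $\mathcal L\subset\mathbb R^2$ and $a^*>0$ let $\mathcal G=\{\mathfrak X_{x_0}(t):x_0\in\mathcal L,\,-a^*\le t\le a^*\}$. **Estimators.** Let $X_1,X_2,\dots$ be i.i.d. with density $f$, let $h=h_n>0$, and let $\hat f(x)=\frac1{nh^2}\sum_{i=1}^nK\big(\frac{x-X_i}h\big)$. Let $\hat V,\hat\lambda_2,\hat{\mathfrak X}_{x_0},\hat\Theta_{x_0}$ be defined as $V,\lambda_2,\mathfrak X_{x_0},\Theta_{x_0}$ with $\hat f$ in place of $f$. Let $\hat\theta_{x_0}$ be a minimizer of $|t|$ over $t\in\hat\Theta_{x_0}$ (any one, if there are several), and $\hat\theta_{x_0}=0$ if $\hat\Theta_{x_0}=\emptyset$. **Assumptions.** * (F1) $f$ is a four times continuously differentiable probability density on $\mathbb R^2$; its partial derivatives of orders $1$ to $4$ are bounded. * (F2) $\mathcal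 H$ is compact, $f>0$ on the open $\epsilon_0$-neighbourhood of $\mathcal H$ for some $\epsilon_0>0$, and $\nabla^2f(x)$ has two distinct eigenvalues for each $x\in\mathcal H$. * (F3) $a^*>0$, $\mathcal L$ is compact, $\mathcal G\subset\mathcal H$, for each $x_0\in\mathcal G$ the minimizer $\theta_{x_0}$ exists and is unique, and $\mathcal L=\{\mathfrak X_{x_0}(\theta_{x_0}):x_0\in\mathcal G\}$. * (F4) There is $\gamma>0$ with $\big\|\frac1{u-s}\int_s^uV(\mathfrak X_{x_0}(\lambda))\,d\lambda\big\|\ge\gamma$ for all $x_0\in\mathcal L$ and $-a^*\le s<u\le a^*$. * (F5) $\langle\nabla\langle\nabla f,V\rangle(x),V(x)\rangle\ne0$ for all $x\in\mathcal L$. * (F6) No point $x\in\mathcal H$, and no point $x=\mathfrak X_{x_0}(t)$ with $x_0\in\mathcal G$ and $|t|\le|\theta_{x_0}|$, satisfies both $\lambda_2(x)=0$ and $\langle\nabla f(x),V(x)\rangle=0$. (The second part is implied by the first if these arcs lie in $\mathcal H$.) * (K1) $K$ is a four times differentiable probability density on $\mathbb R^2$, symmetric ($K(-x)=K(x)$),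 whose support is the closed unit ball; its partial derivatives of orders $1$ to $4$ are bounded; and $\int K(x)xx^T\,dx=\mu_2(K)\,I_{2\times2}$ with $\mu_2(K)<\infty$. * (K2) $\int d^2K(x)\,d^2K(x)^T\,dx$ is finite. * (H1) As $n\to\infty$: $h_n\to0$, $nh_n^8/(\log n)^3\to\infty$, and $nh_n^9\to\beta$ for some $\beta\ge0$. **Theorem 3.5.** Assume (F1)–(F6), (K1)–(K2) and (H1). With $$\hat\varphi_{1n}(x)=\frac1{\tilde a'(x)}\,\nabla f(x)^T\,\tilde G(x)\,\big(d^2\hat f(x)-\mathbb E\,d^2\hat f(x)\big),$$ $$\sup_{x_0\in\mathcal G}\big\|\hat{\mathfrak X}_{x_0}(\hat\theta_{x_0})-\mathfrak X_{x_0}(\theta_{x_0})+\hat\varphi_{1n}(\mathfrak X_{x_0}(\theta_{x_0}))\,V(\mathfrak X_{x_0}(\theta_{x_0}))\big\|=O_p\Big(\frac{\log n}{nh^7}\Big).$$ If in addition $\sup_{x_0\in\mathcal G}\|\nabla f(\mathfrak X_{x_0}(\theta_{x_0}))\|=0$, then $$\sup_{x_0\in\mathcal G}\Big\|\hat{\mathfrak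 X}_{x_0}(\hat\theta_{x_0})-\mathfrak X_{x_0}(\theta_{x_0})+\Gamma(\theta_{x_0})\big(\hat{\mathfrak X}_{x_0}(\theta_{x_0})-\mathfrak X_{x_0}(\theta_{x_0})\big)+\frac1{\tilde a'(\mathfrak X_{x_0}(\theta_{x_0}))}P_V(\theta_{x_0})\,\hat b_{x_0}\Big\|=O_p\Big(\frac{\log n}{nh^{13/2}}\Big),$$ where $\hat b_{x_0}=(\mathbb E\nabla\hat f-\nabla f)(\hat{\mathfrak X}_{x_0}(\theta_{x_0}))$ (the deterministic function $\mathbb E\nabla\hat f-\nabla f$ evaluated at the random point), $P_V(t)=V(\mathfrak X_{x_0}(t))V(\mathfrak X_{x_0}(t))^T$ and $\Gamma(t)=\tilde a'(\mathfrak X_{x_0}(t))^{-1}P_V(t)\nabla^2f(\mathfrak X_{x_0}(t))-I_{2\times2}$. Here $\sup_{x_0\in\mathcal G}\|Z_n(x_0)\|=O_p(r_n)$ means: for every $\varepsilon>0$ there is $M$ such that, for all large $n$, the (outer) probability that $\|Z_n(x_0)\|>Mr_n$ for some $x_0\in\mathcal G$ is at most $\varepsilon$. -/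

import Mathlib

open MeasureTheory ProbabilityTheory Filter Topology

noncomputable section

namespace Filament

/-- The Euclidean plane `ℝ²`. -/
abbrev Plane := EuclideanSpace ℝ (Fin 2)

/-- Euclidean space `ℝ³`, in which the vectors of second derivatives live. -/
abbrev Space3 := EuclideanSpace ℝ (Fin 3)

/-! ### Derivatives -/

/-- The partial derivative of `g` in the `i`-th coordinate. -/
def partialD (i : Fin 2) (g : Plane → ℝ) : Plane → ℝ :=
  fun x => fderiv ℝ g x (EuclideanSpace.single i 1)

/-- The iterated partial derivative `g^{(i,j)} = ∂^{i+j} g / ∂x₁^i ∂x₂^j`. -/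
def pd (i j : ℕ) (g : Plane → ℝ) : Plane → ℝ :=
  (partialD 0)^[i] ((partialD 1)^[j] g)

/-- All partial derivatives of `g` of the orders `1, …, 4` are bounded. -/
def BoundedPartials (g : Plane → ℝ) : Prop :=
  ∀ i j : ℕ, 1 ≤ i + j → i + j ≤ 4 → ∃ C : ℝ, ∀ x, |pd i j g x| ≤ C

/-- The Hessian matrix `∇² g`. -/
def hess (g : Plane → ℝ) (x : Plane) : Matrix (Fin 2) (Fin 2) ℝ :=
  !![pd 2 0 g x, pd 1 1 g x; pd 1 1 g x, pd 0 2 g x]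

/-- `d² g = (g^{(2,0)}, g^{(1,1)}, g^{(0,2)})`. -/
def d2 (g : Plane → ℝ) (x : Plane) : Space3 :=
  !₂[pd 2 0 g x, pd 1 1 g x, pd 0 2 g x]

/-! ### The second eigenvector and the second eigenvalue of the Hessian -/

/-- The map `G : ℝ³ → ℝ²` for which `G (d² g)` is an eigenvector of `∇² g` for its smaller
eigenvalue. -/
def G (p : Space3) : Plane :=
  !₂[2 * p 0 - 2 * p 2 + 2 * p 1 - 2 * √((p 2 - p 0) ^ 2 + 4 * p 1 ^ 2),
     p 2 - p 0 + 4 * p 1 - √((p 2 - p 0) ^ 2 + 4 * p 1 ^ 2)]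

/-- The smaller eigenvalue of the symmetric matrix with entries `u, v; v, w`. -/
def J (p : Space3) : ℝ :=
  (p 0 + p 2 - √((p 0 - p 2) ^ 2 + 4 * p 1 ^ 2)) / 2

/-- The vector field `V = G (d² g)`. -/
def V (g : Plane → ℝ) (x : Plane) : Plane := G (d2 g x)

/-- The second eigenvalue `λ₂ = J (d² g)` of the Hessian. -/
def lam2 (g : Plane → ℝ) (x : Plane) : ℝ := J (d2 g x)

/-- `⟨∇ g, V⟩`, the derivative of `g` along `V`. -/
def slope (g : Plane → ℝ) (x : Plane) : ℝ := inner ℝ (gradient g x) (V g x)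

/-- `ã'(x) = ∇g(x)ᵀ ∇V(x) V(x) + λ₂(x) ‖V(x)‖²`. -/
def aTilde' (g : Plane → ℝ) (x : Plane) : ℝ :=
  inner ℝ (gradient g x) (fderiv ℝ (V g) x (V g x)) + lam2 g x * ‖V g x‖ ^ 2

/-! ### Integral curves and hitting times -/

/-- `γ` is a solution on all of `ℝ` of `γ' = W (γ)`, `γ 0 = x₀`. -/
def IsCurve (W : Plane → Plane) (x₀ : Plane) (γ : ℝ → Plane) : Prop :=
  γ 0 = x₀ ∧ ∀ t, HasDerivAt γ (W (γ t)) t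

open Classical in
/-- The integral curve of `W` that starts in `x₀`. For a globally Lipschitz field `W` (such as
`V g`, when the third partial derivatives of `g` are bounded) it exists and is unique;
the constant curve is a placeholder for the other cases. -/
def curve (W : Plane → Plane) (x₀ : Plane) : ℝ → Plane :=
  if h : ∃ γ, IsCurve W x₀ γ then h.choose else fun _ => x₀

/-- The integral curve `𝔛_{x₀}` driven by the second eigenvector of the Hessian of `g`. -/
def X (g : Plane → ℝ) (x₀ : Plane) : ℝ → Plane := curve (V g) x₀

/-- The set `Θ_{x₀}` of the times at which `𝔛_{x₀}` is in a filament point. -/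
def hitTimes (g : Plane → ℝ) (x₀ : Plane) : Set ℝ :=
  {t | slope g (X g x₀ t) = 0 ∧ lam2 g (X g x₀ t) < 0}

/-- `t` minimizes `|·|` over `S`. -/
def IsAbsArgmin (S : Set ℝ) (t : ℝ) : Prop := t ∈ S ∧ ∀ s ∈ S, |t| ≤ |s|

open Classical in
/-- `θ_{x₀}`, the minimizer of `|t|` over `Θ_{x₀}` (used only where it exists and is unique). -/
def theta (g : Plane → ℝ) (x₀ : Plane) : ℝ :=
  if h : ∃ t, IsAbsArgmin (hitTimes g x₀) t then h.choose else 0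

/-- `t` is an admissible value of the estimated hitting time when `S` is the set of estimated
times: one of the minimizers of `|·|` over `S` if there are any, and `0` if `S` is empty. -/
def IsHatTheta (S : Set ℝ) (t : ℝ) : Prop :=
  ((∃ s, IsAbsArgmin S s) → IsAbsArgmin S t) ∧ (S = ∅ → t = 0)

/-- `𝒢(L, a) = {𝔛_{x₀}(t) : x₀ ∈ L, -a ≤ t ≤ a}`. -/
def startSet (g : Plane → ℝ) (L : Set Plane) (a : ℝ) : Set Plane :=
  {x | ∃ x₀ ∈ L, ∃ t ∈ Set.Icc (-a) a, x = X g x₀ t}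

/-! ### Assumptions on the density, the filament, the kernel and the bandwidth -/

/-- `f` is a four times continuously differentiable probability density with bounded partial
derivatives of the orders one to four. -/
structure SmoothDensity (f : Plane → ℝ) : Prop where
  nonneg : ∀ x, 0 ≤ f x
  integrable : Integrable f
  integral_eq_one : ∫ x, f x = 1
  contDiff : ContDiff ℝ 4 f
  bounded : BoundedPartials f

/-- `H` is compact, `f > 0` on an `ε₀`-enlargement of `H`, and the Hessian of `f` has two distinct
eigenvalues on `H`. -/
structure Region (f : Plane → ℝ) (H : Set Plane) : Prop where
  isCompact : IsCompact H
  pos : ∃ ε₀ > 0, ∀ x ∈ Metric.thickening ε₀ H, 0 < f x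
  distinct : ∀ x ∈ H, ∃ a b : ℝ, a ≠ b ∧
    Module.End.HasEigenvalue (Matrix.toLin' (hess f x)) a ∧
    Module.End.HasEigenvalue (Matrix.toLin' (hess f x)) b

/-- `L` is a compact filament, `𝒢 = 𝒢(L, a) ⊆ H`, the time `θ_{x₀}` exists and is unique for
`x₀ ∈ 𝒢`, and `L` is the set of the points `𝔛_{x₀}(θ_{x₀})`, `x₀ ∈ 𝒢`. -/
structure IsFilament (f : Plane → ℝ) (H L : Set Plane) (a : ℝ) : Prop where
  a_pos : 0 < a
  isCompact : IsCompact L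
  subset : startSet f L a ⊆ H
  unique : ∀ x₀ ∈ startSet f L a, ∃! t, IsAbsArgmin (hitTimes f x₀) t
  eq : L = {x | ∃ x₀ ∈ startSet f L a, x = X f x₀ (theta f x₀)}

/-- Chords of the integral curves through `L` are uniformly nondegenerate. -/
def ChordBound (f : Plane → ℝ) (L : Set Plane) (a : ℝ) : Prop :=
  ∃ γ > 0, ∀ x₀ ∈ L, ∀ s u : ℝ, -a ≤ s → s < u → u ≤ a →
    γ ≤ ‖(1 / (u - s)) • ∫ l in s..u, V f (X f x₀ l)‖

/-- `⟨∇⟨∇f, V⟩, V⟩ ≠ 0` on `L`. -/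
def Transversal (f : Plane → ℝ) (L : Set Plane) : Prop :=
  ∀ x ∈ L, inner ℝ (gradient (slope f) x) (V f x) ≠ 0

/-- There is no degenerate point `λ₂ = 0 = ⟨∇f, V⟩`, neither in `H` nor on an arc
`{𝔛_{x₀}(t) : |t| ≤ |θ_{x₀}|}`, `x₀ ∈ 𝒢`, of a curve that is searched for its filament point. The
second part follows from the first if these (two-sided) arcs lie in `H`. -/
structure NoDegenerate (f : Plane → ℝ) (H L : Set Plane) (a : ℝ) : Prop where
  region : {x ∈ H | lam2 f x = 0 ∧ slope f x = 0} = ∅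
  arcs : ∀ x₀ ∈ startSet f L a, ∀ t : ℝ, |t| ≤ |theta f x₀| →
    ¬ (lam2 f (X f x₀ t) = 0 ∧ slope f (X f x₀ t) = 0)

/-- `K` is a four times differentiable symmetric probability density whose support is the unit
ball, with bounded partial derivatives of the orders one to four and with
`∫ K(x) x xᵀ dx` a multiple of the identity. -/
structure IsKernel (K : Plane → ℝ) : Prop where
  nonneg : ∀ x, 0 ≤ K x
  integral_eq_one : ∫ x, K x = 1
  symm : ∀ x, K (-x) = K x
  support : tsupport K = Metric.closedBall 0 1
  contDiff : ContDiff ℝ 3 K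
  differentiable : Differentiable ℝ (iteratedFDeriv ℝ 3 K)
  bounded : BoundedPartials K
  moments : ∃ μ₂ : ℝ, ∀ i j : Fin 2, ∫ x, K x * (x i * x j) = if i = j then μ₂ else 0

/-- `∫ d²K (d²K)ᵀ` is finite. -/
def FiniteEnergy (K : Plane → ℝ) : Prop :=
  ∀ i j : Fin 3, Integrable (fun x => d2 K x i * d2 K x j)

/-- `h_n > 0`, `h_n → 0`, `n h_n⁸ / (log n)³ → ∞`, and `n h_n⁹ → β` for some `β ≥ 0`. -/
structure Bandwidth (h : ℕ → ℝ) : Prop where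
  pos : ∀ n, 0 < h n
  tendsto_zero : Tendsto h atTop (𝓝 0)
  lower : Tendsto (fun n : ℕ => (n : ℝ) * h n ^ 8 / Real.log n ^ 3) atTop atTop
  upper : ∃ β : ℝ, 0 ≤ β ∧ Tendsto (fun n : ℕ => (n : ℝ) * h n ^ 9) atTop (𝓝 β)

/-! ### The sample and the kernel estimators -/

/-- `ξ 0, ξ 1, …` are independent random points with density `f`. -/
structure IsSample {Ω : Type*} [MeasurableSpace Ω] (P : Measure Ω) (f : Plane → ℝ)
    (ξ : ℕ → Ω → Plane) : Prop where
  measurable : ∀ i, Measurable (ξ i)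
  indep : iIndepFun ξ P
  law : ∀ i, P.map (ξ i) = volume.withDensity (fun x => ENNReal.ofReal (f x))

/-- The kernel density estimator
`f̂(x) = (n h²)⁻¹ ∑_{i < n} K ((x - ξ i) / h)`, with `h = h_n`. -/
def fHat {Ω : Type*} (K : Plane → ℝ) (h : ℕ → ℝ) (ξ : ℕ → Ω → Plane) (n : ℕ) (ω : Ω) :
    Plane → ℝ :=
  fun x => (1 / ((n : ℝ) * h n ^ 2)) * ∑ i ∈ Finset.range n, K ((h n)⁻¹ • (x - ξ i ω))

/-- `φ̂_{1n}(x) = ã'(x)⁻¹ ∇f(x)ᵀ ∇G(d²f(x)) (d²f̂(x) - 𝔼 d²f̂(x))`. -/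
def phi1 {Ω : Type*} [MeasurableSpace Ω] (P : Measure Ω) (f K : Plane → ℝ) (h : ℕ → ℝ)
    (ξ : ℕ → Ω → Plane) (n : ℕ) (ω : Ω) (x : Plane) : ℝ :=
  1 / aTilde' f x * inner ℝ (gradient f x)
    (fderiv ℝ G (d2 f x) (d2 (fHat K h ξ n ω) x - ∫ ω', d2 (fHat K h ξ n ω') x ∂P))

/-- The bias `(𝔼 ∇f̂ - ∇f)(x)` of the gradient estimator. -/
def gradBias {Ω : Type*} [MeasurableSpace Ω] (P : Measure Ω) (f K : Plane → ℝ) (h : ℕ → ℝ)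
    (ξ : ℕ → Ω → Plane) (n : ℕ) (x : Plane) : Plane :=
  (∫ ω', gradient (fHat K h ξ n ω') x ∂P) - gradient f x

/-- `V(x) V(x)ᵀ`. -/
def PV (f : Plane → ℝ) (x : Plane) : Matrix (Fin 2) (Fin 2) ℝ :=
  Matrix.vecMulVec (V f x) (V f x)

/-- `Γ = ã'(x)⁻¹ V(x) V(x)ᵀ ∇²f(x) - I` at the point `x` of the curve. -/
def Gam (f : Plane → ℝ) (x : Plane) : Matrix (Fin 2) (Fin 2) ℝ :=
  (aTilde' f x)⁻¹ • (PV f x * hess f x) - 1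

/-- `sup_{x ∈ S} ‖Z_n(x)‖ = O_p(r_n)`. No measurability of the supremum is presupposed: `P` of a set
that is not measurable is its outer measure. -/
def UnifBigOp {Ω : Type*} [MeasurableSpace Ω] (P : Measure Ω) (S : Set Plane)
    (Z : ℕ → Ω → Plane → Plane) (r : ℕ → ℝ) : Prop :=
  ∀ ε : ℝ, 0 < ε → ∃ M : ℝ, ∀ᶠ n in atTop,
    P {ω | ∃ x ∈ S, M * r n < ‖Z n ω x‖} ≤ ENNReal.ofReal ε

end Filament

end

/-!
Write `g` for the kernel estimator, `p = X f x θ` for the filament point that is reached from `x`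
at the time `θ = theta f x`, and `q = X g x θ` for the point of the estimated curve at the same
time. The slope `⟨∇f, V⟩` vanishes at `p` and grows along the curve at the rate `ã'(p) ≠ 0`, by
transversality (`fderiv_slope_V`, `Model.exists_local`). Compactness and the absence of degenerate
points show that no other point of the arc that is searched can be mistaken for `p`
(`Model.exists_separation`). Hence, if `g` is close to `f` up to the third derivatives, the
estimated hitting time `τ` exists, is close to `θ`, and satisfies `⟨∇g, V g⟩ (X g x τ) = 0`
(`Model.exists_hat_near`). One Newton step from `q` gives `τ - θ`, and with it the two expansions of
`X g x τ` (`Model.exists_expansion`): around `p` in general, and around `q` where `∇f (p) = 0`, in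
which case the third derivatives drop out of the remainder.

The remainders are as small as claimed because the curves average the error of the vector field.
The pointwise error of the second derivatives is of the order `√(log n / (n h⁶))`, but a curve stays
within distance `h` of a given point only for a time `O(h)` (this is the chord condition), so that
integrals of the error along the curves are of the order `√(log n / (n h⁵))`
(`KernelBounds.exists_curve_rate`). By Grönwall's inequality in the integrated form
`IsCurve.norm_sub_le_of_integral` this is then the order of `q - p`
(`SmoothBounds.exists_V_taylor` linearizes the error of the vector field).

The stochastic input is one concentration inequality, `exists_uniform_concentration`: Chernoff's
bound for the empirical mean of one function, and a union bound over a grid for a family of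
functions with polynomially large Lipschitz constants. It is applied to the rescaled kernel and to
its integrals along curves. The bias is of the order `h²`, by integration by parts and the symmetry
of the kernel (`KernelBounds.abs_bias_le_sq`). Since `n h⁹` is bounded, the bias and the deviation
`√(log n / (n h⁴))` of the gradient are absorbed by the remainders (`Regime.rate_le`,
`Regime.pow_le_rate`).
-/

open MeasureTheory ProbabilityTheory Filter Topology

noncomputable section

open scoped NNReal

namespace Filament

/-! ### The eigenvector map and the eigenvalue map -/

/-- The linear map `ℝ³ → ℝ²` whose norm is the gap `√((w - u)² + 4 v²)` between the eigenvalues of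
the symmetric matrix with entries `u, v; v, w`. -/
def gapMap : Space3 →L[ℝ] Plane :=
  LinearMap.toContinuousLinearMap
    { toFun := fun p => !₂[p 2 - p 0, 2 * p 1]
      map_add' := fun p q => by ext i; fin_cases i <;> simp <;> ring
      map_smul' := fun c p => by ext i; fin_cases i <;> simp <;> ring }

/-- The linear part of `G`. -/
def linPart : Space3 →L[ℝ] Plane :=
  LinearMap.toContinuousLinearMap
    { toFun := fun p => !₂[2 * p 0 - 2 * p 2 + 2 * p 1, p 2 - p 0 + 4 * p 1]
      map_add' := fun p q => by ext i; fin_cases i <;> simp <;> ring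
      map_smul' := fun c p => by ext i; fin_cases i <;> simp <;> ring }

/-- Half the trace of the symmetric matrix with entries `u, v; v, w`. -/
def halfTrace : Space3 →L[ℝ] ℝ :=
  LinearMap.toContinuousLinearMap
    { toFun := fun p => (p 0 + p 2) / 2
      map_add' := fun p q => by simp; ring
      map_smul' := fun c p => by simp; ring }

lemma norm_gapMap (p : Space3) : ‖gapMap p‖ = √((p 2 - p 0) ^ 2 + 4 * p 1 ^ 2) := by
  rw [EuclideanSpace.norm_eq]
  congr 1
  simp [gapMap, Fin.sum_univ_two]
  ring

lemma G_eq (p : Space3) : G p = linPart p - ‖gapMap p‖ • (!₂[2, 1] : Plane) := by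
  rw [norm_gapMap]
  ext i
  fin_cases i <;> simp [G, linPart]
  ring

lemma J_eq (p : Space3) : J p = halfTrace p - ‖gapMap p‖ / 2 := by
  rw [norm_gapMap]
  simp only [J, halfTrace, LinearMap.coe_toContinuousLinearMap', LinearMap.coe_mk, AddHom.coe_mk]
  rw [show (p 0 - p 2) ^ 2 = (p 2 - p 0) ^ 2 by ring]
  ring

lemma exists_norm_G_sub_le : ∃ C : ℝ, 0 ≤ C ∧ ∀ p q, ‖G p - G q‖ ≤ C * ‖p - q‖ := by
  refine ⟨‖linPart‖ + ‖gapMap‖ * ‖(!₂[2, 1] : Plane)‖, by positivity, fun p q => ?_⟩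
  have e : G p - G q
      = linPart (p - q) - (‖gapMap p‖ - ‖gapMap q‖) • (!₂[2, 1] : Plane) := by
    rw [G_eq, G_eq, map_sub, sub_smul]; abel
  rw [e]
  refine (norm_sub_le _ _).trans ?_
  have h1 := linPart.le_opNorm (p - q)
  have h2 : |‖gapMap p‖ - ‖gapMap q‖| ≤ ‖gapMap‖ * ‖p - q‖ := by
    refine (abs_norm_sub_norm_le _ _).trans ?_
    rw [← map_sub]; exact gapMap.le_opNorm _
  rw [norm_smul, Real.norm_eq_abs]
  nlinarith [mul_le_mul_of_nonneg_right h2 (norm_nonneg (!₂[2, 1] : Plane))]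

lemma exists_abs_J_sub_le : ∃ C : ℝ, 0 ≤ C ∧ ∀ p q, |J p - J q| ≤ C * ‖p - q‖ := by
  refine ⟨‖halfTrace‖ + ‖gapMap‖, by positivity, fun p q => ?_⟩
  have e : J p - J q = halfTrace (p - q) - (‖gapMap p‖ - ‖gapMap q‖) / 2 := by
    rw [J_eq, J_eq, map_sub]; ring
  rw [e]
  refine (abs_sub _ _).trans ?_
  have h1 := halfTrace.le_opNorm (p - q)
  rw [Real.norm_eq_abs] at h1
  have h2 : |‖gapMap p‖ - ‖gapMap q‖| ≤ ‖gapMap‖ * ‖p - q‖ := by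
    refine (abs_norm_sub_norm_le _ _).trans ?_
    rw [← map_sub]; exact gapMap.le_opNorm _
  have h3 : |(‖gapMap p‖ - ‖gapMap q‖) / 2| ≤ ‖gapMap‖ * ‖p - q‖ := by
    rw [abs_div, abs_two]
    linarith [abs_nonneg (‖gapMap p‖ - ‖gapMap q‖)]
  linarith

lemma continuous_J : Continuous J := by
  obtain ⟨C, hC, h⟩ := exists_abs_J_sub_le
  have : LipschitzWith C.toNNReal J := LipschitzWith.of_dist_le' fun p q => by
    simpa [dist_eq_norm] using h p q
  exact this.continuous

lemma contDiffAt_G {p : Space3} (hp : gapMap p ≠ 0) (n : WithTop ℕ∞) : ContDiffAt ℝ n G p := by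
  have h : ContDiffAt ℝ n (fun q => linPart q - ‖gapMap q‖ • (!₂[2, 1] : Plane)) p :=
    linPart.contDiff.contDiffAt.sub
      (((contDiffAt_norm ℝ hp).comp p gapMap.contDiff.contDiffAt).smul contDiffAt_const)
  exact h.congr_of_eventuallyEq (Eventually.of_forall G_eq)

lemma differentiableAt_G {p : Space3} (hp : gapMap p ≠ 0) : DifferentiableAt ℝ G p :=
  (contDiffAt_G hp 1).differentiableAt (by norm_num)

/-- `G p` is an eigenvector for the eigenvalue `J p`: the first row of the eigenvalue equation. -/
lemma eigen_fst (p : Space3) : p 0 * G p 0 + p 1 * G p 1 = J p * G p 0 := by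
  have hs := Real.sq_sqrt (show 0 ≤ (p 2 - p 0) ^ 2 + 4 * p 1 ^ 2 by positivity)
  have e : (p 0 - p 2) ^ 2 = (p 2 - p 0) ^ 2 := by ring
  simp only [G, J, e]
  set s := √((p 2 - p 0) ^ 2 + 4 * p 1 ^ 2)
  simp
  linear_combination (-1 : ℝ) * hs

/-- `G p` is an eigenvector for the eigenvalue `J p`: the second row of the eigenvalue equation. -/
lemma eigen_snd (p : Space3) : p 1 * G p 0 + p 2 * G p 1 = J p * G p 1 := by
  have hs := Real.sq_sqrt (show 0 ≤ (p 2 - p 0) ^ 2 + 4 * p 1 ^ 2 by positivity)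
  have e : (p 0 - p 2) ^ 2 = (p 2 - p 0) ^ 2 := by ring
  simp only [G, J, e]
  set s := √((p 2 - p 0) ^ 2 + 4 * p 1 ^ 2)
  simp
  linear_combination (-1 / 2 : ℝ) * hs

/-- Around a compact set of matrices without double eigenvalue, `G` has a Lipschitz derivative, with
uniform constants. -/
lemma exists_G_bounds {C : Set Space3} (hC : IsCompact C) (h0 : ∀ p ∈ C, gapMap p ≠ 0) :
    ∃ r > 0, ∃ K : ℝ, 0 ≤ K ∧ ∀ p ∈ C, ∀ q, ‖q - p‖ ≤ r → gapMap q ≠ 0 ∧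
      ‖fderiv ℝ G q - fderiv ℝ G p‖ ≤ K * ‖q - p‖ ∧
      ‖G q - G p - fderiv ℝ G p (q - p)‖ ≤ K * ‖q - p‖ ^ 2 := by
  have hU : IsOpen {p : Space3 | gapMap p ≠ 0} :=
    isOpen_ne_fun gapMap.continuous continuous_const
  obtain ⟨r, hr, hrU⟩ := hC.exists_cthickening_subset_open hU h0
  have hN : IsCompact (Metric.cthickening r C) := hC.cthickening
  have hll : LocallyLipschitzOn (Metric.cthickening r C) (fderiv ℝ G) := by
    intro p hp
    have hc : ContDiffAt ℝ 1 (fderiv ℝ G) p :=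
      (contDiffAt_G (hrU hp) 2).fderiv_right (by norm_num)
    obtain ⟨K, t, ht, hK⟩ := hc.exists_lipschitzOnWith
    exact ⟨K, t, mem_nhdsWithin_of_mem_nhds ht, hK⟩
  obtain ⟨K, hK⟩ := hll.exists_lipschitzOnWith_of_compact hN
  have hball : ∀ p ∈ C, Metric.closedBall p r ⊆ Metric.cthickening r C := fun p hp =>
    Metric.closedBall_subset_cthickening hp r
  refine ⟨r, hr, K, K.2, fun p hp q hq => ?_⟩
  have hq' : q ∈ Metric.closedBall p r := by simpa [dist_eq_norm] using hq
  have hp' : p ∈ Metric.closedBall p r := Metric.mem_closedBall_self hr.le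
  have hL : ∀ q ∈ Metric.closedBall p r, ‖fderiv ℝ G q - fderiv ℝ G p‖ ≤ K * ‖q - p‖ :=
    fun q hq => by
      simpa [dist_eq_norm] using hK.dist_le_mul q (hball p hp hq) p (hball p hp hp')
  refine ⟨hrU (hball p hp hq'), hL q hq', ?_⟩
  have hseg : ∀ z ∈ segment ℝ p q, ‖z - p‖ ≤ ‖q - p‖ := fun z hz => by
    obtain ⟨t, ht, rfl⟩ := (segment_eq_image' ℝ p q ▸ hz :)
    simp only [add_sub_cancel_left, norm_smul, Real.norm_eq_abs, abs_of_nonneg ht.1]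
    exact mul_le_of_le_one_left (norm_nonneg _) ht.2
  have hsub : ∀ z ∈ segment ℝ p q, z ∈ Metric.closedBall p r := fun z hz => by
    simpa [dist_eq_norm] using (hseg z hz).trans hq
  have := (convex_segment p q).norm_image_sub_le_of_norm_hasFDerivWithin_le' (f := G)
    (f' := fderiv ℝ G) (φ := fderiv ℝ G p) (C := K * ‖q - p‖)
    (fun z hz =>
      ((differentiableAt_G (hrU (hball p hp (hsub z hz)))).hasFDerivAt).hasFDerivWithinAt)
    (fun z hz => (hL z (hsub z hz)).trans (by gcongr; exact hseg z hz))
    (left_mem_segment ℝ p q) (right_mem_segment ℝ p q)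
  rw [pow_two, ← mul_assoc]
  exact this

lemma norm_plane_le (v : Plane) : ‖v‖ ≤ |v 0| + |v 1| := by
  rw [EuclideanSpace.norm_eq, Fin.sum_univ_two]
  refine Real.sqrt_le_iff.2 ⟨by positivity, ?_⟩
  simp only [Real.norm_eq_abs]
  nlinarith [abs_nonneg (v 0), abs_nonneg (v 1)]

lemma norm_space3_le (v : Space3) : ‖v‖ ≤ |v 0| + |v 1| + |v 2| := by
  rw [EuclideanSpace.norm_eq, Fin.sum_univ_three]
  refine Real.sqrt_le_iff.2 ⟨by positivity, ?_⟩
  simp only [Real.norm_eq_abs]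
  nlinarith [abs_nonneg (v 0), abs_nonneg (v 1), abs_nonneg (v 2),
    mul_nonneg (abs_nonneg (v 0)) (abs_nonneg (v 1)),
    mul_nonneg (abs_nonneg (v 0)) (abs_nonneg (v 2)),
    mul_nonneg (abs_nonneg (v 1)) (abs_nonneg (v 2))]

lemma abs_apply_le_norm {n : ℕ} (v : EuclideanSpace ℝ (Fin n)) (i : Fin n) : |v i| ≤ ‖v‖ :=
  PiLp.norm_apply_le v i

/-! ### Iterated partial derivatives -/

/-- The iterated partial derivative of `g` along the coordinates listed in `w`, the last entry of
`w` being the innermost derivative. -/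
def wordD (w : List (Fin 2)) (g : Plane → ℝ) : Plane → ℝ := w.foldr partialD g

@[simp] lemma wordD_nil (g : Plane → ℝ) : wordD [] g = g := rfl

lemma wordD_cons (i : Fin 2) (w : List (Fin 2)) (g : Plane → ℝ) :
    wordD (i :: w) g = partialD i (wordD w g) := rfl

/-- All iterated partial derivatives of order less than `n` are differentiable. -/
def DiffUpTo (n : ℕ) (g : Plane → ℝ) : Prop :=
  ∀ w : List (Fin 2), w.length < n → Differentiable ℝ (wordD w g)

lemma clm_apply_eq {F : Type*} [NormedAddCommGroup F] [NormedSpace ℝ F] (A : Plane →L[ℝ] F)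
    (v : Plane) :
    A v = v 0 • A (EuclideanSpace.single 0 1) + v 1 • A (EuclideanSpace.single 1 1) := by
  rw [← map_smul, ← map_smul, ← map_add]
  congr 1
  ext i
  fin_cases i <;> simp

lemma clm_norm_le {F : Type*} [NormedAddCommGroup F] [NormedSpace ℝ F] (A : Plane →L[ℝ] F) :
    ‖A‖ ≤ ‖A (EuclideanSpace.single 0 1)‖ + ‖A (EuclideanSpace.single 1 1)‖ := by
  refine A.opNorm_le_bound (by positivity) fun v => ?_
  rw [clm_apply_eq A v]
  refine (norm_add_le _ _).trans ?_
  rw [norm_smul, norm_smul, add_mul, Real.norm_eq_abs, Real.norm_eq_abs,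
    mul_comm ‖A _‖ ‖v‖, mul_comm ‖A _‖ ‖v‖]
  gcongr
  · exact abs_apply_le_norm v 0
  · exact abs_apply_le_norm v 1

lemma fderiv_apply_eq (g : Plane → ℝ) (x v : Plane) :
    fderiv ℝ g x v = v 0 * partialD 0 g x + v 1 * partialD 1 g x :=
  clm_apply_eq (fderiv ℝ g x) v

lemma differentiable_fderiv_of_partialD {g : Plane → ℝ}
    (h : ∀ i, Differentiable ℝ (partialD i g)) : Differentiable ℝ (fderiv ℝ g) := by
  have e : fderiv ℝ g = fun x =>
      partialD 0 g x • (EuclideanSpace.proj 0 : Plane →L[ℝ] ℝ)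
        + partialD 1 g x • (EuclideanSpace.proj 1 : Plane →L[ℝ] ℝ) := by
    funext x
    ext1 v
    rw [fderiv_apply_eq]
    simp [mul_comm]
  rw [e]
  exact ((h 0).smul_const _).add ((h 1).smul_const _)

lemma partialD_partialD {g : Plane → ℝ} (h : Differentiable ℝ (fderiv ℝ g)) (i j : Fin 2)
    (x : Plane) : partialD i (partialD j g) x
      = fderiv ℝ (fderiv ℝ g) x (EuclideanSpace.single i 1) (EuclideanSpace.single j 1) := by
  have := ((h x).hasFDerivAt.clm_apply
    (hasFDerivAt_const (EuclideanSpace.single j (1 : ℝ) : Plane) x)).fderiv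
  change fderiv ℝ (fun y => fderiv ℝ g y (EuclideanSpace.single j 1)) x _ = _
  rw [this]
  simp

/-- Symmetry of second derivatives, without continuity of the second derivative. -/
lemma partialD_comm {g : Plane → ℝ} (hg : Differentiable ℝ g)
    (h : ∀ i, Differentiable ℝ (partialD i g)) (i j : Fin 2) :
    partialD i (partialD j g) = partialD j (partialD i g) := by
  have h2 := differentiable_fderiv_of_partialD h
  funext x
  rw [partialD_partialD h2, partialD_partialD h2]
  exact second_derivative_symmetric (𝕜 := ℝ) (fun y => (hg y).hasFDerivAt) (h2 x).hasFDerivAt _ _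

lemma wordD_perm {g : Plane → ℝ} {w w' : List (Fin 2)} (p : w.Perm w')
    (hg : DiffUpTo w.length g) : wordD w g = wordD w' g := by
  induction p with
  | nil => rfl
  | cons i p ih =>
    rw [wordD_cons, wordD_cons, ih fun v hv => hg v (by simp; lia)]
  | swap i j l =>
    rw [wordD_cons, wordD_cons, wordD_cons, wordD_cons]
    exact partialD_comm (hg l (by simp)) (fun k => hg (k :: l) (by simp)) _ _
  | trans p q ih1 ih2 => rw [ih1 hg, ih2 fun v hv => hg v (by rwa [p.length_eq])]

lemma pd_eq_wordD (i j : ℕ) (g : Plane → ℝ) :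
    pd i j g = wordD (List.replicate i 0 ++ List.replicate j 1) g := by
  have key : ∀ (k : Fin 2) (m : ℕ) (u : Plane → ℝ),
      (partialD k)^[m] u = wordD (List.replicate m k) u := by
    intro k m u
    induction m with
    | zero => rfl
    | succ m ih => rw [Function.iterate_succ_apply', ih, List.replicate_succ, wordD_cons]
  rw [pd, key, key]
  simp only [wordD, List.foldr_append]

lemma BoundedPartials.wordD {g : Plane → ℝ} (hb : BoundedPartials g) (hg : DiffUpTo 4 g)
    (w : List (Fin 2)) (h1 : 1 ≤ w.length) (h4 : w.length ≤ 4) :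
    ∃ C : ℝ, ∀ x, |Filament.wordD w g x| ≤ C := by
  have hlen : w.count 0 + w.count 1 = w.length := by
    clear h1 h4
    induction w with
    | nil => rfl
    | cons i w ih => fin_cases i <;> simp <;> lia
  have hp : w.Perm (List.replicate (w.count 0) 0 ++ List.replicate (w.count 1) 1) := by
    rw [List.perm_iff_count]
    intro a
    fin_cases a <;> simp [List.count_replicate]
  obtain ⟨C, hC⟩ := hb (w.count 0) (w.count 1) (by lia) (by lia)
  refine ⟨C, fun x => ?_⟩
  rw [wordD_perm hp fun v hv => hg v (by lia), ← pd_eq_wordD]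
  exact hC x

lemma ContDiff.wordD {g : Plane → ℝ} (w : List (Fin 2)) {m : ℕ}
    (hg : ContDiff ℝ ((m + w.length : ℕ) : WithTop ℕ∞) g) :
    ContDiff ℝ (m : WithTop ℕ∞) (Filament.wordD w g) := by
  induction w generalizing m with
  | nil => simpa using hg
  | cons i w ih =>
    have h1 : ContDiff ℝ ((m + 1 : ℕ) : WithTop ℕ∞) (Filament.wordD w g) :=
      ih (by rw [List.length_cons] at hg; convert hg using 2; lia)
    rw [wordD_cons]
    exact (h1.fderiv_right (m := (m : WithTop ℕ∞)) (by push_cast; exact le_rfl)).clm_apply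
      contDiff_const

lemma ContDiff.diffUpTo {g : Plane → ℝ} {n : ℕ} (hg : ContDiff ℝ (n : WithTop ℕ∞) g) :
    DiffUpTo n g := fun w hw =>
  (ContDiff.wordD (m := 1) w
    (hg.of_le (by exact_mod_cast (by lia : 1 + w.length ≤ n)))).differentiable (by norm_num)

lemma wordD_eq_iteratedFDeriv {g : Plane → ℝ} {n : ℕ} (hg : ContDiff ℝ (n : WithTop ℕ∞) g)
    (w : List (Fin 2)) (hw : w.length ≤ n) (x : Plane) :
    wordD w g x
      = iteratedFDeriv ℝ w.length g x fun k => EuclideanSpace.single (w.get k) (1 : ℝ) := by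
  induction w generalizing x with
  | nil => simp
  | cons i w ih =>
    rw [List.length_cons] at hw
    have hfun : wordD w g = fun y =>
        iteratedFDeriv ℝ w.length g y fun k => EuclideanSpace.single (w.get k) (1 : ℝ) :=
      funext fun y => ih (by lia) y
    have hd : DifferentiableAt ℝ (iteratedFDeriv ℝ w.length g) x :=
      (hg.differentiable_iteratedFDeriv (by exact_mod_cast hw)) x
    rw [wordD_cons, hfun]
    simp only [partialD, List.length_cons]
    rw [iteratedFDeriv_succ_apply_left]
    have := (hd.hasFDerivAt.continuousMultilinear_apply_const
      fun k => EuclideanSpace.single (w.get k) (1 : ℝ)).fderiv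
    rw [this]
    rfl

lemma diffUpTo_four_of_iteratedFDeriv {g : Plane → ℝ} (hg : ContDiff ℝ 3 g)
    (hd : Differentiable ℝ (iteratedFDeriv ℝ 3 g)) : DiffUpTo 4 g := by
  intro w hw
  rcases Nat.lt_succ_iff_lt_or_eq.1 hw with h | h
  · exact ContDiff.diffUpTo (n := 3) (by exact_mod_cast hg) w h
  · have hfun : wordD w g = fun y =>
        iteratedFDeriv ℝ w.length g y fun k => EuclideanSpace.single (w.get k) (1 : ℝ) :=
      funext fun y => wordD_eq_iteratedFDeriv (n := 3) (by exact_mod_cast hg) w h.le y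
    rw [hfun]
    have hd' : Differentiable ℝ (iteratedFDeriv ℝ w.length g) := by rw [h]; exact hd
    exact fun x => ((hd' x).hasFDerivAt.continuousMultilinear_apply_const _).differentiableAt

/-! ### The vector of second derivatives -/

lemma d2_eq (g : Plane → ℝ) (x : Plane) :
    d2 g x = !₂[wordD [0, 0] g x, wordD [0, 1] g x, wordD [1, 1] g x] := rfl

lemma contDiff_d2 {g : Plane → ℝ} {m : ℕ} (hg : ContDiff ℝ ((m + 2 : ℕ) : WithTop ℕ∞) g) :
    ContDiff ℝ (m : WithTop ℕ∞) (d2 g) := by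
  rw [contDiff_euclidean]
  intro i
  fin_cases i
  · exact ContDiff.wordD [0, 0] hg
  · exact ContDiff.wordD [0, 1] hg
  · exact ContDiff.wordD [1, 1] hg

lemma fderiv_d2_single {g : Plane → ℝ} (hg : ContDiff ℝ 3 g) (x : Plane) (i : Fin 2) :
    fderiv ℝ (d2 g) x (EuclideanSpace.single i 1)
      = !₂[wordD [i, 0, 0] g x, wordD [i, 0, 1] g x, wordD [i, 1, 1] g x] := by
  have hd : DifferentiableAt ℝ (d2 g) x :=
    ((contDiff_d2 (m := 1) (by exact_mod_cast hg)).differentiable (by norm_num)) x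
  have key : ∀ l : Fin 3, fderiv ℝ (d2 g) x (EuclideanSpace.single i 1) l
      = partialD i (fun y => d2 g y l) x := by
    intro l
    have h := ((EuclideanSpace.proj l : Space3 →L[ℝ] ℝ).hasFDerivAt.comp x hd.hasFDerivAt).fderiv
    change _ = fderiv ℝ (⇑(EuclideanSpace.proj l : Space3 →L[ℝ] ℝ) ∘ d2 g) x _
    rw [h]
    rfl
  ext l
  rw [key]
  fin_cases l <;> rfl

lemma norm_fderiv_d2_sub_le {g f : Plane → ℝ} (hg : ContDiff ℝ 3 g) (hf : ContDiff ℝ 3 f)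
    {x y : Plane} {e : ℝ} (h : ∀ w : List (Fin 2), w.length = 3 → |wordD w g x - wordD w f y| ≤ e) :
    ‖fderiv ℝ (d2 g) x - fderiv ℝ (d2 f) y‖ ≤ 6 * e := by
  refine (clm_norm_le _).trans ?_
  have key : ∀ i : Fin 2,
      ‖(fderiv ℝ (d2 g) x - fderiv ℝ (d2 f) y) (EuclideanSpace.single i 1)‖ ≤ 3 * e := by
    intro i
    refine (norm_space3_le _).trans ?_
    rw [sub_apply, fderiv_d2_single hg, fderiv_d2_single hf]
    have h0 := h [i, 0, 0] rfl
    have h1 := h [i, 0, 1] rfl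
    have h2 := h [i, 1, 1] rfl
    simp
    linarith
  linarith [key 0, key 1]

lemma norm_d2_sub_le {g f : Plane → ℝ} {x y : Plane} {e : ℝ}
    (h : ∀ w : List (Fin 2), w.length = 2 → |wordD w g x - wordD w f y| ≤ e) :
    ‖d2 g x - d2 f y‖ ≤ 3 * e := by
  refine (norm_space3_le _).trans ?_
  rw [d2_eq, d2_eq]
  have h0 := h [0, 0] rfl
  have h1 := h [0, 1] rfl
  have h2 := h [1, 1] rfl
  simp
  linarith

lemma norm_fderiv_sub_le {g f : Plane → ℝ} {x y : Plane} {e : ℝ}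
    (h : ∀ w : List (Fin 2), w.length = 1 → |wordD w g x - wordD w f y| ≤ e) :
    ‖fderiv ℝ g x - fderiv ℝ f y‖ ≤ 2 * e := by
  refine (clm_norm_le _).trans ?_
  have h0 := h [0] rfl
  have h1 := h [1] rfl
  simp only [wordD_cons, wordD_nil, partialD] at h0 h1
  simp only [sub_apply, Real.norm_eq_abs]
  linarith

lemma inner_plane (v w : Plane) : inner ℝ v w = v 0 * w 0 + v 1 * w 1 := by
  simp [PiLp.inner_apply, Fin.sum_univ_two, mul_comm]

lemma inner_gradient (g : Plane → ℝ) (x v : Plane) :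
    inner ℝ (gradient g x) v = fderiv ℝ g x v := by
  simp [gradient]

/-- The Hessian as a bilinear form, in terms of `d²`. -/
lemma fderiv_fderiv_apply {g : Plane → ℝ} (hg : ContDiff ℝ 2 g) (x v w : Plane) :
    fderiv ℝ (fderiv ℝ g) x v w
      = v 0 * w 0 * d2 g x 0 + (v 0 * w 1 + v 1 * w 0) * d2 g x 1 + v 1 * w 1 * d2 g x 2 := by
  have hD : DiffUpTo 2 g := ContDiff.diffUpTo (by exact_mod_cast hg)
  have hd : Differentiable ℝ (fderiv ℝ g) :=
    differentiable_fderiv_of_partialD fun i => hD [i] (by simp)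
  have hc : wordD [1, 0] g x = wordD [0, 1] g x := by
    exact congrFun (wordD_perm (List.Perm.swap 0 1 []) hD) x
  have h := fun i j => partialD_partialD hd i j x
  rw [clm_apply_eq (fderiv ℝ (fderiv ℝ g) x) v]
  simp only [add_apply, smul_apply]
  rw [clm_apply_eq _ w, clm_apply_eq (fderiv ℝ (fderiv ℝ g) x (EuclideanSpace.single 1 1)) w]
  simp only [← h, smul_eq_mul]
  have e0 : d2 g x 0 = partialD 0 (partialD 0 g) x := rfl
  have e1 : d2 g x 1 = partialD 0 (partialD 1 g) x := rfl
  have e2 : d2 g x 2 = partialD 1 (partialD 1 g) x := rfl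
  have e3 : partialD 1 (partialD 0 g) x = partialD 0 (partialD 1 g) x := hc
  rw [e0, e1, e2, e3]
  ring

/-- `V` is an eigenvector of the Hessian for the eigenvalue `λ₂`. -/
lemma fderiv_fderiv_V {g : Plane → ℝ} (hg : ContDiff ℝ 2 g) (x v : Plane) :
    fderiv ℝ (fderiv ℝ g) x v (V g x) = lam2 g x * inner ℝ v (V g x) := by
  rw [fderiv_fderiv_apply hg, inner_plane]
  have h0 := eigen_fst (d2 g x)
  have h1 := eigen_snd (d2 g x)
  simp only [V, lam2]
  linear_combination v 0 * h0 + v 1 * h1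

lemma slope_eq (g : Plane → ℝ) (x : Plane) : slope g x = fderiv ℝ g x (V g x) :=
  inner_gradient _ _ _

lemma aTilde'_eq (g : Plane → ℝ) (x : Plane) :
    aTilde' g x = fderiv ℝ g x (fderiv ℝ (V g) x (V g x)) + lam2 g x * ‖V g x‖ ^ 2 := by
  rw [aTilde', inner_gradient]

lemma hasFDerivAt_V {g : Plane → ℝ} (hg : ContDiff ℝ 3 g) {x : Plane}
    (hx : gapMap (d2 g x) ≠ 0) :
    HasFDerivAt (V g) ((fderiv ℝ G (d2 g x)).comp (fderiv ℝ (d2 g) x)) x :=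
  (differentiableAt_G hx).hasFDerivAt.comp x
    (((contDiff_d2 (m := 1) (by exact_mod_cast hg)).differentiable (by norm_num)) x).hasFDerivAt

lemma hasFDerivAt_slope {g : Plane → ℝ} (hg : ContDiff ℝ 3 g) {x : Plane}
    (hx : gapMap (d2 g x) ≠ 0) :
    HasFDerivAt (slope g)
      ((fderiv ℝ g x).comp (fderiv ℝ (V g) x) + (fderiv ℝ (fderiv ℝ g) x).flip (V g x)) x := by
  have h1 : HasFDerivAt (fderiv ℝ g) (fderiv ℝ (fderiv ℝ g) x) x :=
    ((hg.fderiv_right (m := 1) (by norm_num)).differentiable (by norm_num) x).hasFDerivAt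
  have h2 := (hasFDerivAt_V hg hx).differentiableAt.hasFDerivAt
  exact (h1.clm_apply h2).congr_of_eventuallyEq (Eventually.of_forall (slope_eq g))

/-- `ã'` is the derivative of the slope along `V`. -/
lemma fderiv_slope_V {g : Plane → ℝ} (hg : ContDiff ℝ 3 g) {x : Plane}
    (hx : gapMap (d2 g x) ≠ 0) : fderiv ℝ (slope g) x (V g x) = aTilde' g x := by
  rw [(hasFDerivAt_slope hg hx).fderiv, aTilde'_eq]
  simp only [add_apply, ContinuousLinearMap.comp_apply,
    ContinuousLinearMap.flip_apply]
  rw [fderiv_fderiv_V (hg.of_le (by norm_num)), real_inner_self_eq_norm_sq]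

/-- A Hessian with two distinct eigenvalues has a positive eigenvalue gap. -/
lemma gapMap_ne_zero_of_eigenvalues {g : Plane → ℝ} {x : Plane}
    (h : ∃ a b : ℝ, a ≠ b ∧ Module.End.HasEigenvalue (Matrix.toLin' (hess g x)) a ∧
      Module.End.HasEigenvalue (Matrix.toLin' (hess g x)) b) : gapMap (d2 g x) ≠ 0 := by
  intro h0
  have e0 : pd 0 2 g x - pd 2 0 g x = 0 := by
    have := congrArg (fun v : Plane => v 0) h0
    simpa [gapMap, d2] using this
  have e1 : pd 1 1 g x = 0 := by
    have := congrArg (fun v : Plane => v 1) h0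
    simpa [gapMap, d2] using this
  have hs : hess g x = pd 2 0 g x • (1 : Matrix (Fin 2) (Fin 2) ℝ) := by
    ext i j
    fin_cases i <;> fin_cases j <;> simp [hess, e1]
    linarith
  have key : ∀ a : ℝ, Module.End.HasEigenvalue (Matrix.toLin' (hess g x)) a → a = pd 2 0 g x := by
    intro a ha
    obtain ⟨v, hv⟩ := ha.exists_hasEigenvector
    have h1 := hv.apply_eq_smul
    rw [hs] at h1
    simp only [map_smul, Matrix.toLin'_one, LinearMap.smul_apply, LinearMap.id_coe, id] at h1
    exact (smul_left_injective ℝ hv.2 h1).symm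
  obtain ⟨a, b, hab, ha, hb⟩ := h
  exact hab ((key a ha).trans (key b hb).symm)

/-! ### Integral curves of bounded Lipschitz fields -/

section Curves

variable {W W' : Plane → Plane} {M K : ℝ≥0}

lemma IsCurve.continuous {x : Plane} {γ : ℝ → Plane} (h : IsCurve W x γ) : Continuous γ :=
  continuous_iff_continuousAt.2 fun t => (h.2 t).continuousAt

lemma IsCurve.unique (hK : LipschitzWith K W) {x : Plane} {γ δ : ℝ → Plane}
    (hγ : IsCurve W x γ) (hδ : IsCurve W x δ) : γ = δ :=
  ODE_solution_unique_univ (v := fun _ => W) (s := fun _ => Set.univ) (t₀ := 0) (K := K)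
    (fun _ => hK.lipschitzOnWith) (fun t => ⟨hγ.2 t, trivial⟩) (fun t => ⟨hδ.2 t, trivial⟩)
    (hγ.1.trans hδ.1.symm)

lemma exists_isCurve (hM : ∀ x, ‖W x‖ ≤ M) (hK : LipschitzWith K W) (x : Plane) :
    ∃ γ, IsCurve W x γ := by
  have loc : ∀ T : ℝ≥0, ∃ α : ℝ → Plane, α 0 = x ∧
      ∀ t ∈ Set.Ioo (-(T : ℝ)) T, HasDerivAt α (W (α t)) t := by
    intro T
    have hT : (0 : ℝ) ∈ Set.Icc (-(T : ℝ)) T := by simp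
    have hp : IsPicardLindelof (fun _ => W) (⟨0, hT⟩ : Set.Icc (-(T : ℝ)) T) x (M * T) 0 M K :=
      IsPicardLindelof.of_time_independent (fun y _ => hM y) hK.lipschitzOnWith (by simp)
    obtain ⟨α, h0, hα⟩ := hp.exists_eq_forall_mem_Icc_hasDerivWithinAt₀
    exact ⟨α, h0, fun t ht =>
      (hα t (Set.Ioo_subset_Icc_self ht)).hasDerivAt (Icc_mem_nhds ht.1 ht.2)⟩
  choose α h0 hα using loc
  have agree : ∀ S T : ℝ≥0, S ≤ T → ∀ t ∈ Set.Ioo (-(S : ℝ)) S, α S t = α T t := by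
    intro S T hST t ht
    have hS : (0 : ℝ) < S := by have := ht.1.trans ht.2; linarith
    have hST' : (S : ℝ) ≤ T := hST
    refine ODE_solution_unique_of_mem_Ioo (v := fun _ => W) (s := fun _ => Set.univ) (t₀ := 0)
      (K := K) (fun _ _ => hK.lipschitzOnWith) ⟨by linarith, hS⟩
      (fun t ht => ⟨hα S t ht, trivial⟩) (fun t ht => ⟨hα T t ?_, trivial⟩)
      ((h0 S).trans (h0 T).symm) ht
    exact ⟨by linarith [ht.1], by linarith [ht.2]⟩
  set τ : ℝ → ℝ≥0 := fun t => ⟨|t| + 1, by positivity⟩ with hτ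
  have hmem : ∀ t, t ∈ Set.Ioo (-(τ t : ℝ)) (τ t) := fun t => by
    change t ∈ Set.Ioo (-(|t| + 1)) (|t| + 1)
    exact ⟨by linarith [neg_abs_le t], by linarith [le_abs_self t]⟩
  refine ⟨fun t => α (τ t) t, h0 _, fun t => ?_⟩
  refine (hα (τ t) t (hmem t)).congr_of_eventuallyEq ?_
  filter_upwards [Ioo_mem_nhds (hmem t).1 (hmem t).2] with s hs
  rcases le_total (τ s) (τ t) with h | h
  · exact agree _ _ h s (hmem s)
  · exact (agree _ _ h s hs).symm

lemma isCurve_curve (hM : ∀ x, ‖W x‖ ≤ M) (hK : LipschitzWith K W) (x : Plane) :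
    IsCurve W x (curve W x) := by
  have h := exists_isCurve hM hK x
  rw [curve, dif_pos h]
  exact h.choose_spec

lemma IsCurve.shift {x : Plane} {γ : ℝ → Plane} (h : IsCurve W x γ) (s : ℝ) :
    IsCurve W (γ s) fun t => γ (s + t) :=
  ⟨by simp, fun t => by
    simpa [Function.comp_def] using (h.2 (s + t)).scomp t ((hasDerivAt_id t).const_add s)⟩

lemma IsCurve.reverse {x : Plane} {γ : ℝ → Plane} (h : IsCurve W x γ) :
    IsCurve (fun y => -W y) x fun t => γ (-t) :=
  ⟨by simpa using h.1, fun t => by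
    simpa [Function.comp_def] using (h.2 (-t)).scomp t (hasDerivAt_neg t)⟩

lemma curve_curve (hM : ∀ x, ‖W x‖ ≤ M) (hK : LipschitzWith K W) (x : Plane) (s t : ℝ) :
    curve W (curve W x s) t = curve W x (s + t) :=
  congrFun (IsCurve.unique hK (isCurve_curve hM hK _) ((isCurve_curve hM hK x).shift s)) t

lemma IsCurve.norm_sub_le {C : ℝ} {x : Plane} {γ : ℝ → Plane} (h : IsCurve W x γ)
    {s t : ℝ} (hC : ∀ u ∈ Set.uIcc s t, ‖W (γ u)‖ ≤ C) : ‖γ t - γ s‖ ≤ C * |t - s| := by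
  have := (convex_uIcc s t).norm_image_sub_le_of_norm_hasDerivWithin_le
    (fun u _ => (h.2 u).hasDerivWithinAt) hC Set.left_mem_uIcc Set.right_mem_uIcc
  simpa using this

lemma norm_curve_sub_curve_le (hM : ∀ x, ‖W x‖ ≤ M) (hK : LipschitzWith K W) (x y : Plane)
    (t : ℝ) : ‖curve W x t - curve W y t‖ ≤ ‖x - y‖ * Real.exp (K * |t|) := by
  have key : ∀ {U : Plane → Plane} {γ δ : ℝ → Plane}, LipschitzWith K U →
      IsCurve U x γ → IsCurve U y δ → ∀ t : ℝ, 0 ≤ t →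
      ‖γ t - δ t‖ ≤ ‖x - y‖ * Real.exp (K * t) := by
    intro U γ δ hU hγ hδ t ht
    have := dist_le_of_trajectories_ODE (v := fun _ => U) (a := 0) (b := t) (K := K) (f := γ)
      (g := δ) (δ := ‖x - y‖) (fun _ => hU) hγ.continuous.continuousOn
      (fun t _ => (hγ.2 t).hasDerivWithinAt) hδ.continuous.continuousOn
      (fun t _ => (hδ.2 t).hasDerivWithinAt) (by rw [hγ.1, hδ.1, dist_eq_norm]) t ⟨ht, le_rfl⟩
    simpa [dist_eq_norm] using this
  rcases le_total 0 t with ht | ht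
  · rw [abs_of_nonneg ht]
    exact key hK (isCurve_curve hM hK x) (isCurve_curve hM hK y) t ht
  · rw [abs_of_nonpos ht]
    have := key hK.neg (isCurve_curve hM hK x).reverse (isCurve_curve hM hK y).reverse (-t)
      (by linarith)
    simpa using this

lemma continuous_curve (hM : ∀ x, ‖W x‖ ≤ M) (hK : LipschitzWith K W) :
    Continuous fun p : Plane × ℝ => curve W p.1 p.2 := by
  refine continuous_iff_continuousAt.2 fun p => ?_
  rw [ContinuousAt, tendsto_iff_norm_sub_tendsto_zero]
  have hb : ∀ q : Plane × ℝ, ‖curve W q.1 q.2 - curve W p.1 p.2‖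
      ≤ ‖q.1 - p.1‖ * Real.exp (K * |q.2|) + M * |q.2 - p.2| := by
    intro q
    have h1 := norm_curve_sub_curve_le hM hK q.1 p.1 q.2
    have h2 := (isCurve_curve hM hK p.1).norm_sub_le (s := p.2) (t := q.2) (C := M)
      (fun u _ => hM _)
    calc _ = ‖(curve W q.1 q.2 - curve W p.1 q.2) + (curve W p.1 q.2 - curve W p.1 p.2)‖ := by
          congr 1; abel
      _ ≤ _ := (norm_add_le _ _).trans (add_le_add h1 h2)
  refine squeeze_zero (fun _ => norm_nonneg _) hb ?_
  have hc : Continuous fun q : Plane × ℝ =>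
      ‖q.1 - p.1‖ * Real.exp (K * |q.2|) + M * |q.2 - p.2| := by fun_prop
  simpa using hc.tendsto p

/-- A curve of a field that is close to the Lipschitz field `W` near a curve of `W` stays close to
that curve. The hypothesis is only needed within distance one, so the nearby curve cannot
escape. -/
lemma IsCurve.norm_sub_le_of_near {x : Plane} {γ δ : ℝ → Plane} {T e : ℝ} (hK : LipschitzWith K W)
    (hK1 : 1 ≤ K) (hγ : IsCurve W x γ) (hδ : IsCurve W' x δ) (he0 : 0 ≤ e)
    (he : e * Real.exp (K * T) < 1)
    (hn : ∀ t, |t| ≤ T → ∀ y, ‖y - γ t‖ ≤ 1 → ‖W' y - W y‖ ≤ e) {t : ℝ} (ht : |t| ≤ T) :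
    ‖δ t - γ t‖ ≤ e * Real.exp (K * T) := by
  have key : ∀ {U U' : Plane → Plane} {γ δ : ℝ → Plane}, LipschitzWith K U →
      IsCurve U x γ → IsCurve U' x δ →
      (∀ t, |t| ≤ T → ∀ y, ‖y - γ t‖ ≤ 1 → ‖U' y - U y‖ ≤ e) → ∀ t : ℝ, 0 ≤ t → t ≤ T →
      ‖δ t - γ t‖ ≤ e * Real.exp (K * T) := by
    intro U U' γ δ hU hγ hδ hn t ht htT
    have hc : Continuous fun s => ‖δ s - γ s‖ := (hδ.continuous.sub hγ.continuous).norm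
    -- Grönwall's inequality on an interval on which the distance is still below one
    have gron : ∀ s, 0 ≤ s → s ≤ T → (∀ u ∈ Set.Ico 0 s, ‖δ u - γ u‖ ≤ 1) →
        ‖δ s - γ s‖ ≤ e * Real.exp (K * T) := by
      intro s hs hsT hu
      have h := norm_le_gronwallBound_of_norm_deriv_right_le (f := fun u => δ u - γ u)
        (f' := fun u => U' (δ u) - U (γ u)) (δ := 0) (K := K) (ε := e) (a := 0) (b := s)
        (hδ.continuous.sub hγ.continuous).continuousOn
        (fun u _ => ((hδ.2 u).sub (hγ.2 u)).hasDerivWithinAt) (by simp [hδ.1, hγ.1])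
        (fun u hu' => by
          have h1 := hn u (abs_le.2 ⟨by linarith [hu'.1], by linarith [hu'.2]⟩) (δ u) (hu u hu')
          have h2 : ‖U (δ u) - U (γ u)‖ ≤ K * ‖δ u - γ u‖ := by
            simpa [dist_eq_norm] using hU.dist_le_mul (δ u) (γ u)
          calc _ = ‖(U (δ u) - U (γ u)) + (U' (δ u) - U (δ u))‖ := by congr 1; abel
            _ ≤ _ := (norm_add_le _ _).trans (add_le_add h2 h1)) s ⟨hs, le_rfl⟩
      refine h.trans ?_
      have hK1' : (1 : ℝ) ≤ K := hK1
      rw [gronwallBound_of_K_ne_0 (by positivity)]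
      simp only [zero_mul, zero_add, sub_zero]
      have h3 : e / K ≤ e := div_le_self he0 hK1'
      have h4 : Real.exp (K * s) - 1 ≤ Real.exp (K * T) := by
        have : Real.exp (K * s) ≤ Real.exp (K * T) := by gcongr
        linarith
      have h5 : 0 ≤ Real.exp (K * s) - 1 := by
        linarith [Real.one_le_exp (show 0 ≤ (K : ℝ) * s by positivity)]
      exact mul_le_mul h3 h4 h5 he0
    by_cases hall : ∀ u ∈ Set.Ico 0 t, ‖δ u - γ u‖ ≤ 1
    · exact gron t ht htT hall
    · exfalso
      push Not at hall
      obtain ⟨u, hu, hu1⟩ := hall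
      -- the first time at which the distance reaches one
      set A := Set.Icc 0 u ∩ {s | 1 ≤ ‖δ s - γ s‖} with hA
      have hAc : IsCompact A := isCompact_Icc.inter_right (isClosed_le continuous_const hc)
      obtain ⟨τ, hτA, hτ⟩ := hAc.exists_isLeast ⟨u, ⟨hu.1, le_rfl⟩, hu1.le⟩
      have := gron τ hτA.1.1 (by linarith [hτA.1.2, hu.2]) fun s hs => by
        by_contra! hcon
        have := hτ ⟨⟨hs.1, by linarith [hs.2, hτA.1.2]⟩, hcon.le⟩
        linarith [hs.2]
      have h1 : 1 ≤ ‖δ τ - γ τ‖ := hτA.2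
      linarith
  rcases le_total 0 t with h0 | h0
  · exact key hK hγ hδ hn t h0 (by rwa [abs_of_nonneg h0] at ht)
  · have := key hK.neg hγ.reverse hδ.reverse
      (fun t ht y hy => by
        have := hn (-t) (by rwa [abs_neg]) y hy
        change ‖-W' y - -W y‖ ≤ e
        rwa [neg_sub_neg, norm_sub_rev]) (-t) (by linarith)
        (by rwa [abs_of_nonpos h0] at ht)
    simpa using this

/-- Stability in terms of the integral of the perturbation along the unperturbed curve; this is
what makes averaging along the curve effective. -/
lemma IsCurve.norm_sub_le_of_integral {x : Plane} {γ δ : ℝ → Plane} {T e L : ℝ}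
    (hW : Continuous W) (hW' : Continuous W') (hγ : IsCurve W x γ) (hδ : IsCurve W' x δ)
    (hL : 0 < L)
    (hI : ∀ t ∈ Set.uIcc 0 T, ‖∫ s in (0 : ℝ)..t, (W' (γ s) - W (γ s))‖ ≤ e)
    (hLip : ∀ t ∈ Set.uIcc 0 T, ‖W' (δ t) - W' (γ t)‖ ≤ L * ‖δ t - γ t‖) :
    ‖δ T - γ T‖ ≤ e * Real.exp (L * |T|) := by
  have key : ∀ {U U' : Plane → Plane} {γ δ : ℝ → Plane} {T : ℝ}, Continuous U → Continuous U' →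
      IsCurve U x γ → IsCurve U' x δ →
      (∀ t ∈ Set.Icc 0 T, ‖∫ s in (0 : ℝ)..t, (U' (γ s) - U (γ s))‖ ≤ e) →
      (∀ t ∈ Set.Icc 0 T, ‖U' (δ t) - U' (γ t)‖ ≤ L * ‖δ t - γ t‖) → 0 ≤ T →
      ‖δ T - γ T‖ ≤ e * Real.exp (L * T) := by
    intro U U' γ δ T hU hU' hγ hδ hI hLip hT
    have hcont : Continuous fun s => U' (γ s) - U (γ s) :=
      (hU'.comp hγ.continuous).sub (hU.comp hγ.continuous)
    have hder : ∀ t, HasDerivAt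
        (fun t => δ t - γ t - ∫ s in (0 : ℝ)..t, (U' (γ s) - U (γ s)))
        (U' (δ t) - U' (γ t)) t := by
      intro t
      have := ((hδ.2 t).sub (hγ.2 t)).sub (hcont.integral_hasStrictDerivAt 0 t).hasDerivAt
      convert! this using 1
      abel
    have hsum : ∀ t, ‖δ t - γ t‖
        ≤ ‖δ t - γ t - ∫ s in (0 : ℝ)..t, (U' (γ s) - U (γ s))‖
          + ‖∫ s in (0 : ℝ)..t, (U' (γ s) - U (γ s))‖ := fun t => by
      simpa using norm_add_le (δ t - γ t - ∫ s in (0 : ℝ)..t, (U' (γ s) - U (γ s)))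
        (∫ s in (0 : ℝ)..t, (U' (γ s) - U (γ s)))
    have h := norm_le_gronwallBound_of_norm_deriv_right_le (δ := 0) (K := L) (ε := L * e) (a := 0)
      (b := T) (fun t _ => (hder t).continuousAt.continuousWithinAt)
      (fun t _ => (hder t).hasDerivWithinAt) (by simp [hδ.1, hγ.1])
      (fun t ht => by
        have h1 := hLip t ⟨ht.1, ht.2.le⟩
        have h2 := hI t ⟨ht.1, ht.2.le⟩
        have h3 := hsum t
        calc _ ≤ _ := h1
          _ ≤ L * (‖δ t - γ t - ∫ s in (0 : ℝ)..t, (U' (γ s) - U (γ s))‖ + e) := by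
            gcongr; linarith
          _ = _ := by ring) T ⟨hT, le_rfl⟩
    rw [gronwallBound_of_K_ne_0 hL.ne', mul_div_cancel_left₀ _ hL.ne'] at h
    have h2 := hI T ⟨hT, le_rfl⟩
    have h3 := hsum T
    simp only [zero_mul, zero_add, sub_zero] at h
    linarith
  rcases le_total 0 T with h0 | h0
  · rw [Set.uIcc_of_le h0] at hI hLip
    rw [abs_of_nonneg h0]
    exact key hW hW' hγ hδ hI hLip h0
  · rw [Set.uIcc_of_ge h0] at hI hLip
    rw [abs_of_nonpos h0]
    have := key hW.neg hW'.neg hγ.reverse hδ.reverse (T := -T)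
      (fun t ht => by
        have h1 := hI (-t) ⟨by linarith [ht.2], by linarith [ht.1]⟩
        have h2 := intervalIntegral.integral_comp_neg (a := 0) (b := t)
          (fun s => W' (γ s) - W (γ s))
        rw [neg_zero] at h2
        rw [intervalIntegral.integral_symm, norm_neg, ← h2] at h1
        have e1 : (fun s => -W' (γ (-s)) - -W (γ (-s)))
            = fun s => -(W' (γ (-s)) - W (γ (-s))) := by funext s; abel
        change ‖∫ s in (0 : ℝ)..t, (-W' (γ (-s)) - -W (γ (-s)))‖ ≤ e
        rw [e1, intervalIntegral.integral_neg, norm_neg]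
        exact h1)
      (fun t ht => by
        have h1 := hLip (-t) ⟨by linarith [ht.2], by linarith [ht.1]⟩
        change ‖-W' (δ (-t)) - -W' (γ (-t))‖ ≤ _
        rw [neg_sub_neg, norm_sub_rev]
        exact h1) (by linarith)
    simpa using this

end Curves

/-! ### Uniform bounds for the density and its derived fields -/

/-- Uniform bounds and Lipschitz constants for the derivatives of `f` and for the fields that are
built from them. -/
structure SmoothBounds (f : Plane → ℝ) (C : ℝ≥0) : Prop where
  one_le : 1 ≤ C
  contDiff : ContDiff ℝ 3 f
  word_sub : ∀ w : List (Fin 2), 1 ≤ w.length → w.length ≤ 3 → ∀ x y,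
    |wordD w f x - wordD w f y| ≤ C * ‖x - y‖
  norm_fderiv : ∀ x, ‖fderiv ℝ f x‖ ≤ C
  norm_fderiv_sub : ∀ x y, ‖fderiv ℝ f x - fderiv ℝ f y‖ ≤ C * ‖x - y‖
  taylor : ∀ x y, ‖fderiv ℝ f y - fderiv ℝ f x - fderiv ℝ (fderiv ℝ f) x (y - x)‖
    ≤ C * ‖y - x‖ ^ 2
  norm_d2_sub : ∀ x y, ‖d2 f x - d2 f y‖ ≤ C * ‖x - y‖
  norm_fderiv_d2 : ∀ x, ‖fderiv ℝ (d2 f) x‖ ≤ C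
  norm_fderiv_d2_sub : ∀ x y, ‖fderiv ℝ (d2 f) x - fderiv ℝ (d2 f) y‖ ≤ C * ‖x - y‖
  norm_V : ∀ x, ‖V f x‖ ≤ C
  norm_V_sub : ∀ x y, ‖V f x - V f y‖ ≤ C * ‖x - y‖
  abs_lam2 : ∀ x, |lam2 f x| ≤ C
  abs_lam2_sub : ∀ x y, |lam2 f x - lam2 f y| ≤ C * ‖x - y‖
  abs_slope_sub : ∀ x y, |slope f x - slope f y| ≤ C * ‖x - y‖
  norm_G_sub : ∀ p q, ‖G p - G q‖ ≤ C * ‖p - q‖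
  abs_J_sub : ∀ p q, |J p - J q| ≤ C * ‖p - q‖

lemma exists_uniform_bound {ι : Type*} (s : Finset ι) {α : Type*} (u : ι → α → ℝ)
    (h : ∀ i ∈ s, ∃ C : ℝ, ∀ x, |u i x| ≤ C) : ∃ C : ℝ, 0 ≤ C ∧ ∀ i ∈ s, ∀ x, |u i x| ≤ C := by
  classical
  choose! c hc using h
  refine ⟨∑ i ∈ s, |c i|, Finset.sum_nonneg fun _ _ => abs_nonneg _, fun i hi x => ?_⟩
  exact ((hc i hi x).trans (le_abs_self _)).trans
    (Finset.single_le_sum (f := fun i => |c i|) (fun _ _ => abs_nonneg _) hi)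

/-- The words of length at most four. -/
def shortWords : Finset (List (Fin 2)) :=
  (List.finite_length_le (Fin 2) 4).toFinset

lemma mem_shortWords {w : List (Fin 2)} : w ∈ shortWords ↔ w.length ≤ 4 := by
  simp [shortWords]

lemma exists_word_bound {g : Plane → ℝ} (P : List (Fin 2) → Prop)
    (h : ∀ w : List (Fin 2), w.length ≤ 4 → P w → ∃ C : ℝ, ∀ x, |wordD w g x| ≤ C) :
    ∃ C : ℝ, 0 ≤ C ∧ ∀ w : List (Fin 2), w.length ≤ 4 → P w → ∀ x, |wordD w g x| ≤ C := by
  classical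
  obtain ⟨C, h0, hC⟩ := exists_uniform_bound (shortWords.filter P) (fun w => wordD w g)
    (fun w hw => by
      rw [Finset.mem_filter, mem_shortWords] at hw
      exact h w hw.1 hw.2)
  exact ⟨C, h0, fun w h1 h2 => hC w (by rw [Finset.mem_filter, mem_shortWords]; exact ⟨h1, h2⟩)⟩

lemma abs_wordD_sub_le {g : Plane → ℝ} {C : ℝ} (w : List (Fin 2))
    (hd : Differentiable ℝ (wordD w g)) (h : ∀ i x, |wordD (i :: w) g x| ≤ C) (x y : Plane) :
    |wordD w g x - wordD w g y| ≤ 2 * C * ‖x - y‖ := by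
  have hn : ∀ z ∈ (Set.univ : Set Plane), ‖fderiv ℝ (wordD w g) z‖ ≤ 2 * C := fun z _ => by
    refine (clm_norm_le _).trans ?_
    have h0 := h 0 z
    have h1 := h 1 z
    simp only [wordD_cons, partialD] at h0 h1
    simp only [Real.norm_eq_abs]
    linarith
  simpa using convex_univ.norm_image_sub_le_of_norm_fderiv_le (fun z _ => hd z) hn
    (Set.mem_univ y) (Set.mem_univ x)

lemma clm_apply_sub_le {E F : Type*} [NormedAddCommGroup E] [NormedSpace ℝ E]
    [NormedAddCommGroup F] [NormedSpace ℝ F] (A B : E →L[ℝ] F) (u v : E) :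
    ‖A u - B v‖ ≤ ‖A - B‖ * ‖u‖ + ‖B‖ * ‖u - v‖ := by
  calc ‖A u - B v‖ = ‖(A - B) u + B (u - v)‖ := by
        rw [sub_apply, map_sub]; congr 1; abel
    _ ≤ _ := (norm_add_le _ _).trans (add_le_add ((A - B).le_opNorm u) (B.le_opNorm _))

lemma norm_fderiv_fderiv_sub_le {g : Plane → ℝ} (hg : ContDiff ℝ 2 g) {x y : Plane} {e : ℝ}
    (h : ∀ w : List (Fin 2), w.length = 2 → |wordD w g x - wordD w g y| ≤ e) :
    ‖fderiv ℝ (fderiv ℝ g) x - fderiv ℝ (fderiv ℝ g) y‖ ≤ 4 * e := by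
  have hd : Differentiable ℝ (fderiv ℝ g) :=
    (hg.fderiv_right (m := 1) (by norm_num)).differentiable (by norm_num)
  have key : ∀ i : Fin 2, ‖(fderiv ℝ (fderiv ℝ g) x - fderiv ℝ (fderiv ℝ g) y)
      (EuclideanSpace.single i 1)‖ ≤ 2 * e := by
    intro i
    refine (clm_norm_le _).trans ?_
    simp only [sub_apply, ← partialD_partialD hd, Real.norm_eq_abs]
    have h0 := h [i, 0] rfl
    have h1 := h [i, 1] rfl
    simp only [wordD_cons, wordD_nil] at h0 h1
    linarith
  refine (clm_norm_le _).trans ?_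
  linarith [key 0, key 1]

/-- `V g` is bounded and Lipschitz as soon as the partial derivatives of orders two and three are
bounded. -/
lemma exists_V_bounds {g : Plane → ℝ} (hg : ContDiff ℝ 3 g)
    (h : ∀ w : List (Fin 2), 2 ≤ w.length → w.length ≤ 3 → ∃ C : ℝ, ∀ x, |wordD w g x| ≤ C) :
    ∃ M K : ℝ≥0, (∀ x, ‖V g x‖ ≤ M) ∧ LipschitzWith K (V g) := by
  obtain ⟨C, hC0, hC⟩ := exists_word_bound (g := g) (fun w => 2 ≤ w.length ∧ w.length ≤ 3)
    (fun w _ hw => h w hw.1 hw.2)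
  obtain ⟨CG, hG0, hG⟩ := exists_norm_G_sub_le
  have hD : DiffUpTo 3 g := ContDiff.diffUpTo (by exact_mod_cast hg)
  refine ⟨⟨CG * (3 * C) + ‖G 0‖, by positivity⟩, ⟨CG * (3 * (2 * C)), by positivity⟩,
    fun x => ?_, LipschitzWith.of_dist_le_mul fun x y => ?_⟩
  · have h1 : ‖d2 g x‖ ≤ 3 * C := by
      refine (norm_space3_le _).trans ?_
      have h0 := hC [0, 0] (by simp) (by simp) x
      have h1 := hC [0, 1] (by simp) (by simp) x
      have h2 := hC [1, 1] (by simp) (by simp) x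
      rw [d2_eq]
      simp
      linarith
    have h2 := hG (d2 g x) 0
    rw [sub_zero] at h2
    calc ‖V g x‖ = ‖(G (d2 g x) - G 0) + G 0‖ := by simp [V]
      _ ≤ CG * ‖d2 g x‖ + ‖G 0‖ := (norm_add_le _ _).trans (by gcongr)
      _ ≤ CG * (3 * C) + ‖G 0‖ := by gcongr
  · rw [dist_eq_norm, dist_eq_norm]
    refine (hG _ _).trans ?_
    have : ‖d2 g x - d2 g y‖ ≤ 3 * (2 * C * ‖x - y‖) := norm_d2_sub_le fun w hw =>
      abs_wordD_sub_le w (hD w (by lia))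
        (fun i x => hC (i :: w) (by simp; lia) (by simp; lia) x) x y
    change _ ≤ CG * (3 * (2 * C)) * ‖x - y‖
    calc _ ≤ CG * (3 * (2 * C * ‖x - y‖)) := by gcongr
      _ = _ := by ring

lemma SmoothDensity.exists_bounds {f : Plane → ℝ} (hf : SmoothDensity f) :
    ∃ C, SmoothBounds f C := by
  have hD : DiffUpTo 4 f := ContDiff.diffUpTo (by exact_mod_cast hf.contDiff)
  have h3 : ContDiff ℝ 3 f := hf.contDiff.of_le (by norm_num)
  have h2 : ContDiff ℝ 2 f := hf.contDiff.of_le (by norm_num)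
  obtain ⟨c, hc0, hc⟩ := exists_word_bound (g := f) (fun w => 1 ≤ w.length)
    (fun w h4 h1 => BoundedPartials.wordD hf.bounded hD w h1 h4)
  obtain ⟨CG, hG0, hG⟩ := exists_norm_G_sub_le
  obtain ⟨CJ, hJ0, hJ⟩ := exists_abs_J_sub_le
  obtain ⟨M, K, hM, hK⟩ := exists_V_bounds h3 fun w h2 h3 => ⟨c, hc w (by lia) (by lia)⟩
  have hsub : ∀ w : List (Fin 2), 1 ≤ w.length → w.length ≤ 3 → ∀ x y,
      |wordD w f x - wordD w f y| ≤ 2 * c * ‖x - y‖ := fun w h1 h3 x y =>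
    abs_wordD_sub_le w (hD w (by lia)) (fun i x => hc (i :: w) (by simp; lia) (by simp) x) x y
  have hf1 : ∀ x, ‖fderiv ℝ f x‖ ≤ 2 * c := fun x => by
    refine (clm_norm_le _).trans ?_
    have h0 := hc [0] (by simp) (by simp) x
    have h1 := hc [1] (by simp) (by simp) x
    simp only [wordD_cons, wordD_nil, partialD] at h0 h1
    simp only [Real.norm_eq_abs]
    linarith
  have hf1s : ∀ x y, ‖fderiv ℝ f x - fderiv ℝ f y‖ ≤ 4 * c * ‖x - y‖ := fun x y => by
    refine (norm_fderiv_sub_le (e := 2 * c * ‖x - y‖)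
      fun w hw => hsub w (by lia) (by lia) x y).trans (by linarith)
  have hd2s : ∀ x y, ‖d2 f x - d2 f y‖ ≤ 6 * c * ‖x - y‖ := fun x y => by
    refine (norm_d2_sub_le (e := 2 * c * ‖x - y‖)
      fun w hw => hsub w (by lia) (by lia) x y).trans (by linarith)
  have hd3 : ∀ x, ‖fderiv ℝ (d2 f) x‖ ≤ 6 * c := fun x => by
    refine (clm_norm_le _).trans ?_
    have key : ∀ i : Fin 2, ‖fderiv ℝ (d2 f) x (EuclideanSpace.single i 1)‖ ≤ 3 * c := by
      intro i
      rw [fderiv_d2_single h3]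
      refine (norm_space3_le _).trans ?_
      have h0 := hc [i, 0, 0] (by simp) (by simp) x
      have h1 := hc [i, 0, 1] (by simp) (by simp) x
      have h2 := hc [i, 1, 1] (by simp) (by simp) x
      simp
      linarith
    linarith [key 0, key 1]
  have hd3s : ∀ x y, ‖fderiv ℝ (d2 f) x - fderiv ℝ (d2 f) y‖ ≤ 12 * c * ‖x - y‖ := fun x y => by
    refine (norm_fderiv_d2_sub_le h3 h3 (e := 2 * c * ‖x - y‖)
      fun w hw => hsub w (by lia) (by lia) x y).trans (by linarith)
  have htay : ∀ x y, ‖fderiv ℝ f y - fderiv ℝ f x - fderiv ℝ (fderiv ℝ f) x (y - x)‖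
      ≤ 8 * c * ‖y - x‖ ^ 2 := fun x y => by
    have hd : Differentiable ℝ (fderiv ℝ f) :=
      (h2.fderiv_right (m := 1) (by norm_num)).differentiable (by norm_num)
    have hseg : ∀ z ∈ segment ℝ x y, ‖z - x‖ ≤ ‖y - x‖ := fun z hz => by
      obtain ⟨t, ht, rfl⟩ := (segment_eq_image' ℝ x y ▸ hz :)
      simp only [add_sub_cancel_left, norm_smul, Real.norm_eq_abs, abs_of_nonneg ht.1]
      exact mul_le_of_le_one_left (norm_nonneg _) ht.2
    have := (convex_segment x y).norm_image_sub_le_of_norm_hasFDerivWithin_le' (f := fderiv ℝ f)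
      (f' := fderiv ℝ (fderiv ℝ f)) (φ := fderiv ℝ (fderiv ℝ f) x) (C := 8 * c * ‖y - x‖)
      (fun z _ => (hd z).hasFDerivAt.hasFDerivWithinAt)
      (fun z hz => by
        refine (norm_fderiv_fderiv_sub_le h2 (e := 2 * c * ‖z - x‖)
          fun w hw => hsub w (by lia) (by lia) z x).trans ?_
        have := hseg z hz
        nlinarith)
      (left_mem_segment ℝ x y) (right_mem_segment ℝ x y)
    rw [pow_two, ← mul_assoc]
    exact this
  have hVs : ∀ x y, ‖V f x - V f y‖ ≤ K * ‖x - y‖ := fun x y => by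
    simpa [dist_eq_norm] using hK.dist_le_mul x y
  have hls : ∀ x y, |lam2 f x - lam2 f y| ≤ CJ * (6 * c) * ‖x - y‖ := fun x y => by
    refine (hJ _ _).trans ?_
    rw [mul_assoc]
    gcongr
    exact hd2s x y
  have hl : ∀ x, |lam2 f x| ≤ CJ * (3 * c) + |J 0| := fun x => by
    have h1 : ‖d2 f x‖ ≤ 3 * c := by
      refine (norm_space3_le _).trans ?_
      have h0 := hc [0, 0] (by simp) (by simp) x
      have h1 := hc [0, 1] (by simp) (by simp) x
      have h2 := hc [1, 1] (by simp) (by simp) x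
      rw [d2_eq]
      simp
      linarith
    have h2 := hJ (d2 f x) 0
    rw [sub_zero] at h2
    calc |lam2 f x| = |(J (d2 f x) - J 0) + J 0| := by simp [lam2]
      _ ≤ CJ * ‖d2 f x‖ + |J 0| := (abs_add_le _ _).trans (by gcongr)
      _ ≤ CJ * (3 * c) + |J 0| := by gcongr
  have hss : ∀ x y, |slope f x - slope f y| ≤ (4 * c * M + 2 * c * K) * ‖x - y‖ := fun x y => by
    rw [slope_eq, slope_eq, ← Real.norm_eq_abs]
    refine (clm_apply_sub_le _ _ _ _).trans ?_
    have h1 : ‖fderiv ℝ f x - fderiv ℝ f y‖ * ‖V f x‖ ≤ (4 * c * ‖x - y‖) * M := by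
      gcongr
      · exact hf1s x y
      · exact hM x
    have h2 : ‖fderiv ℝ f y‖ * ‖V f x - V f y‖ ≤ 2 * c * (K * ‖x - y‖) := by
      gcongr
      · exact hf1 y
      · exact hVs x y
    linarith
  -- one constant that dominates all the previous ones
  set D : ℝ := 1 + 12 * c + M + K + CJ * (6 * c) + |J 0| + (4 * c * M + 2 * c * K) + CG + CJ
    with hDdef
  have hM0 : (0 : ℝ) ≤ M := M.2
  have hK0 : (0 : ℝ) ≤ K := K.2
  have hJc : 0 ≤ CJ * (6 * c) := by positivity
  have hMc : 0 ≤ 4 * c * M + 2 * c * K := by positivity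
  have hJ00 := abs_nonneg (J 0)
  have hD1 : 1 ≤ D := by rw [hDdef]; linarith
  obtain ⟨E, hE⟩ : ∃ E : ℝ≥0, (E : ℝ) = D := ⟨⟨D, by linarith⟩, rfl⟩
  refine ⟨E, ?_⟩
  constructor
  · rw [← NNReal.coe_le_coe, hE]
    exact hD1
  · exact h3
  all_goals simp only [hE]
  · exact fun w h1 h3 x y => (hsub w h1 h3 x y).trans (by gcongr; linarith)
  · exact fun x => (hf1 x).trans (by linarith)
  · exact fun x y => (hf1s x y).trans (by gcongr; linarith)
  · exact fun x y => (htay x y).trans (by gcongr; linarith)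
  · exact fun x y => (hd2s x y).trans (by gcongr; linarith)
  · exact fun x => (hd3 x).trans (by linarith)
  · exact fun x y => (hd3s x y).trans (by gcongr; linarith)
  · exact fun x => (hM x).trans (by linarith)
  · exact fun x y => (hVs x y).trans (by gcongr; linarith)
  · exact fun x => (hl x).trans (by linarith)
  · exact fun x y => (hls x y).trans (by gcongr; linarith)
  · exact fun x y => (hss x y).trans (by gcongr; linarith)
  · exact fun p q => (hG p q).trans (by gcongr; linarith)
  · exact fun p q => (hJ p q).trans (by gcongr; linarith)

/-! ### Perturbation of the fields derived from a density -/

lemma norm_fderiv_G_le {f : Plane → ℝ} {C : ℝ≥0} (hC : SmoothBounds f C) (p : Space3) :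
    ‖fderiv ℝ G p‖ ≤ C :=
  norm_fderiv_le_of_lip' ℝ C.2 (Eventually.of_forall fun q => hC.norm_G_sub q p)

lemma SmoothBounds.abs_slope_perturb {f g : Plane → ℝ} {C : ℝ≥0} (hC : SmoothBounds f C)
    {y : Plane} {e : ℝ} (he : e ≤ 1) (h1 : ‖fderiv ℝ g y - fderiv ℝ f y‖ ≤ e)
    (h2 : ‖d2 g y - d2 f y‖ ≤ e) : |slope g y - slope f y| ≤ (2 * C + C * C) * e := by
  have h0 : 0 ≤ e := (norm_nonneg _).trans h1
  have hc : (0 : ℝ) ≤ C := C.2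
  have hV : ‖V g y - V f y‖ ≤ C * e := (hC.norm_G_sub _ _).trans (by gcongr)
  have hVg : ‖V g y‖ ≤ 2 * C := by
    calc ‖V g y‖ = ‖(V g y - V f y) + V f y‖ := by simp
      _ ≤ C * e + C := (norm_add_le _ _).trans (add_le_add hV (hC.norm_V y))
      _ ≤ 2 * C := by nlinarith
  rw [slope_eq, slope_eq, ← Real.norm_eq_abs]
  refine (clm_apply_sub_le (fderiv ℝ g y) (fderiv ℝ f y) _ _).trans ?_
  calc _ ≤ e * (2 * C) + C * (C * e) := by
        gcongr
        exact hC.norm_fderiv y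
    _ = _ := by ring

lemma SmoothBounds.abs_lam2_perturb {f g : Plane → ℝ} {C : ℝ≥0} (hC : SmoothBounds f C)
    {y : Plane} {e : ℝ} (h2 : ‖d2 g y - d2 f y‖ ≤ e) : |lam2 g y - lam2 f y| ≤ C * e :=
  (hC.abs_J_sub _ _).trans (by gcongr)

lemma SmoothBounds.norm_V_perturb {f g : Plane → ℝ} {C : ℝ≥0} (hC : SmoothBounds f C)
    {y : Plane} {e : ℝ} (h2 : ‖d2 g y - d2 f y‖ ≤ e) : ‖V g y - V f y‖ ≤ C * e :=
  (hC.norm_G_sub _ _).trans (by gcongr)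

/-- On a compact set without double eigenvalue, `V`, its derivative, `λ₂` and `ã'` depend in a
Lipschitz way on the point and on the density. Only `ã'` sees the third derivatives of the density,
and not even `ã'` does so where the gradient vanishes. -/
lemma SmoothBounds.exists_perturb {f : Plane → ℝ} {C : ℝ≥0} (hC : SmoothBounds f C)
    {S : Set Plane} (hS : IsCompact S) (hgap : ∀ x ∈ S, gapMap (d2 f x) ≠ 0) :
    ∃ r > 0, r ≤ 1 ∧ ∃ K : ℝ, 1 ≤ K ∧ ∀ x ∈ S, ∀ g : Plane → ℝ, ContDiff ℝ 3 g →
      ∀ (y : Plane) (s e : ℝ), s ≤ r → e ≤ 1 → ‖y - x‖ ≤ s → ‖fderiv ℝ g y - fderiv ℝ f y‖ ≤ s →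
      ‖d2 g y - d2 f y‖ ≤ s → ‖fderiv ℝ (d2 g) y - fderiv ℝ (d2 f) y‖ ≤ e →
      gapMap (d2 g y) ≠ 0 ∧ ‖V g y - V f x‖ ≤ K * s ∧ ‖fderiv ℝ (V g) y‖ ≤ K ∧
      |lam2 g y - lam2 f x| ≤ K * s ∧ |aTilde' g y - aTilde' f x| ≤ K * (s + e) ∧
      (fderiv ℝ f x = 0 → |aTilde' g y - aTilde' f x| ≤ K * s) := by
  have hd2c : Continuous (d2 f) :=
    (contDiff_d2 (m := 1) (by exact_mod_cast hC.contDiff)).continuous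
  obtain ⟨r₀, hr₀, K₀, hK₀, hG⟩ := exists_G_bounds (hS.image hd2c)
    (by rintro _ ⟨x, hx, rfl⟩; exact hgap x hx)
  set c : ℝ := (C : ℝ) with hcdef
  have hc1 : (1 : ℝ) ≤ c := hC.one_le
  set m : ℝ := c + c * (1 + c) with hm
  set K₂ : ℝ := K₀ * (1 + c) * (2 * c + 1) + c + c * c with hK₂
  set K₃ : ℝ := K₂ * m + c * c * (c * (1 + c)) with hK₃
  set K₄ : ℝ := (1 + c) * (c * (2 * c + 1) * m)
    + (c * (1 + c) * m ^ 2 + c * (c * (1 + c)) * (m + c)) with hK₄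
  have hm0 : 0 ≤ m := by positivity
  have hK₂0 : 0 ≤ K₂ := by positivity
  have hK₃0 : 0 ≤ K₃ := by positivity
  have hK₄0 : 0 ≤ K₄ := by positivity
  set K : ℝ := 1 + c * (1 + c) + c * (2 * c + 1) + c * K₃ + K₄ with hK
  have hcK₃ : 0 ≤ c * K₃ := by positivity
  have hc2 : 0 ≤ c * (1 + c) := by positivity
  have hc3 : 0 ≤ c * (2 * c + 1) := by positivity
  refine ⟨min 1 (r₀ / (2 * (1 + c))), by positivity, min_le_left _ _, K, by linarith, ?_⟩
  intro x hx g hg y s e hs he hyx h1 h2 h3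
  have hs0 : 0 ≤ s := (norm_nonneg _).trans hyx
  have he0 : 0 ≤ e := (norm_nonneg _).trans h3
  have hs1 : s ≤ 1 := hs.trans (min_le_left _ _)
  have hsr : (1 + c) * s ≤ r₀ / 2 := by
    have := hs.trans (min_le_right _ _)
    rw [le_div_iff₀ (by positivity)] at this
    linarith
  have hd : ‖d2 g y - d2 f x‖ ≤ (1 + c) * s := by
    calc _ = ‖(d2 g y - d2 f y) + (d2 f y - d2 f x)‖ := by congr 1; abel
      _ ≤ s + c * ‖y - x‖ := (norm_add_le _ _).trans (add_le_add h2 (hC.norm_d2_sub y x))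
      _ ≤ s + c * s := by gcongr
      _ = _ := by ring
  have hmem : d2 f x ∈ d2 f '' S := ⟨x, hx, rfl⟩
  obtain ⟨hgapg, hGA, -⟩ := hG _ hmem (d2 g y) (by linarith)
  obtain ⟨hgapx, -, -⟩ := hG _ hmem (d2 f x) (by simpa using hr₀.le)
  have hA : ‖fderiv ℝ G (d2 g y) - fderiv ℝ G (d2 f x)‖ ≤ K₀ * ((1 + c) * s) :=
    hGA.trans (by gcongr)
  have hv : ‖V g y - V f x‖ ≤ c * (1 + c) * s := by
    refine (hC.norm_G_sub _ _).trans ?_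
    rw [mul_assoc]
    gcongr
  have hVg : ‖V g y‖ ≤ m := by
    calc ‖V g y‖ = ‖(V g y - V f x) + V f x‖ := by simp
      _ ≤ c * (1 + c) * s + c := (norm_add_le _ _).trans (add_le_add hv (hC.norm_V x))
      _ ≤ c * (1 + c) * 1 + c := by gcongr
      _ = m := by rw [hm]; ring
  have hl : |lam2 g y - lam2 f x| ≤ c * (1 + c) * s := by
    refine (hC.abs_J_sub _ _).trans ?_
    rw [mul_assoc]
    gcongr
  have hD : ‖fderiv ℝ g y - fderiv ℝ f x‖ ≤ (1 + c) * s := by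
    calc _ = ‖(fderiv ℝ g y - fderiv ℝ f y) + (fderiv ℝ f y - fderiv ℝ f x)‖ := by congr 1; abel
      _ ≤ s + c * ‖y - x‖ := (norm_add_le _ _).trans (add_le_add h1 (hC.norm_fderiv_sub y x))
      _ ≤ s + c * s := by gcongr
      _ = _ := by ring
  have hB : ‖fderiv ℝ (d2 g) y - fderiv ℝ (d2 f) x‖ ≤ e + c * s := by
    calc _ = ‖(fderiv ℝ (d2 g) y - fderiv ℝ (d2 f) y)
          + (fderiv ℝ (d2 f) y - fderiv ℝ (d2 f) x)‖ := by congr 1; abel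
      _ ≤ e + c * ‖y - x‖ := (norm_add_le _ _).trans (add_le_add h3 (hC.norm_fderiv_d2_sub y x))
      _ ≤ e + c * s := by gcongr
  have hBg : ‖fderiv ℝ (d2 g) y‖ ≤ 2 * c + 1 := by
    calc _ = ‖(fderiv ℝ (d2 g) y - fderiv ℝ (d2 f) y) + fderiv ℝ (d2 f) y‖ := by simp
      _ ≤ e + c := (norm_add_le _ _).trans (add_le_add h3 (hC.norm_fderiv_d2 y))
      _ ≤ 2 * c + 1 := by linarith
  have hDVg : fderiv ℝ (V g) y = (fderiv ℝ G (d2 g y)).comp (fderiv ℝ (d2 g) y) :=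
    (hasFDerivAt_V hg hgapg).fderiv
  have hDVf : fderiv ℝ (V f) x = (fderiv ℝ G (d2 f x)).comp (fderiv ℝ (d2 f) x) :=
    (hasFDerivAt_V hC.contDiff hgapx).fderiv
  have hDVgn : ‖fderiv ℝ (V g) y‖ ≤ c * (2 * c + 1) := by
    rw [hDVg]
    refine (ContinuousLinearMap.opNorm_comp_le _ _).trans ?_
    gcongr
    exact norm_fderiv_G_le hC _
  have hDVfn : ‖fderiv ℝ (V f) x‖ ≤ c * c := by
    rw [hDVf]
    refine (ContinuousLinearMap.opNorm_comp_le _ _).trans ?_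
    gcongr
    · exact norm_fderiv_G_le hC _
    · exact hC.norm_fderiv_d2 x
  have hDV : ‖fderiv ℝ (V g) y - fderiv ℝ (V f) x‖ ≤ K₂ * (s + e) := by
    rw [hDVg, hDVf]
    calc _ = ‖(fderiv ℝ G (d2 g y) - fderiv ℝ G (d2 f x)).comp (fderiv ℝ (d2 g) y)
          + (fderiv ℝ G (d2 f x)).comp (fderiv ℝ (d2 g) y - fderiv ℝ (d2 f) x)‖ := by
            rw [ContinuousLinearMap.sub_comp, ContinuousLinearMap.comp_sub]; congr 1; abel
      _ ≤ K₀ * ((1 + c) * s) * (2 * c + 1) + c * (e + c * s) := by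
        refine (norm_add_le _ _).trans (add_le_add ?_ ?_)
        · refine (ContinuousLinearMap.opNorm_comp_le _ _).trans ?_
          gcongr
        · refine (ContinuousLinearMap.opNorm_comp_le _ _).trans ?_
          gcongr
          exact norm_fderiv_G_le hC _
      _ ≤ K₀ * ((1 + c) * (s + e)) * (2 * c + 1) + c * ((s + e) + c * (s + e)) := by
        gcongr <;> linarith
      _ = _ := by rw [hK₂]; ring
  have hu : ‖fderiv ℝ (V g) y (V g y) - fderiv ℝ (V f) x (V f x)‖ ≤ K₃ * (s + e) := by
    refine (clm_apply_sub_le (fderiv ℝ (V g) y) (fderiv ℝ (V f) x) _ _).trans ?_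
    calc _ ≤ K₂ * (s + e) * m + c * c * (c * (1 + c) * s) := by gcongr
      _ ≤ K₂ * (s + e) * m + c * c * (c * (1 + c) * (s + e)) := by gcongr; linarith
      _ = _ := by rw [hK₃]; ring
  have hun : ‖fderiv ℝ (V g) y (V g y)‖ ≤ c * (2 * c + 1) * m :=
    (ContinuousLinearMap.le_opNorm _ _).trans (by gcongr)
  have hlast : |lam2 g y * ‖V g y‖ ^ 2 - lam2 f x * ‖V f x‖ ^ 2|
      ≤ (c * (1 + c) * m ^ 2 + c * (c * (1 + c)) * (m + c)) * s := by
    have e1 : lam2 g y * ‖V g y‖ ^ 2 - lam2 f x * ‖V f x‖ ^ 2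
        = (lam2 g y - lam2 f x) * ‖V g y‖ ^ 2
          + lam2 f x * ((‖V g y‖ - ‖V f x‖) * (‖V g y‖ + ‖V f x‖)) := by ring
    rw [e1]
    refine (abs_add_le _ _).trans ?_
    rw [abs_mul, abs_mul, abs_mul, abs_of_nonneg (show 0 ≤ ‖V g y‖ ^ 2 by positivity),
      abs_of_nonneg (show 0 ≤ ‖V g y‖ + ‖V f x‖ by positivity)]
    calc _ ≤ c * (1 + c) * s * m ^ 2 + c * (c * (1 + c) * s * (m + c)) := by
          gcongr
          · exact hC.abs_lam2 x
          · exact (abs_norm_sub_norm_le _ _).trans hv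
          · exact hC.norm_V x
      _ = _ := by ring
  have hat : |aTilde' g y - aTilde' f x| ≤ K₄ * s
      + ‖fderiv ℝ f x‖ * ‖fderiv ℝ (V g) y (V g y) - fderiv ℝ (V f) x (V f x)‖ := by
    have e1 : aTilde' g y - aTilde' f x
        = (fderiv ℝ g y (fderiv ℝ (V g) y (V g y)) - fderiv ℝ f x (fderiv ℝ (V f) x (V f x)))
          + (lam2 g y * ‖V g y‖ ^ 2 - lam2 f x * ‖V f x‖ ^ 2) := by
      rw [aTilde'_eq, aTilde'_eq]; ring
    rw [e1]
    refine (abs_add_le _ _).trans ?_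
    have h4 := clm_apply_sub_le (fderiv ℝ g y) (fderiv ℝ f x) (fderiv ℝ (V g) y (V g y))
      (fderiv ℝ (V f) x (V f x))
    rw [Real.norm_eq_abs] at h4
    have h5 : ‖fderiv ℝ g y - fderiv ℝ f x‖ * ‖fderiv ℝ (V g) y (V g y)‖
        ≤ (1 + c) * s * (c * (2 * c + 1) * m) := by gcongr
    rw [hK₄]
    linarith
  refine ⟨hgapg, hv.trans (by gcongr; linarith), hDVgn.trans (by linarith),
    hl.trans (by gcongr; linarith), ?_, fun h0 => ?_⟩
  · refine hat.trans ?_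
    calc _ ≤ K₄ * (s + e) + c * (K₃ * (s + e)) := by
          gcongr
          · linarith
          · exact hC.norm_fderiv x
      _ = (K₄ + c * K₃) * (s + e) := by ring
      _ ≤ _ := by gcongr; linarith
  · refine hat.trans ?_
    rw [h0, norm_zero, zero_mul, add_zero]
    gcongr
    linarith

/-- First-order expansion of `V` in the second derivatives of the density, uniformly on a compact
set without double eigenvalue. -/
lemma SmoothBounds.exists_V_taylor {f : Plane → ℝ} {C : ℝ≥0} (hC : SmoothBounds f C)
    {S : Set Plane} (hS : IsCompact S) (hgap : ∀ x ∈ S, gapMap (d2 f x) ≠ 0) :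
    ∃ r > 0, ∃ K : ℝ, 0 ≤ K ∧ ∀ x ∈ S, ∀ g : Plane → ℝ, ‖d2 g x - d2 f x‖ ≤ r →
      ‖V g x - V f x - fderiv ℝ G (d2 f x) (d2 g x - d2 f x)‖ ≤ K * ‖d2 g x - d2 f x‖ ^ 2 := by
  have hd2c : Continuous (d2 f) :=
    (contDiff_d2 (m := 1) (by exact_mod_cast hC.contDiff)).continuous
  obtain ⟨r₀, hr₀, K₀, hK₀, hG⟩ := exists_G_bounds (hS.image hd2c)
    (by rintro _ ⟨x, hx, rfl⟩; exact hgap x hx)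
  exact ⟨r₀, hr₀, K₀, hK₀, fun x hx g hg => (hG _ ⟨x, hx, rfl⟩ _ hg).2.2⟩

/-! ### Geometry of the filament and of the curves that are searched for it -/

section FlowOfDensity

variable {f : Plane → ℝ} {C : ℝ≥0}

lemma SmoothBounds.lipschitz_V (hC : SmoothBounds f C) : LipschitzWith C (V f) :=
  LipschitzWith.of_dist_le_mul fun x y => by simpa [dist_eq_norm] using hC.norm_V_sub x y

lemma SmoothBounds.isCurve (hC : SmoothBounds f C) (x : Plane) : IsCurve (V f) x (X f x) :=
  isCurve_curve hC.norm_V hC.lipschitz_V x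

lemma SmoothBounds.X_X (hC : SmoothBounds f C) (x : Plane) (s t : ℝ) :
    X f (X f x s) t = X f x (s + t) :=
  curve_curve hC.norm_V hC.lipschitz_V x s t

lemma SmoothBounds.X_zero (hC : SmoothBounds f C) (x : Plane) : X f x 0 = x := (hC.isCurve x).1

lemma SmoothBounds.continuous_X (hC : SmoothBounds f C) :
    Continuous fun p : Plane × ℝ => X f p.1 p.2 :=
  continuous_curve hC.norm_V hC.lipschitz_V

lemma SmoothBounds.norm_X_sub_X (hC : SmoothBounds f C) (x y : Plane) (t : ℝ) :
    ‖X f x t - X f y t‖ ≤ ‖x - y‖ * Real.exp (C * |t|) :=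
  norm_curve_sub_curve_le hC.norm_V hC.lipschitz_V x y t

lemma SmoothBounds.norm_X_sub (hC : SmoothBounds f C) (x : Plane) (s t : ℝ) :
    ‖X f x t - X f x s‖ ≤ C * |t - s| :=
  (hC.isCurve x).norm_sub_le fun _ _ => hC.norm_V _

lemma SmoothBounds.continuous_slope (hC : SmoothBounds f C) : Continuous (slope f) :=
  (LipschitzWith.of_dist_le_mul (K := C) fun x y => by
    simpa [dist_eq_norm] using hC.abs_slope_sub x y).continuous

lemma SmoothBounds.continuous_lam2 (hC : SmoothBounds f C) : Continuous (lam2 f) :=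
  (LipschitzWith.of_dist_le_mul (K := C) fun x y => by
    simpa [dist_eq_norm] using hC.abs_lam2_sub x y).continuous

end FlowOfDensity

/-- The slope along an integral curve has the derivative `ã'`. -/
lemma IsCurve.hasDerivAt_slope {g : Plane → ℝ} (hg : ContDiff ℝ 3 g) {x : Plane} {γ : ℝ → Plane}
    (h : IsCurve (V g) x γ) {t : ℝ} (ht : gapMap (d2 g (γ t)) ≠ 0) :
    HasDerivAt (fun s => slope g (γ s)) (aTilde' g (γ t)) t := by
  rw [← fderiv_slope_V hg ht]
  exact (hasFDerivAt_slope hg ht).differentiableAt.hasFDerivAt.comp_hasDerivAt t (h.2 t)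

/-- A function that is close to a line of slope at least `c` has a zero. -/
lemma exists_zero_of_near_line {ψ : ℝ → ℝ} (hψ : Continuous ψ) {θ α c η δ : ℝ} (hη : 0 ≤ η)
    (hα : c ≤ |α|) (hδ : δ ≤ c / 2 * η)
    (h : ∀ s, |s| ≤ η → |ψ (θ + s) - α * s| ≤ c / 2 * |s| + δ) :
    ∃ t, |t - θ| ≤ η ∧ ψ t = 0 := by
  have hp := abs_le.1 (h η (by rw [abs_of_nonneg hη]))
  have hm := abs_le.1 (h (-η) (by rw [abs_neg, abs_of_nonneg hη]))
  rw [abs_of_nonneg hη] at hp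
  rw [abs_neg, abs_of_nonneg hη] at hm
  have hI : (0 : ℝ) ∈ Set.uIcc (ψ (θ + -η)) (ψ (θ + η)) := by
    rcases le_total 0 α with h0 | h0
    · rw [abs_of_nonneg h0] at hα
      exact Set.mem_uIcc.2 (Or.inl ⟨by nlinarith, by nlinarith⟩)
    · rw [abs_of_nonpos h0] at hα
      exact Set.mem_uIcc.2 (Or.inr ⟨by nlinarith, by nlinarith⟩)
  obtain ⟨t, ht, h0⟩ := intermediate_value_uIcc hψ.continuousOn hI
  rw [Set.uIcc_of_le (by linarith)] at ht
  exact ⟨t, abs_le.2 ⟨by linarith [ht.1], by linarith [ht.2]⟩, h0⟩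

/-- The assumptions on the density, the region and the filament. -/
structure Model (f : Plane → ℝ) (H L : Set Plane) (a : ℝ) : Prop where
  smooth : SmoothDensity f
  region : Region f H
  filament : IsFilament f H L a
  chord : ChordBound f L a
  transversal : Transversal f L
  nondegenerate : NoDegenerate f H L a

section Model

variable {f : Plane → ℝ} {H L : Set Plane} {a : ℝ} {C : ℝ≥0}

lemma Model.mem_startSet (m : Model f H L a) (hC : SmoothBounds f C) {z : Plane} (hz : z ∈ L) :
    z ∈ startSet f L a :=
  ⟨z, hz, 0, ⟨by linarith [m.filament.a_pos], m.filament.a_pos.le⟩, (hC.X_zero z).symm⟩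

lemma X_mem_startSet {z : Plane} (hz : z ∈ L) {t : ℝ} (ht : |t| ≤ a) :
    X f z t ∈ startSet f L a := ⟨z, hz, t, abs_le.1 ht, rfl⟩

lemma Model.isCompact_startSet (m : Model f H L a) (hC : SmoothBounds f C) :
    IsCompact (startSet f L a) := by
  have h := (m.filament.isCompact.prod (isCompact_Icc (a := -a) (b := a))).image hC.continuous_X
  convert h using 1
  ext x
  simp only [startSet, Set.mem_ofPred_eq, Set.mem_image, Set.mem_prod, Prod.exists]
  constructor
  · rintro ⟨z, hz, t, ht, rfl⟩
    exact ⟨z, t, ⟨hz, ht⟩, rfl⟩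
  · rintro ⟨z, t, ⟨hz, ht⟩, rfl⟩
    exact ⟨z, hz, t, ht, rfl⟩

lemma Model.gap (m : Model f H L a) {x : Plane} (hx : x ∈ startSet f L a) :
    gapMap (d2 f x) ≠ 0 :=
  gapMap_ne_zero_of_eigenvalues (m.region.distinct x (m.filament.subset hx))

lemma Model.theta_spec (m : Model f H L a) {x : Plane} (hx : x ∈ startSet f L a) :
    IsAbsArgmin (hitTimes f x) (theta f x) := by
  have h := (m.filament.unique x hx).exists
  rw [theta, dif_pos h]
  exact h.choose_spec

lemma Model.X_theta_mem (m : Model f H L a) {x : Plane} (hx : x ∈ startSet f L a) :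
    X f x (theta f x) ∈ L := by
  rw [m.filament.eq]
  exact ⟨x, hx, rfl⟩

lemma Model.slope_eq_zero (m : Model f H L a) {z : Plane} (hz : z ∈ L) : slope f z = 0 := by
  rw [m.filament.eq] at hz
  obtain ⟨x, hx, rfl⟩ := hz
  exact (m.theta_spec hx).1.1

lemma Model.lam2_neg (m : Model f H L a) {z : Plane} (hz : z ∈ L) : lam2 f z < 0 := by
  rw [m.filament.eq] at hz
  obtain ⟨x, hx, rfl⟩ := hz
  exact (m.theta_spec hx).1.2

/-- A point of `𝒢` reaches the filament within the time `a`. -/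
lemma Model.abs_theta_le (m : Model f H L a) (hC : SmoothBounds f C) {x : Plane}
    (hx : x ∈ startSet f L a) : |theta f x| ≤ a := by
  have hx' := hx
  obtain ⟨z, hz, t, ht, rfl⟩ := hx
  have h1 : X f (X f z t) (-t) = z := by rw [hC.X_X, add_neg_cancel, hC.X_zero]
  have h2 : -t ∈ hitTimes f (X f z t) := by
    refine ⟨?_, ?_⟩
    · rw [h1]; exact m.slope_eq_zero hz
    · rw [h1]; exact m.lam2_neg hz
  refine ((m.theta_spec hx').2 _ h2).trans ?_
  rw [abs_neg]
  exact abs_le.2 ht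

/-- The curve through `x` is a time shift of the curve through its filament point. -/
lemma SmoothBounds.X_eq_shift (hC : SmoothBounds f C) (x : Plane) (s t : ℝ) :
    X f x t = X f (X f x s) (t - s) := by rw [hC.X_X]; congr 1; ring

lemma Model.aTilde'_ne_zero (m : Model f H L a) (hC : SmoothBounds f C) {z : Plane} (hz : z ∈ L) :
    aTilde' f z ≠ 0 := by
  have h := m.transversal z hz
  rwa [inner_gradient, fderiv_slope_V hC.contDiff (m.gap (m.mem_startSet hC hz))] at h

/-- Near the filament the slope grows linearly along the curves and the second eigenvalue is
negative, uniformly over the filament. -/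
lemma Model.exists_local (m : Model f H L a) (hC : SmoothBounds f C) :
    ∃ c > 0, ∃ η > 0, η ≤ a ∧ ∀ z ∈ L, c ≤ |aTilde' f z| ∧ ∀ s, |s| ≤ η →
      |slope f (X f z s) - aTilde' f z * s| ≤ c / 2 * |s| ∧ lam2 f (X f z s) ≤ -c / 2 := by
  have ha := m.filament.a_pos
  rcases L.eq_empty_or_nonempty with rfl | hne
  · exact ⟨1, one_pos, a, ha, le_rfl, by simp⟩
  obtain ⟨r, hr, -, K, hK, hP⟩ := hC.exists_perturb (m.isCompact_startSet hC) fun x hx => m.gap hx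
  have hat : ∀ x ∈ startSet f L a, ∀ y, ‖y - x‖ ≤ min r 1 →
      |aTilde' f y - aTilde' f x| ≤ K * (2 * ‖y - x‖) := by
    intro x hx y hy
    have := (hP x hx f hC.contDiff y ‖y - x‖ ‖y - x‖ (hy.trans (min_le_left _ _))
      (hy.trans (min_le_right _ _)) le_rfl (by simp) (by simp) (by simp)).2.2.2.2.1
    rwa [← two_mul] at this
  have hcont : ContinuousOn (aTilde' f) L := by
    intro x hx
    refine ContinuousAt.continuousWithinAt ?_
    rw [ContinuousAt, tendsto_iff_norm_sub_tendsto_zero]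
    refine squeeze_zero' (Eventually.of_forall fun _ => norm_nonneg _)
      (g := fun y => K * (2 * ‖y - x‖)) ?_ ?_
    · filter_upwards [Metric.closedBall_mem_nhds x (show 0 < min r 1 by positivity)] with y hy
      exact hat x (m.mem_startSet hC hx) y (by rwa [← mem_closedBall_iff_norm])
    · have : Continuous fun y => K * (2 * ‖y - x‖) := by fun_prop
      simpa using this.tendsto x
  obtain ⟨z₁, hz₁, h₁⟩ := m.filament.isCompact.exists_isMinOn hne hcont.abs
  obtain ⟨z₂, hz₂, h₂⟩ := m.filament.isCompact.exists_isMaxOn hne hC.continuous_lam2.continuousOn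
  have hc₁ : 0 < |aTilde' f z₁| := abs_pos.2 (m.aTilde'_ne_zero hC hz₁)
  have hc₂ : 0 < -lam2 f z₂ := by linarith [m.lam2_neg hz₂]
  set c := min |aTilde' f z₁| (-lam2 f z₂) with hc
  have hc0 : 0 < c := lt_min hc₁ hc₂
  have hC1 : (1 : ℝ) ≤ C := hC.one_le
  set η := min (min a (c / (2 * C * C))) (min (min r 1 / C) (c / (4 * K * C))) with hη
  refine ⟨c, hc0, η, by positivity,
    (min_le_left _ _).trans (min_le_left _ _), fun z hz => ⟨?_, fun s hs => ⟨?_, ?_⟩⟩⟩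
  · exact (min_le_left _ _).trans (h₁ hz)
  · have hder : ∀ u ∈ Set.uIcc 0 s, HasDerivWithinAt
        (fun u => slope f (X f z u) - aTilde' f z * u) (aTilde' f (X f z u) - aTilde' f z)
        (Set.uIcc 0 s) u := by
      intro u hu
      have hu' : |u| ≤ η := by
        have := Set.abs_sub_left_of_mem_uIcc hu
        rw [sub_zero, sub_zero] at this
        exact this.trans hs
      have := (hC.isCurve z).hasDerivAt_slope hC.contDiff (t := u)
        (m.gap (X_mem_startSet hz (hu'.trans
          ((min_le_left _ _).trans (min_le_left _ _)))))
      exact (this.sub (by simpa using (hasDerivAt_id u).const_mul (aTilde' f z))).hasDerivWithinAt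
    have hbd : ∀ u ∈ Set.uIcc 0 s, ‖aTilde' f (X f z u) - aTilde' f z‖ ≤ c / 2 := by
      intro u hu
      have hu' : |u| ≤ η := by
        have := Set.abs_sub_left_of_mem_uIcc hu
        rw [sub_zero, sub_zero] at this
        exact this.trans hs
      have hX : ‖X f z u - z‖ ≤ C * |u| := by
        have := hC.norm_X_sub z 0 u
        rwa [hC.X_zero, sub_zero] at this
      have h3 : |u| ≤ min r 1 / C := hu'.trans ((min_le_right _ _).trans (min_le_left _ _))
      have h4 : |u| ≤ c / (4 * K * C) := hu'.trans ((min_le_right _ _).trans (min_le_right _ _))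
      rw [le_div_iff₀ (by positivity)] at h3 h4
      refine (hat z (m.mem_startSet hC hz) _ (hX.trans (by linarith))).trans ?_
      calc K * (2 * ‖X f z u - z‖) ≤ K * (2 * (C * |u|)) := by gcongr
        _ ≤ c / 2 := by linarith
    have := (convex_uIcc 0 s).norm_image_sub_le_of_norm_hasDerivWithin_le hder hbd
      Set.left_mem_uIcc Set.right_mem_uIcc
    simpa [hC.X_zero, m.slope_eq_zero hz] using this
  · have hX : ‖X f z s - z‖ ≤ C * |s| := by
      have := hC.norm_X_sub z 0 s
      rwa [hC.X_zero, sub_zero] at this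
    have h4 : |s| ≤ c / (2 * C * C) := hs.trans ((min_le_left _ _).trans (min_le_right _ _))
    rw [le_div_iff₀ (by positivity)] at h4
    have h5 := (abs_le.1 (hC.abs_lam2_sub (X f z s) z)).2
    have h6 : C * ‖X f z s - z‖ ≤ C * (C * |s|) := by gcongr
    have h7 : lam2 f z ≤ lam2 f z₂ := h₂ hz
    have h8 : c ≤ -lam2 f z₂ := min_le_right _ _
    linarith

/-- Upper semicontinuity of the hitting time. -/
lemma Model.exists_abs_theta_le (m : Model f H L a) (hC : SmoothBounds f C) {x : Plane}
    (hx : x ∈ startSet f L a) {ε : ℝ} (hε : 0 < ε) :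
    ∃ ρ > 0, ∀ y ∈ startSet f L a, ‖y - x‖ < ρ → |theta f y| ≤ |theta f x| + ε := by
  obtain ⟨c, hc, η₀, hη₀, hη₀a, hloc⟩ := m.exists_local hC
  set z := X f x (theta f x) with hz
  have hzL : z ∈ L := m.X_theta_mem hx
  obtain ⟨hα, hl⟩ := hloc z hzL
  set η := min ε η₀ with hη
  have hη0 : 0 < η := lt_min hε hη₀
  have hC1 : (1 : ℝ) ≤ C := hC.one_le
  set E := Real.exp (C * (a + η)) with hE
  have hE0 : 0 < E := Real.exp_pos _
  have hηη₀ : η ≤ η₀ := min_le_right _ _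
  refine ⟨min (c / 2 * η) (c / 4) / (C * E), by positivity, fun y hy hyx => ?_⟩
  rw [lt_div_iff₀ (by positivity)] at hyx
  have hclose : ∀ s, |s| ≤ η →
      C * ‖X f y (theta f x + s) - X f z s‖ < min (c / 2 * η) (c / 4) := by
    intro s hs
    have h1 := hC.norm_X_sub_X y x (theta f x + s)
    rw [hC.X_eq_shift x (theta f x) (theta f x + s), ← hz, add_sub_cancel_left] at h1
    have h2 : |theta f x + s| ≤ a + η :=
      (abs_add_le _ _).trans (add_le_add (m.abs_theta_le hC hx) hs)
    calc _ ≤ C * (‖y - x‖ * E) := by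
          refine mul_le_mul_of_nonneg_left (h1.trans ?_) C.2
          rw [hE]
          gcongr
      _ = ‖y - x‖ * (C * E) := by ring
      _ < _ := hyx
  obtain ⟨t, ht, h0⟩ := exists_zero_of_near_line (ψ := fun t => slope f (X f y t))
    (θ := theta f x) (hC.continuous_slope.comp (hC.isCurve y).continuous) hη0.le hα
    (δ := c / 2 * η) le_rfl fun s hs => by
      have h1 := (hl s (hs.trans hηη₀)).1
      have h2 := (hC.abs_slope_sub (X f y (theta f x + s)) (X f z s)).trans
        (hclose s hs).le
      have h3 := h2.trans (min_le_left _ _)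
      calc _ = |(slope f (X f z s) - aTilde' f z * s)
            + (slope f (X f y (theta f x + s)) - slope f (X f z s))| := by congr 1; ring
        _ ≤ _ := (abs_add_le _ _).trans (add_le_add h1 h3)
  have hhit : t ∈ hitTimes f y := by
    refine ⟨h0, ?_⟩
    have h1 := (hl (t - theta f x) (ht.trans hηη₀)).2
    have h2 := (hclose _ ht).trans_le (min_le_right _ _)
    have h3 := (abs_le.1 (hC.abs_lam2_sub (X f y (theta f x + (t - theta f x)))
      (X f z (t - theta f x)))).2
    rw [add_sub_cancel] at h2 h3
    linarith
  have h1 := (m.theta_spec hy).2 t hhit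
  have h2 : |t| ≤ |theta f x| + η := by
    calc |t| = |theta f x + (t - theta f x)| := by congr 1; ring
      _ ≤ _ := (abs_add_le _ _).trans (by gcongr)
  linarith [min_le_left ε η₀]

/-- Along the arcs that are searched, a point with almost vanishing slope and an eigenvalue that
is not clearly positive is close to the filament point. -/
lemma Model.exists_separation (m : Model f H L a) (hC : SmoothBounds f C) {η : ℝ} (hη : 0 < η) :
    ∃ δ > 0, ∀ x ∈ startSet f L a, ∀ t, |t| ≤ |theta f x| + δ → |slope f (X f x t)| ≤ δ →
      lam2 f (X f x t) ≤ δ → |t - theta f x| < η := by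
  by_contra! hcon
  choose x hx t ht hs hl hη' using fun k : ℕ => hcon (1 / ((k : ℝ) + 1)) (by positivity)
  have hδ : Tendsto (fun k : ℕ => 1 / ((k : ℝ) + 1)) atTop (𝓝 0) :=
    tendsto_one_div_add_atTop_nhds_zero_nat
  have hδ1 : ∀ k : ℕ, 1 / ((k : ℝ) + 1) ≤ 1 := fun k => by
    rw [div_le_one (by positivity)]
    linarith [k.cast_nonneg (α := ℝ)]
  have hcomp : IsCompact (startSet f L a ×ˢ (Set.Icc (-(a + 1)) (a + 1) ×ˢ Set.Icc (-a) a)) :=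
    (m.isCompact_startSet hC).prod (isCompact_Icc.prod isCompact_Icc)
  obtain ⟨⟨x₀, τ, θ⟩, ⟨hx₀, -, -⟩, φ, hφ, hlim⟩ := hcomp.tendsto_subseq
    (x := fun k => (x k, t k, theta f (x k))) fun k => by
      refine ⟨hx k, abs_le.1 ?_, abs_le.1 (m.abs_theta_le hC (hx k))⟩
      linarith [ht k, hδ1 k, m.abs_theta_le hC (hx k)]
  have hxl : Tendsto (fun k => x (φ k)) atTop (𝓝 x₀) := hlim.fst_nhds
  have htl : Tendsto (fun k => t (φ k)) atTop (𝓝 τ) := hlim.snd_nhds.fst_nhds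
  have hθl : Tendsto (fun k => theta f (x (φ k))) atTop (𝓝 θ) := hlim.snd_nhds.snd_nhds
  have hδl : Tendsto (fun k => 1 / ((φ k : ℝ) + 1)) atTop (𝓝 0) := hδ.comp hφ.tendsto_atTop
  have hXt : Tendsto (fun k => X f (x (φ k)) (t (φ k))) atTop (𝓝 (X f x₀ τ)) :=
    (hC.continuous_X.tendsto (x₀, τ)).comp (hxl.prodMk_nhds htl)
  have hXθ : Tendsto (fun k => X f (x (φ k)) (theta f (x (φ k)))) atTop (𝓝 (X f x₀ θ)) :=
    (hC.continuous_X.tendsto (x₀, θ)).comp (hxl.prodMk_nhds hθl)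
  have h1 : |τ| ≤ |θ| := by
    have := le_of_tendsto_of_tendsto' htl.abs (hθl.abs.add hδl) fun k => ht (φ k)
    simpa using this
  have h2 : slope f (X f x₀ τ) = 0 := by
    have := le_of_tendsto_of_tendsto' ((hC.continuous_slope.tendsto _).comp hXt).abs hδl
      fun k => hs (φ k)
    exact abs_nonpos_iff.1 this
  have h3 : lam2 f (X f x₀ τ) ≤ 0 :=
    le_of_tendsto_of_tendsto' ((hC.continuous_lam2.tendsto _).comp hXt) hδl fun k => hl (φ k)
  have h4 : η ≤ |τ - θ| := ge_of_tendsto' (htl.sub hθl).abs fun k => hη' (φ k)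
  have h5 : X f x₀ θ ∈ L :=
    m.filament.isCompact.isClosed.mem_of_tendsto hXθ
      (Eventually.of_forall fun k => m.X_theta_mem (hx _))
  have hspec := m.theta_spec hx₀
  have huniq : ∀ s, s ∈ hitTimes f x₀ → |s| ≤ |theta f x₀| → s = theta f x₀ := fun s hs hs' =>
    (m.filament.unique x₀ hx₀).unique ⟨hs, fun u hu => hs'.trans (hspec.2 u hu)⟩ hspec
  -- upper semicontinuity forces the limit of the hitting times to be the hitting time
  have h6 : |θ| ≤ |theta f x₀| := by
    refine le_of_forall_pos_le_add fun ε hε => ?_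
    obtain ⟨ρ, hρ, hle⟩ := m.exists_abs_theta_le hC hx₀ hε
    refine le_of_tendsto hθl.abs ?_
    filter_upwards [(Metric.tendsto_nhds.1 hxl) ρ hρ] with k hk
    exact hle _ (hx _) (by rwa [dist_eq_norm] at hk)
  have h7 : θ = theta f x₀ := huniq θ ⟨m.slope_eq_zero h5, m.lam2_neg h5⟩ h6
  have h8 : lam2 f (X f x₀ τ) ≠ 0 := fun h0 =>
    m.nondegenerate.arcs x₀ hx₀ τ (h1.trans h6) ⟨h0, h2⟩
  have h9 : τ = theta f x₀ := huniq τ ⟨h2, lt_of_le_of_ne h3 h8⟩ (h1.trans h6)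
  rw [h7, h9, sub_self, abs_zero] at h4
  linarith

end Model

/-! ### The curves and hitting times of a nearby density -/

/-- `g` is close to `f` up to the third derivatives on the ball of radius `R`, with the errors
`e₁ ≤ e₂ ≤ e₃` for the three orders, and the linearized error of the vector field,
integrated along the curves through `L`, is at most `e₅`. -/
structure Near (f g : Plane → ℝ) (L : Set Plane) (a R e₁ e₅ e₂ e₃ : ℝ) : Prop where
  contDiff : ContDiff ℝ 3 g
  bounded : ∃ M K : ℝ≥0, (∀ x, ‖V g x‖ ≤ M) ∧ LipschitzWith K (V g)
  first : ∀ y, ‖y‖ ≤ R → ‖fderiv ℝ g y - fderiv ℝ f y‖ ≤ e₁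
  second : ∀ y, ‖y‖ ≤ R → ‖d2 g y - d2 f y‖ ≤ e₂
  third : ∀ y, ‖y‖ ≤ R → ‖fderiv ℝ (d2 g) y - fderiv ℝ (d2 f) y‖ ≤ e₃
  integral : ∀ z ∈ L, ∀ t, |t| ≤ a →
    ‖∫ s in (0 : ℝ)..t, fderiv ℝ G (d2 f (X f z s)) (d2 g (X f z s) - d2 f (X f z s))‖ ≤ e₅
  nonneg : 0 ≤ e₁
  e₁_le : e₁ ≤ e₅
  e₅_le : e₅ ≤ e₂
  e₂_le : e₂ ≤ e₃
  sq_le : e₂ ^ 2 ≤ e₅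

section Near

variable {f g : Plane → ℝ} {H L : Set Plane} {a R e₁ e₅ e₂ e₃ : ℝ} {C : ℝ≥0}

lemma Near.isCurve (h : Near f g L a R e₁ e₅ e₂ e₃) (x : Plane) : IsCurve (V g) x (X g x) := by
  obtain ⟨M, K, hM, hK⟩ := h.bounded
  exact isCurve_curve hM hK x

lemma Near.continuous_V (h : Near f g L a R e₁ e₅ e₂ e₃) : Continuous (V g) := by
  obtain ⟨M, K, hM, hK⟩ := h.bounded
  exact hK.continuous

lemma Near.continuous_slope (h : Near f g L a R e₁ e₅ e₂ e₃) : Continuous (slope g) := by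
  have h1 : Continuous (fderiv ℝ g) := h.contDiff.continuous_fderiv (by norm_num)
  exact (h1.clm_apply h.continuous_V).congr fun x => (slope_eq g x).symm

lemma Near.continuous_lam2 (h : Near f g L a R e₁ e₅ e₂ e₃) : Continuous (lam2 g) :=
  continuous_J.comp (contDiff_d2 (m := 1) (by exact_mod_cast h.contDiff)).continuous

/-- If slope and eigenvalue along a curve are perturbed slightly, the set of estimated hitting
times has a minimizer, and each of its minimizers is close to the hitting time. -/
lemma Model.exists_hat_close (m : Model f H L a) (hC : SmoothBounds f C) {η : ℝ} (hη : 0 < η) :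
    ∃ κ > 0, ∀ x ∈ startSet f L a, ∀ ψ l : ℝ → ℝ, Continuous ψ → Continuous l →
      (∀ t, |t| ≤ a + 1 → |ψ t - slope f (X f x t)| ≤ κ) →
      (∀ t, |t| ≤ a + 1 → |l t - lam2 f (X f x t)| ≤ κ) →
      ∀ t, IsHatTheta {t | ψ t = 0 ∧ l t < 0} t → |t - theta f x| < η ∧ ψ t = 0 := by
  obtain ⟨c, hc, η₀, hη₀, hη₀a, hloc⟩ := m.exists_local hC
  obtain ⟨δ, hδ, hsep⟩ := m.exists_separation hC (lt_min hη hη₀)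
  set η₂ := min (min η₀ 1) δ with hη₂
  have hη₂0 : 0 < η₂ := by positivity
  have hη₂η₀ : η₂ ≤ η₀ := (min_le_left _ _).trans (min_le_left _ _)
  have hη₂1 : η₂ ≤ 1 := (min_le_left _ _).trans (min_le_right _ _)
  have hη₂δ : η₂ ≤ δ := min_le_right _ _
  refine ⟨min (min (c / 2 * η₂) (c / 4)) δ, by positivity, ?_⟩
  intro x hx ψ l hψ hl hψκ hlκ that hhat
  have hκ₁ := (min_le_left (min (c / 2 * η₂) (c / 4)) δ).trans (min_le_left _ _)
  have hκ₂ := (min_le_left (min (c / 2 * η₂) (c / 4)) δ).trans (min_le_right _ _)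
  have hκ₃ := min_le_right (min (c / 2 * η₂) (c / 4)) δ
  set κ := min (min (c / 2 * η₂) (c / 4)) δ with hκ
  have hθa := m.abs_theta_le hC hx
  set θ := theta f x with hθ
  have hzL : X f x θ ∈ L := m.X_theta_mem hx
  obtain ⟨hα, hnear⟩ := hloc _ hzL
  have hshift : ∀ s, X f x (θ + s) = X f (X f x θ) s := fun s => (hC.X_X x θ s).symm
  have hlam : ∀ t, |t - θ| < η₀ → |t| ≤ a + 1 → l t < 0 := by
    intro t ht hta
    have h1 := (hnear (t - θ) ht.le).2
    rw [← hshift, add_sub_cancel] at h1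
    have h2 := (abs_le.1 (hlκ t hta)).2
    linarith
  obtain ⟨t₁, ht₁, hψ₁⟩ := exists_zero_of_near_line hψ hη₂0.le hα hκ₁ (θ := θ) fun s hs => by
    have h1 := (hnear s (hs.trans hη₂η₀)).1
    rw [← hshift] at h1
    have h2 := hψκ (θ + s) ((abs_add_le _ _).trans (by linarith))
    calc _ = |(slope f (X f x (θ + s)) - aTilde' f (X f x θ) * s)
          + (ψ (θ + s) - slope f (X f x (θ + s)))| := by congr 1; ring
      _ ≤ _ := (abs_add_le _ _).trans (add_le_add h1 h2)
  have hbd : ∀ t, |t - θ| ≤ η₂ → |t| ≤ |θ| + η₂ := fun t ht => by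
    calc |t| = |θ + (t - θ)| := by congr 1; ring
      _ ≤ _ := (abs_add_le _ _).trans (by gcongr)
  have hclose : ∀ t, |t| ≤ |θ| + η₂ → ψ t = 0 → l t ≤ 0 → |t - θ| < min η η₀ := by
    intro t ht h0 hlt
    have hta : |t| ≤ a + 1 := ht.trans (by linarith)
    refine hsep x hx t (ht.trans (by linarith)) ?_ ?_
    · have := hψκ t hta
      rw [h0, zero_sub, abs_neg] at this
      exact this.trans hκ₃
    · have := (abs_le.1 (hlκ t hta)).1
      linarith
  -- the closed condition `l ≤ 0` yields a compact set, hence a minimizer, which satisfies `l < 0`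
  have hAc : IsCompact ({t : ℝ | |t| ≤ |θ| + η₂} ∩ {t | ψ t = 0 ∧ l t ≤ 0}) := by
    have h1 : {t : ℝ | |t| ≤ |θ| + η₂} = Set.Icc (-(|θ| + η₂)) (|θ| + η₂) := by
      ext t
      simp only [Set.mem_ofPred_eq, Set.mem_Icc, abs_le]
    rw [h1]
    exact isCompact_Icc.inter_right ((isClosed_eq hψ continuous_const).inter
      (isClosed_le hl continuous_const))
  have ht₁b := hbd t₁ ht₁
  have ht₁l : l t₁ < 0 := by
    have h3 : |t₁ - θ| ≤ η₀ := ht₁.trans hη₂η₀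
    have h1 := (hnear (t₁ - θ) h3).2
    rw [← hshift, add_sub_cancel] at h1
    have h2 := (abs_le.1 (hlκ t₁ (by linarith))).2
    linarith
  obtain ⟨t₀, ⟨ht₀b, ht₀ψ, ht₀l⟩, hmin⟩ := hAc.exists_isMinOn ⟨t₁, ht₁b, hψ₁, ht₁l.le⟩
    continuous_abs.continuousOn
  have ht₀ : IsAbsArgmin {t | ψ t = 0 ∧ l t < 0} t₀ := by
    refine ⟨⟨ht₀ψ, hlam t₀ ((hclose t₀ ht₀b ht₀ψ ht₀l).trans_le (min_le_right _ _)) ?_⟩, ?_⟩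
    · exact (show |t₀| ≤ |θ| + η₂ from ht₀b).trans (by linarith)
    · intro s hs
      rcases le_total |s| (|θ| + η₂) with h | h
      · exact hmin ⟨h, hs.1, hs.2.le⟩
      · exact (show |t₀| ≤ |θ| + η₂ from ht₀b).trans h
  obtain ⟨hmem, hle⟩ := hhat.1 ⟨t₀, ht₀⟩
  have hb : |that| ≤ |θ| + η₂ := (hle t₀ ht₀.1).trans ht₀b
  exact ⟨(hclose that hb hmem.1 hmem.2.le).trans_le (min_le_left _ _), hmem.1⟩

/-- The curves of a nearby density stay close to the original curves. -/
lemma Model.exists_crude (m : Model f H L a) (hC : SmoothBounds f C)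
    (hR : ∀ x ∈ startSet f L a, ∀ t, |t| ≤ a + 1 → ‖X f x t‖ + 1 ≤ R) :
    ∃ B : ℝ, 1 ≤ B ∧ ∀ g : Plane → ℝ, ∀ e₁ e₅ e₂ e₃, Near f g L a R e₁ e₅ e₂ e₃ → B * e₂ < 1 →
      ∀ x ∈ startSet f L a, ∀ t, |t| ≤ a + 1 → ‖X g x t - X f x t‖ ≤ B * e₂ ∧ ‖X g x t‖ ≤ R := by
  have hC1 : (1 : ℝ) ≤ C := hC.one_le
  have ha := m.filament.a_pos
  have hexp : 1 ≤ Real.exp (C * (a + 1)) := Real.one_le_exp (by positivity)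
  refine ⟨C * Real.exp (C * (a + 1)), by nlinarith, ?_⟩
  intro g e₁ e₅ e₂ e₃ h hB x hx t ht
  have he₂ : 0 ≤ e₂ := h.nonneg.trans (h.e₁_le.trans h.e₅_le)
  have h1 := IsCurve.norm_sub_le_of_near (T := a + 1) (e := C * e₂) hC.lipschitz_V hC.one_le
    (hC.isCurve x) (h.isCurve x) (by positivity) (by linarith)
    (fun s hs y hy => by
      refine hC.norm_V_perturb (h.second y ?_)
      calc ‖y‖ = ‖X f x s + (y - X f x s)‖ := by congr 1; abel
        _ ≤ ‖X f x s‖ + 1 := (norm_add_le _ _).trans (by gcongr)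
        _ ≤ R := hR x hx s hs) ht
  have h2 : ‖X g x t - X f x t‖ ≤ C * Real.exp (C * (a + 1)) * e₂ := h1.trans (by linarith)
  refine ⟨h2, ?_⟩
  calc ‖X g x t‖ = ‖X f x t + (X g x t - X f x t)‖ := by congr 1; abel
    _ ≤ ‖X f x t‖ + 1 := (norm_add_le _ _).trans (by gcongr; linarith)
    _ ≤ R := hR x hx t ht

/-- For a nearby density the estimated hitting time is a time at which the estimated slope
vanishes, and it is close to the hitting time. -/
lemma Model.exists_hat_near (m : Model f H L a) (hC : SmoothBounds f C)
    (hR : ∀ x ∈ startSet f L a, ∀ t, |t| ≤ a + 1 → ‖X f x t‖ + 1 ≤ R) {η : ℝ} (hη : 0 < η) :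
    ∃ ε > 0, ∀ g : Plane → ℝ, ∀ e₁ e₅ e₂ e₃, Near f g L a R e₁ e₅ e₂ e₃ → e₂ ≤ ε →
      ∀ x ∈ startSet f L a, ∀ t, IsHatTheta (hitTimes g x) t →
        |t - theta f x| < η ∧ slope g (X g x t) = 0 := by
  obtain ⟨κ, hκ, hhat⟩ := m.exists_hat_close hC hη
  obtain ⟨B, hB, hcr⟩ := m.exists_crude hC hR
  have hC1 : (1 : ℝ) ≤ C := hC.one_le
  set D : ℝ := 2 * C + C * C + C * B with hD
  refine ⟨min (1 / (2 * B)) (κ / D), by positivity, ?_⟩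
  intro g e₁ e₅ e₂ e₃ h he x hx t ht
  have he0 : 0 ≤ e₂ := h.nonneg.trans (h.e₁_le.trans h.e₅_le)
  have h1 : B * e₂ < 1 := by
    have := he.trans (min_le_left _ _)
    rw [le_div_iff₀ (by positivity)] at this
    linarith
  have h2 : D * e₂ ≤ κ := by
    have := he.trans (min_le_right _ _)
    rw [le_div_iff₀ (by positivity)] at this
    linarith
  have h3 : e₂ ≤ 1 := by nlinarith
  refine hhat x hx (fun s => slope g (X g x s)) (fun s => lam2 g (X g x s))
    (h.continuous_slope.comp (h.isCurve x).continuous)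
    (h.continuous_lam2.comp (h.isCurve x).continuous) ?_ ?_ t ht
  · intro s hs
    obtain ⟨h4, h5⟩ := hcr g _ _ _ _ h h1 x hx s hs
    have h6 := hC.abs_slope_perturb h3 ((h.first _ h5).trans (h.e₁_le.trans h.e₅_le))
      (h.second _ h5)
    have h7 := hC.abs_slope_sub (X g x s) (X f x s)
    have h8 : C * ‖X g x s - X f x s‖ ≤ C * (B * e₂) := by gcongr
    calc _ ≤ (2 * C + C * C) * e₂ + C * (B * e₂) := by
          refine (abs_sub_le _ (slope f (X g x s)) _).trans ?_
          linarith
      _ = D * e₂ := by rw [hD]; ring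
      _ ≤ κ := h2
  · intro s hs
    obtain ⟨h4, h5⟩ := hcr g _ _ _ _ h h1 x hx s hs
    have h6 := hC.abs_lam2_perturb (h.second _ h5)
    have h7 := hC.abs_lam2_sub (X g x s) (X f x s)
    have h8 : C * ‖X g x s - X f x s‖ ≤ C * (B * e₂) := by gcongr
    calc _ ≤ C * e₂ + C * (B * e₂) := by
          refine (abs_sub_le _ (lam2 f (X g x s)) _).trans ?_
          linarith
      _ ≤ D * e₂ := by rw [hD]; nlinarith [mul_nonneg (mul_nonneg C.2 C.2) he0, mul_nonneg C.2 he0]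
      _ ≤ κ := h2

end Near

/-! ### First-order expansion of the estimated filament points -/

section Expansion

variable {f : Plane → ℝ} {H L : Set Plane} {a R : ℝ} {C : ℝ≥0}

/-- At the filament point, the error of the curve is of the order of the error of the vector field
*averaged along the curve*, not of the pointwise error. -/
lemma Model.exists_flow_error (m : Model f H L a) (hC : SmoothBounds f C)
    (hR : ∀ x ∈ startSet f L a, ∀ t, |t| ≤ a + 1 → ‖X f x t‖ + 1 ≤ R) :
    ∃ ε > 0, ∃ K : ℝ, 0 ≤ K ∧ ∀ g : Plane → ℝ, ∀ e₁ e₅ e₂ e₃, Near f g L a R e₁ e₅ e₂ e₃ →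
      e₃ ≤ ε → ∀ x ∈ startSet f L a, ‖X g x (theta f x) - X f x (theta f x)‖ ≤ K * e₅ := by
  have hC1 : (1 : ℝ) ≤ C := hC.one_le
  have ha := m.filament.a_pos
  have hScomp := m.isCompact_startSet hC
  obtain ⟨r, hr, hr1, K₁, hK₁, hP⟩ := hC.exists_perturb hScomp fun x hx => m.gap hx
  obtain ⟨r₂, hr₂, K₂, hK₂, hT⟩ := hC.exists_V_taylor hScomp fun x hx => m.gap hx
  obtain ⟨B, hB, hcr⟩ := m.exists_crude hC hR
  refine ⟨min r₂ (r / (2 * B)), by positivity, (2 + K₂ * a) * Real.exp (K₁ * a), by positivity, ?_⟩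
  intro g e₁ e₅ e₂ e₃ h he x hx
  have he₅ : 0 ≤ e₅ := h.nonneg.trans h.e₁_le
  have he₂ : 0 ≤ e₂ := he₅.trans h.e₅_le
  have heb : e₃ * (2 * B) ≤ r := by
    have := he.trans (min_le_right _ _)
    rwa [le_div_iff₀ (by positivity)] at this
  have he₃0 : 0 ≤ e₃ := he₂.trans h.e₂_le
  have he₃r : e₃ ≤ r := by nlinarith
  have hBe : B * e₂ ≤ r := by nlinarith [h.e₂_le]
  have hBe1 : B * e₂ < 1 := by nlinarith [h.e₂_le]
  have he₂r : e₂ ≤ r := h.e₂_le.trans he₃r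
  have he₁r : e₁ ≤ r := h.e₁_le.trans (h.e₅_le.trans he₂r)
  have hθa := m.abs_theta_le hC hx
  set θ := theta f x with hθ
  set z := X f x θ with hz
  have hzL : z ∈ L := m.X_theta_mem hx
  have hsh : ∀ s, X f x s = X f z (s - θ) := fun s => hC.X_eq_shift x θ s
  have hint : ∀ s ∈ Set.uIcc 0 θ, |s - θ| ≤ a ∧ |s| ≤ a + 1 := by
    intro s hs
    have h1 := Set.abs_sub_left_of_mem_uIcc hs
    have h2 := Set.abs_sub_right_of_mem_uIcc hs
    rw [sub_zero, sub_zero] at h1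
    rw [sub_zero, abs_sub_comm] at h2
    exact ⟨h2.trans hθa, by linarith⟩
  have hmemS : ∀ s ∈ Set.uIcc 0 θ, X f x s ∈ startSet f L a := fun s hs => by
    rw [hsh]; exact X_mem_startSet hzL (hint s hs).1
  set F : ℝ → Plane :=
    fun u => fderiv ℝ G (d2 f (X f z u)) (d2 g (X f z u) - d2 f (X f z u)) with hF
  have hd2f : Continuous (d2 f) :=
    (contDiff_d2 (m := 1) (by exact_mod_cast hC.contDiff)).continuous
  have hd2g : Continuous (d2 g) :=
    (contDiff_d2 (m := 1) (by exact_mod_cast h.contDiff)).continuous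
  have hFc : ContinuousOn F (Set.Icc (-a) a) := by
    intro u hu
    have hg : gapMap (d2 f (X f z u)) ≠ 0 := m.gap (X_mem_startSet hzL (abs_le.2 hu))
    have h1 : ContinuousAt (fderiv ℝ G) (d2 f (X f z u)) :=
      ((contDiffAt_G hg 2).fderiv_right (m := 1) (by norm_num)).continuousAt
    have hXc := (hC.isCurve z).continuous
    have h2 : ContinuousAt (fun u => fderiv ℝ G (d2 f (X f z u))) u :=
      ContinuousAt.comp (f := fun u => d2 f (X f z u)) h1 (hd2f.comp hXc).continuousAt
    exact (h2.clm_apply ((hd2g.comp hXc).sub (hd2f.comp hXc)).continuousAt).continuousWithinAt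
  have hFi : ∀ u v, |u| ≤ a → |v| ≤ a → IntervalIntegrable F volume u v := fun u v hu hv =>
    (hFc.mono (Set.uIcc_subset_Icc (abs_le.1 hu) (abs_le.1 hv))).intervalIntegrable
  have hI : ∀ t ∈ Set.uIcc 0 θ, ‖∫ s in (0 : ℝ)..t, (V g (X f x s) - V f (X f x s))‖
      ≤ (2 + K₂ * a) * e₅ := by
    intro t ht
    have h1 : ∫ s in (0 : ℝ)..t, F (s - θ) = (∫ u in (0 : ℝ)..(t - θ), F u)
        - ∫ u in (0 : ℝ)..(-θ), F u := by
      rw [intervalIntegral.integral_comp_sub_right, zero_sub,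
        intervalIntegral.integral_interval_sub_left]
      · exact hFi _ _ (by rw [abs_zero]; exact ha.le) (hint t ht).1
      · exact hFi _ _ (by rw [abs_zero]; exact ha.le) (by rwa [abs_neg])
    have hsub : Set.uIcc 0 t ⊆ Set.uIcc 0 θ := Set.uIcc_subset_uIcc_left ht
    have hFs : IntervalIntegrable (fun s => F (s - θ)) volume 0 t := by
      refine ContinuousOn.intervalIntegrable ?_
      refine hFc.comp (continuous_sub_right θ).continuousOn fun s hs => ?_
      exact abs_le.1 (hint s (hsub hs)).1
    have hVs : IntervalIntegrable (fun s => V g (X f x s) - V f (X f x s)) volume 0 t :=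
      ((h.continuous_V.comp (hC.isCurve x).continuous).sub
        (hC.lipschitz_V.continuous.comp (hC.isCurve x).continuous)).intervalIntegrable 0 t
    have h2 : ‖∫ s in (0 : ℝ)..t, (V g (X f x s) - V f (X f x s) - F (s - θ))‖
        ≤ K₂ * e₂ ^ 2 * |t - 0| := by
      refine intervalIntegral.norm_integral_le_of_norm_le_const fun s hs => ?_
      have hs' := hsub (Set.uIoc_subset_uIcc hs)
      have hRs : ‖X f x s‖ ≤ R := by linarith [hR x hx s (hint s hs').2]
      have h3 := h.second _ hRs
      have h4 := hT _ (hmemS s hs') g (h3.trans (h.e₂_le.trans (he.trans (min_le_left _ _))))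
      rw [hF]
      simp only
      rw [← hsh]
      refine h4.trans ?_
      gcongr
    rw [intervalIntegral.integral_sub hVs hFs, h1] at h2
    have h5 := h.integral z hzL (t - θ) (hint t ht).1
    have h6 := h.integral z hzL (-θ) (by rwa [abs_neg])
    have ht' : |t - 0| ≤ a := by
      have := Set.abs_sub_left_of_mem_uIcc ht
      rw [sub_zero θ] at this
      exact this.trans hθa
    set I := ∫ s in (0 : ℝ)..t, (V g (X f x s) - V f (X f x s))
    calc ‖I‖ = ‖(I - ((∫ u in (0 : ℝ)..(t - θ), F u) - ∫ u in (0 : ℝ)..(-θ), F u))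
          + ((∫ u in (0 : ℝ)..(t - θ), F u) - ∫ u in (0 : ℝ)..(-θ), F u)‖ := by congr 1; abel
      _ ≤ K₂ * e₂ ^ 2 * |t - 0| + (e₅ + e₅) :=
        (norm_add_le _ _).trans (add_le_add h2 ((norm_sub_le _ _).trans (add_le_add h5 h6)))
      _ ≤ K₂ * e₅ * a + (e₅ + e₅) := by gcongr; exact h.sq_le
      _ = _ := by ring
  have hLip : ∀ t ∈ Set.uIcc 0 θ, ‖V g (X g x t) - V g (X f x t)‖
      ≤ K₁ * ‖X g x t - X f x t‖ := by
    intro t ht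
    have h1 := (hcr g _ _ _ _ h hBe1 x hx t (hint t ht).2).1
    have hball : ∀ y ∈ Metric.closedBall (X f x t) (B * e₂),
        gapMap (d2 g y) ≠ 0 ∧ ‖fderiv ℝ (V g) y‖ ≤ K₁ := by
      intro y hy
      rw [mem_closedBall_iff_norm] at hy
      have hyR : ‖y‖ ≤ R := by
        calc ‖y‖ = ‖X f x t + (y - X f x t)‖ := by congr 1; abel
          _ ≤ ‖X f x t‖ + 1 := (norm_add_le _ _).trans (by gcongr; linarith)
          _ ≤ R := hR x hx t (hint t ht).2
      have := hP _ (hmemS t ht) g h.contDiff y r e₃ le_rfl (he₃r.trans hr1) (hy.trans hBe)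
        ((h.first y hyR).trans he₁r) ((h.second y hyR).trans he₂r) (h.third y hyR)
      exact ⟨this.1, this.2.2.1⟩
    exact (convex_closedBall _ _).norm_image_sub_le_of_norm_fderiv_le
      (fun y hy => (hasFDerivAt_V h.contDiff (hball y hy).1).differentiableAt)
      (fun y hy => (hball y hy).2)
      (Metric.mem_closedBall_self (by positivity)) (by rwa [mem_closedBall_iff_norm])
  have := IsCurve.norm_sub_le_of_integral (T := θ) hC.lipschitz_V.continuous h.continuous_V
    (hC.isCurve x) (h.isCurve x) (by linarith : 0 < K₁) hI hLip
  calc _ ≤ _ := this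
    _ ≤ (2 + K₂ * a) * e₅ * Real.exp (K₁ * a) := by gcongr
    _ = _ := by ring

/-- The expansion of the estimated filament point around the curve point at the true hitting time:
the estimated curve moves on for a time `-slope / ã'`. The two error bounds differ only in the
order of the time shift and in whether the third derivatives enter. -/
lemma expansion_of_bounds {g : Plane → ℝ} {x v : Plane} {θ τ α E D : ℝ} (hg : ContDiff ℝ 3 g)
    (hcurve : IsCurve (V g) x (X g x))
    (hzero : slope g (X g x τ) = 0)
    (hgap : ∀ t ∈ Set.uIcc θ τ, gapMap (d2 g (X g x t)) ≠ 0)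
    (hE : ∀ t ∈ Set.uIcc θ τ, |aTilde' g (X g x t) - α| ≤ E)
    (hD : ∀ t ∈ Set.uIcc θ τ, ‖V g (X g x t) - v‖ ≤ D) :
    |slope g (X g x θ) + α * (τ - θ)| ≤ E * |τ - θ| ∧
      ‖X g x τ - X g x θ - (τ - θ) • v‖ ≤ D * |τ - θ| := by
  constructor
  · have := (convex_uIcc θ τ).norm_image_sub_le_of_norm_hasDerivWithin_le
      (f := fun t => slope g (X g x t) - α * t) (f' := fun t => aTilde' g (X g x t) - α)
      (fun t ht => ((hcurve.hasDerivAt_slope hg (hgap t ht)).sub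
        (by simpa using (hasDerivAt_id t).const_mul α)).hasDerivWithinAt)
      hE Set.left_mem_uIcc Set.right_mem_uIcc
    rw [hzero, Real.norm_eq_abs, Real.norm_eq_abs] at this
    rw [← abs_neg]
    convert this using 2
    ring
  · have := (convex_uIcc θ τ).norm_image_sub_le_of_norm_hasDerivWithin_le
      (f := fun t => X g x t - t • v) (f' := fun t => V g (X g x t) - v)
      (fun t _ => ((hcurve.2 t).sub
        (by simpa using (hasDerivAt_id t).smul_const v)).hasDerivWithinAt)
      hD Set.left_mem_uIcc Set.right_mem_uIcc
    rw [Real.norm_eq_abs] at this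
    have e : X g x τ - X g x θ - (τ - θ) • v = X g x τ - τ • v - (X g x θ - θ • v) := by
      rw [sub_smul]; abel
    rw [e]
    exact this

/-- An approximate Newton equation with a small relative error bounds the step. -/
lemma abs_shift_le {ψ α Δ c E : ℝ} (hc : 0 < c) (hα : c ≤ |α|) (hE : E ≤ c / 2)
    (h : |ψ + α * Δ| ≤ E * |Δ|) : |Δ| ≤ 2 / c * |ψ| := by
  have h1 : |α| * |Δ| ≤ |ψ + α * Δ| + |ψ| := by
    rw [← abs_mul]
    calc |α * Δ| = |(ψ + α * Δ) - ψ| := by congr 1; ring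
      _ ≤ _ := abs_sub _ _
  have h2 : c * |Δ| ≤ |α| * |Δ| := by gcongr
  have h3 : E * |Δ| ≤ c / 2 * |Δ| := by gcongr
  rw [div_mul_eq_mul_div, le_div_iff₀ hc]
  linarith

lemma abs_shift_add_le {ψ α Δ c E : ℝ} (hc : 0 < c) (hα : c ≤ |α|)
    (h : |ψ + α * Δ| ≤ E * |Δ|) : |Δ + ψ / α| ≤ E * |Δ| / c := by
  have hα0 : α ≠ 0 := abs_pos.1 (hc.trans_le hα)
  have e : Δ + ψ / α = (ψ + α * Δ) / α := by field_simp; ring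
  rw [e, abs_div]
  exact div_le_div₀ ((abs_nonneg _).trans h) h hc hα

/-- The estimates from which the expansions are assembled; `p` is the filament point, `q` the
point of the estimated curve at the true hitting time, and `Δ` the error of the hitting time. -/
structure ShiftBounds (f g : Plane → ℝ) (x p q : Plane) (Δ τ c D e₅ e₂ e₃ : ℝ) : Prop where
  c_le : c ≤ |aTilde' f p|
  flow : ‖q - p‖ ≤ D * e₅
  shift : |Δ| ≤ D * |slope g q|
  shift' : |Δ| ≤ D * e₂
  linear : |Δ + slope g q / aTilde' f p| ≤ D * e₃ * |Δ|
  linear_of_zero : fderiv ℝ f p = 0 → |Δ + slope g q / aTilde' f p| ≤ D * e₂ * |Δ|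
  move : ‖X g x τ - q - Δ • V f p‖ ≤ D * e₂ * |Δ|
  field : ‖V g q - V f p‖ ≤ D * e₂
  field_norm : ‖V g q‖ ≤ D
  field_sub : ‖V g q - V g p‖ ≤ D * e₅
  gradient : ‖fderiv ℝ g q - fderiv ℝ f p‖ ≤ D * e₅
  taylor : ‖V g p - V f p - fderiv ℝ G (d2 f p) (d2 g p - d2 f p)‖ ≤ D * e₂ ^ 2

set_option maxHeartbeats 1000000 in
/-- The estimates hold for all densities that are close to `f`, uniformly over the starting points.
The error of the third derivatives enters only through `linear`. -/
lemma Model.exists_shiftBounds (m : Model f H L a) (hC : SmoothBounds f C)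
    (hR : ∀ x ∈ startSet f L a, ∀ t, |t| ≤ a + 1 → ‖X f x t‖ + 1 ≤ R) :
    ∃ ε > 0, ∃ c > 0, ∃ D : ℝ, 0 ≤ D ∧ ∀ g : Plane → ℝ, ∀ e₁ e₅ e₂ e₃,
      Near f g L a R e₁ e₅ e₂ e₃ →
      e₃ ≤ ε → ∀ x ∈ startSet f L a, ∀ τ, IsHatTheta (hitTimes g x) τ →
      ‖X g x (theta f x)‖ ≤ R ∧
      ShiftBounds f g x (X f x (theta f x)) (X g x (theta f x)) (τ - theta f x) τ c D e₅ e₂ e₃ := by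
  have hC1 : (1 : ℝ) ≤ C := hC.one_le
  have ha := m.filament.a_pos
  have hScomp := m.isCompact_startSet hC
  obtain ⟨r, hr, hr1, K₁, hK₁, hP⟩ := hC.exists_perturb hScomp fun x hx => m.gap hx
  obtain ⟨r₂, hr₂, K₂, hK₂, hT⟩ := hC.exists_V_taylor hScomp fun x hx => m.gap hx
  obtain ⟨B, hB, hcr⟩ := m.exists_crude hC hR
  obtain ⟨εZ, hεZ, KZ, hKZ, hZ⟩ := m.exists_flow_error hC hR
  obtain ⟨c, hc, η₀, hη₀, hη₀a, hloc⟩ := m.exists_local hC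
  obtain ⟨ρ, hρ⟩ : ∃ ρ, ρ = min (r / 2) (c / (8 * K₁)) := ⟨_, rfl⟩
  have hρ0 : 0 < ρ := by rw [hρ]; positivity
  have hρr : ρ ≤ r / 2 := hρ ▸ min_le_left _ _
  have hρc : K₁ * ρ ≤ c / 8 := by
    have : ρ ≤ c / (8 * K₁) := hρ ▸ min_le_right _ _
    rw [le_div_iff₀ (by positivity)] at this
    linarith
  obtain ⟨εh, hεh, hhat⟩ := m.exists_hat_near hC hR
    (show 0 < min 1 (ρ / (2 * C)) by positivity)
  obtain ⟨D₄, hD₄⟩ : ∃ D : ℝ, D = 2 * C + C * C + C * KZ := ⟨_, rfl⟩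
  have hD₄0 : 0 ≤ D₄ := by rw [hD₄]; positivity
  obtain ⟨D₅, hD₅⟩ : ∃ D : ℝ, D = 2 / c * D₄ := ⟨_, rfl⟩
  have hD₅0 : 0 ≤ D₅ := by rw [hD₅]; positivity
  obtain ⟨D₆, hD₆⟩ : ∃ D : ℝ, D = 2 * C * D₅ + KZ + 1 := ⟨_, rfl⟩
  have hD₆0 : 0 ≤ D₆ := by rw [hD₆]; positivity
  obtain ⟨D, hD⟩ : ∃ D : ℝ, D = KZ + 2 / c + D₅ + K₁ * (D₆ + 1) / c + K₁ * D₆ + 2 * C + K₁ * KZ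
      + (1 + C * KZ) + K₂ := ⟨_, rfl⟩
  have h2c : 0 ≤ 2 / c := by positivity
  have hKD : 0 ≤ K₁ * (D₆ + 1) / c := by positivity
  have hKD' : 0 ≤ K₁ * D₆ := by positivity
  have hKK : 0 ≤ K₁ * KZ := by positivity
  have hCK : 0 ≤ C * KZ := by positivity
  have hD0 : 0 ≤ D := by rw [hD]; positivity
  have hDZ : KZ ≤ D := by linarith
  have hDc : 2 / c ≤ D := by linarith
  have hD₅D : D₅ ≤ D := by linarith
  have hDlin : K₁ * (D₆ + 1) / c ≤ D := by linarith
  have hDK₆ : K₁ * D₆ ≤ D := by linarith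
  have hD2C : 2 * C ≤ D := by linarith
  have hDKK : K₁ * KZ ≤ D := by linarith
  have hDCK : 1 + C * KZ ≤ D := by linarith
  have hDK₂ : K₂ ≤ D := by linarith
  clear hD
  refine ⟨min (min (min εZ εh) (min r₂ (1 / (2 * B)))) (ρ / (KZ + 1)),
    by positivity, c, hc, D, hD0, ?_⟩
  intro g e₁ e₅ e₂ e₃ h he x hx τ hτ
  have he₅0 : 0 ≤ e₅ := h.nonneg.trans h.e₁_le
  have he₂0 : 0 ≤ e₂ := he₅0.trans h.e₅_le
  have he₃0 : 0 ≤ e₃ := he₂0.trans h.e₂_le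
  have heZ : e₃ ≤ εZ := he.trans
    ((min_le_left _ _).trans ((min_le_left _ _).trans (min_le_left _ _)))
  have heh : e₂ ≤ εh := h.e₂_le.trans (he.trans
    ((min_le_left _ _).trans ((min_le_left _ _).trans (min_le_right _ _))))
  have her₂ : e₂ ≤ r₂ := h.e₂_le.trans (he.trans
    ((min_le_left _ _).trans ((min_le_right _ _).trans (min_le_left _ _))))
  have heB : B * e₂ < 1 := by
    have := h.e₂_le.trans (he.trans
      ((min_le_left _ _).trans ((min_le_right _ _).trans (min_le_right _ _))))
    rw [le_div_iff₀ (by positivity)] at this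
    linarith
  have heρ : e₃ * (KZ + 1) ≤ ρ := by
    have := he.trans (min_le_right _ _)
    rwa [le_div_iff₀ (by positivity)] at this
  clear he
  have he₃ρ : e₃ ≤ ρ := (le_mul_of_one_le_right he₃0 (by linarith)).trans heρ
  have he₃1 : e₃ ≤ 1 := by linarith
  have he₂1 : e₂ ≤ 1 := h.e₂_le.trans he₃1
  have he₁₂ : e₁ ≤ e₂ := h.e₁_le.trans h.e₅_le
  have he₂₃ := h.e₂_le
  have he₅₂ := h.e₅_le
  obtain ⟨hτθ, hτ0⟩ := hhat g _ _ _ _ h heh x hx τ hτ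
  have hZx := hZ g _ _ _ _ h heZ x hx
  have hθa := m.abs_theta_le hC hx
  have hpL : X f x (theta f x) ∈ L := m.X_theta_mem hx
  have hpR := hR x hx (theta f x) (by linarith)
  have hcrx := hcr g _ _ _ _ h heB x hx
  generalize theta f x = θ at *
  generalize hp : X f x θ = p at *
  have hpS : p ∈ startSet f L a := m.mem_startSet hC hpL
  have hcα : c ≤ |aTilde' f p| := (hloc p hpL).1
  obtain ⟨Δ, hΔ⟩ : ∃ Δ, Δ = τ - θ := ⟨_, rfl⟩
  rw [← hΔ] at hτθ ⊢
  have hΔ1 : |Δ| ≤ 1 := hτθ.le.trans (min_le_left _ _)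
  have hΔρ : 2 * C * |Δ| ≤ ρ := by
    have := hτθ.le.trans (min_le_right _ _)
    rw [le_div_iff₀ (by positivity)] at this
    linarith
  have htR : ∀ t ∈ Set.uIcc θ τ, ‖X g x t‖ ≤ R := by
    intro t ht
    have h1 := Set.abs_sub_left_of_mem_uIcc ht
    rw [← hΔ] at h1
    refine (hcrx t ?_).2
    calc |t| = |θ + (t - θ)| := by congr 1; ring
      _ ≤ a + 1 := (abs_add_le _ _).trans (add_le_add hθa (h1.trans hΔ1))
  have hVgR : ∀ y, ‖y‖ ≤ R → ‖V g y‖ ≤ 2 * C := by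
    intro y hy
    have h1 := hC.norm_V_perturb (h.second y hy)
    calc ‖V g y‖ = ‖(V g y - V f y) + V f y‖ := by simp
      _ ≤ C * e₂ + C := (norm_add_le _ _).trans (add_le_add h1 (hC.norm_V y))
      _ ≤ 2 * C := by linarith [mul_le_of_le_one_right (show (0 : ℝ) ≤ C from C.2) he₂1]
  have htp : ∀ t ∈ Set.uIcc θ τ, ‖X g x t - p‖ ≤ 2 * C * |Δ| + KZ * e₅ := by
    intro t ht
    have h1 := Set.abs_sub_left_of_mem_uIcc ht
    rw [← hΔ] at h1
    have h2 := (h.isCurve x).norm_sub_le (s := θ) (t := t) (C := 2 * C)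
      fun u hu => hVgR _ (htR u (Set.uIcc_subset_uIcc_left ht hu))
    calc ‖X g x t - p‖ = ‖(X g x t - X g x θ) + (X g x θ - p)‖ := by congr 1; abel
      _ ≤ 2 * C * |t - θ| + KZ * e₅ := (norm_add_le _ _).trans (add_le_add h2 hZx)
      _ ≤ _ := by gcongr
  obtain ⟨s, hs⟩ : ∃ s, s = 2 * C * |Δ| + KZ * e₅ + e₂ := ⟨_, rfl⟩
  have hs' : 0 ≤ 2 * C * |Δ| + KZ * e₅ := by positivity
  have hs0 : 0 ≤ s := by rw [hs]; positivity
  have hs2ρ : s ≤ 2 * ρ := by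
    have : KZ * e₅ + e₂ ≤ e₃ * (KZ + 1) := by
      linarith [mul_le_mul_of_nonneg_left (he₅₂.trans he₂₃) hKZ]
    linarith
  have hpert : ∀ t ∈ Set.uIcc θ τ, gapMap (d2 g (X g x t)) ≠ 0 ∧ ‖V g (X g x t) - V f p‖ ≤ K₁ * s ∧
      |aTilde' g (X g x t) - aTilde' f p| ≤ K₁ * (s + e₃) ∧
      (fderiv ℝ f p = 0 → |aTilde' g (X g x t) - aTilde' f p| ≤ K₁ * s) := by
    intro t ht
    have hy := htR t ht
    have h1 := hP p hpS g h.contDiff (X g x t) s e₃ (by linarith) he₃1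
      ((htp t ht).trans (by linarith))
      ((h.first _ hy).trans (by linarith))
      ((h.second _ hy).trans (by linarith))
      (h.third _ hy)
    exact ⟨h1.1, h1.2.1, h1.2.2.2.2.1, h1.2.2.2.2.2⟩
  have hθmem : θ ∈ Set.uIcc θ τ := Set.left_mem_uIcc
  have hqR := htR θ hθmem
  have hE : K₁ * (s + e₃) ≤ c / 2 := by
    have : K₁ * (s + e₃) ≤ K₁ * (2 * ρ + ρ) := by gcongr
    linarith
  -- one Newton step at the true hitting time
  have hexp := fun E hE => expansion_of_bounds (α := aTilde' f p) (E := E) h.contDiff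
    (h.isCurve x) hτ0 (fun t ht => (hpert t ht).1) hE (fun t ht => (hpert t ht).2.1)
  rw [← hΔ] at hexp
  obtain ⟨hψ, hXτ⟩ := hexp _ fun t ht => (hpert t ht).2.2.1
  have hΔψ := abs_shift_le hc hcα hE hψ
  have hslopep : slope f p = 0 := m.slope_eq_zero hpL
  have hψ₂ : |slope g (X g x θ)| ≤ D₄ * e₂ := by
    have h1 := hC.abs_slope_perturb he₂1 ((h.first _ hqR).trans he₁₂) (h.second _ hqR)
    have h2 := hC.abs_slope_sub (X g x θ) p
    rw [hslopep, sub_zero] at h2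
    have h3 : C * ‖X g x θ - p‖ ≤ C * (KZ * e₂) := by
      gcongr
      exact hZx.trans (by gcongr)
    calc |slope g (X g x θ)|
        = |(slope g (X g x θ) - slope f (X g x θ)) + slope f (X g x θ)| := by congr 1; ring
      _ ≤ (2 * C + C * C) * e₂ + C * (KZ * e₂) := (abs_add_le _ _).trans (by linarith)
      _ = _ := by rw [hD₄]; ring
  have hΔ₂ : |Δ| ≤ D₅ * e₂ := by
    calc |Δ| ≤ 2 / c * |slope g (X g x θ)| := hΔψ
      _ ≤ 2 / c * (D₄ * e₂) := by gcongr
      _ = _ := by rw [hD₅]; ring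
  have hs₂ : s ≤ D₆ * e₂ := by
    calc s ≤ 2 * C * (D₅ * e₂) + KZ * e₂ + e₂ := by rw [hs]; gcongr
      _ = _ := by rw [hD₆]; ring
  have hs₃ : K₁ * (s + e₃) / c ≤ K₁ * (D₆ + 1) / c * e₃ := by
    calc K₁ * (s + e₃) / c ≤ K₁ * (D₆ * e₃ + e₃) / c := by
          gcongr
          exact hs₂.trans (by gcongr)
      _ = _ := by ring
  have hs₄ : K₁ * s / c ≤ K₁ * (D₆ + 1) / c * e₂ := by
    calc K₁ * s / c ≤ K₁ * (D₆ * e₂ + e₂) / c := by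
          gcongr
          linarith
      _ = _ := by ring
  have hΔ0 := abs_nonneg Δ
  refine ⟨hqR, hcα, ?_, ?_, ?_, ?_, fun h0 => ?_, ?_, ?_, ?_, ?_, ?_, ?_⟩
  · exact hZx.trans (mul_le_mul_of_nonneg_right hDZ he₅0)
  · exact hΔψ.trans (mul_le_mul_of_nonneg_right hDc (abs_nonneg _))
  · exact hΔ₂.trans (mul_le_mul_of_nonneg_right hD₅D he₂0)
  · refine (abs_shift_add_le hc hcα hψ).trans ?_
    rw [mul_div_right_comm]
    refine mul_le_mul_of_nonneg_right (hs₃.trans ?_) hΔ0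
    exact mul_le_mul_of_nonneg_right hDlin he₃0
  · obtain ⟨hψ', -⟩ := hexp _ fun t ht => (hpert t ht).2.2.2 h0
    refine (abs_shift_add_le hc hcα hψ').trans ?_
    rw [mul_div_right_comm]
    refine mul_le_mul_of_nonneg_right (hs₄.trans ?_) hΔ0
    exact mul_le_mul_of_nonneg_right hDlin he₂0
  · refine hXτ.trans (mul_le_mul_of_nonneg_right ?_ hΔ0)
    calc K₁ * s ≤ K₁ * (D₆ * e₂) := by gcongr
      _ = K₁ * D₆ * e₂ := by ring
      _ ≤ D * e₂ := mul_le_mul_of_nonneg_right hDK₆ he₂0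
  · refine (hpert θ hθmem).2.1.trans ?_
    calc K₁ * s ≤ K₁ * (D₆ * e₂) := by gcongr
      _ = K₁ * D₆ * e₂ := by ring
      _ ≤ D * e₂ := mul_le_mul_of_nonneg_right hDK₆ he₂0
  · exact (hVgR _ hqR).trans hD2C
  · have hball : ∀ y ∈ Metric.closedBall p (KZ * e₅),
        gapMap (d2 g y) ≠ 0 ∧ ‖fderiv ℝ (V g) y‖ ≤ K₁ := by
      intro y hy
      rw [mem_closedBall_iff_norm] at hy
      have hyρ : ‖y - p‖ ≤ ρ := by
        linarith [mul_le_mul_of_nonneg_left (he₅₂.trans he₂₃) hKZ]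
      have hyR : ‖y‖ ≤ R := by
        calc ‖y‖ = ‖p + (y - p)‖ := by congr 1; abel
          _ ≤ ‖p‖ + 1 := (norm_add_le _ _).trans (by gcongr; linarith)
          _ ≤ R := hpR
      have := hP p hpS g h.contDiff y r e₃ le_rfl he₃1 (by linarith)
        ((h.first y hyR).trans (by linarith)) ((h.second y hyR).trans (by linarith)) (h.third y hyR)
      exact ⟨this.1, this.2.2.1⟩
    have := (convex_closedBall p (KZ * e₅)).norm_image_sub_le_of_norm_fderiv_le
      (fun y hy => (hasFDerivAt_V h.contDiff (hball y hy).1).differentiableAt)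
      (fun y hy => (hball y hy).2)
      (Metric.mem_closedBall_self (by positivity)) (show X g x θ ∈ Metric.closedBall p (KZ * e₅) by
        rw [mem_closedBall_iff_norm]; exact hZx)
    refine this.trans ?_
    calc K₁ * ‖X g x θ - p‖ ≤ K₁ * (KZ * e₅) := by gcongr
      _ = K₁ * KZ * e₅ := by ring
      _ ≤ D * e₅ := mul_le_mul_of_nonneg_right hDKK he₅0
  · have h1 : ‖fderiv ℝ g (X g x θ) - fderiv ℝ f p‖ ≤ (1 + C * KZ) * e₅ := by
      calc _ = ‖(fderiv ℝ g (X g x θ) - fderiv ℝ f (X g x θ))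
            + (fderiv ℝ f (X g x θ) - fderiv ℝ f p)‖ := by congr 1; abel
        _ ≤ e₁ + C * ‖X g x θ - p‖ :=
          (norm_add_le _ _).trans (add_le_add (h.first _ hqR) (hC.norm_fderiv_sub _ p))
        _ ≤ e₅ + C * (KZ * e₅) := by gcongr; exact h.e₁_le
        _ = _ := by ring
    exact h1.trans (mul_le_mul_of_nonneg_right hDCK he₅0)
  · have hp2 := h.second p (by linarith)
    refine (hT p hpS g (hp2.trans her₂)).trans ?_
    calc K₂ * ‖d2 g p - d2 f p‖ ^ 2 ≤ K₂ * e₂ ^ 2 := by gcongr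
      _ ≤ D * e₂ ^ 2 := mul_le_mul_of_nonneg_right hDK₂ (sq_nonneg _)

/-- The deterministic expansions of the estimated filament point. -/
lemma Model.exists_expansion (m : Model f H L a) (hC : SmoothBounds f C)
    (hR : ∀ x ∈ startSet f L a, ∀ t, |t| ≤ a + 1 → ‖X f x t‖ + 1 ≤ R) :
    ∃ ε > 0, ∃ K : ℝ, 0 ≤ K ∧ ∀ g : Plane → ℝ, ∀ e₁ e₅ e₂ e₃, Near f g L a R e₁ e₅ e₂ e₃ →
      e₃ ≤ ε → ∀ x ∈ startSet f L a, ∀ τ, IsHatTheta (hitTimes g x) τ →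
      ∀ p q, p = X f x (theta f x) → q = X g x (theta f x) →
      ‖X g x τ - p + (1 / aTilde' f p
        * fderiv ℝ f p (fderiv ℝ G (d2 f p) (d2 g p - d2 f p))) • V f p‖ ≤ K * (e₅ + e₂ * e₃) ∧
      (fderiv ℝ f p = 0 →
        ‖X g x τ - q + ((aTilde' f p)⁻¹ * (fderiv ℝ (fderiv ℝ f) p (q - p) (V f p)
          + (fderiv ℝ g q - fderiv ℝ f q) (V f p))) • V f p‖ ≤ K * (e₅ * e₂)) ∧
      ‖q‖ ≤ R ∧ |(aTilde' f p)⁻¹| ≤ K := by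
  obtain ⟨ε, hε, c, hc, D, hD, hmain⟩ := m.exists_shiftBounds hC hR
  have hC0 : (0 : ℝ) ≤ C := C.2
  refine ⟨ε, hε, (D * D + D + D * D * C + (D * D + C * D + C * D) / c * C)
    + (D * (D * D * D) + D * (D * D * D) * C + (D * D + C * D ^ 2 * C) / c * C) + c⁻¹,
    by positivity, ?_⟩
  intro g e₁ e₅ e₂ e₃ h he x hx τ hτ p q hp hq
  obtain ⟨hqR, hb⟩ := hmain g _ _ _ _ h he x hx τ hτ
  rw [← hp, ← hq] at hb
  rw [← hq] at hqR
  have he₅0 : 0 ≤ e₅ := h.nonneg.trans h.e₁_le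
  have he₂0 : 0 ≤ e₂ := he₅0.trans h.e₅_le
  have he₃0 : 0 ≤ e₃ := he₂0.trans h.e₂_le
  have hsq : e₂ ^ 2 ≤ e₂ * e₃ := by rw [pow_two]; gcongr; exact h.e₂_le
  have hslope : fderiv ℝ f p (V f p) = 0 := by
    rw [← slope_eq, hp]
    exact m.slope_eq_zero (m.X_theta_mem hx)
  have hcα := hb.c_le
  have hVp := hC.norm_V p
  have hfp := hC.norm_fderiv p
  have htay := hC.taylor p q
  generalize τ - theta f x = Δ at *
  have hα0 : 0 < |aTilde' f p| := hc.trans_le hcα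
  have hdiv : ∀ {u b : ℝ}, |u| ≤ b → |u / aTilde' f p| ≤ b / c := fun {u b} hu => by
    rw [abs_div]
    exact div_le_div₀ ((abs_nonneg _).trans hu) hu hc hcα
  have hsm : ∀ {u b : ℝ}, |u| ≤ b → ‖u • V f p‖ ≤ b * C := fun {u b} hu => by
    rw [norm_smul, Real.norm_eq_abs]
    exact mul_le_mul hu hVp (norm_nonneg _) ((abs_nonneg _).trans hu)
  have hA0 : 0 ≤ D * D + D + D * D * C + (D * D + C * D + C * D) / c * C := by positivity
  have hB0 : 0 ≤ D * (D * D * D) + D * (D * D * D) * C + (D * D + C * D ^ 2 * C) / c * C := by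
    positivity
  have hc0 : 0 ≤ c⁻¹ := by positivity
  -- the error splits into the error of the motion, of the time shift, and of the slope
  have hsplit : ∀ Y : ℝ, X g x τ - q + (1 / aTilde' f p * Y) • V f p
      = (X g x τ - q - Δ • V f p) + (Δ + slope g q / aTilde' f p) • V f p
        + ((Y - slope g q) / aTilde' f p) • V f p := by
    intro Y
    have e : 1 / aTilde' f p * Y = -Δ + (Δ + slope g q / aTilde' f p)
        + (Y - slope g q) / aTilde' f p := by ring
    rw [e, add_smul, add_smul, neg_smul]
    abel
  refine ⟨?_, fun h0 => ?_, hqR, ?_⟩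
  · set Y := fderiv ℝ f p (fderiv ℝ G (d2 f p) (d2 g p - d2 f p)) with hY
    have hYψ : |Y - slope g q| ≤ (D * D + C * D) * e₅ + C * D * e₂ ^ 2 := by
      have h1 : ‖fderiv ℝ g q (V g q) - fderiv ℝ f p (V g p)‖ ≤ D * e₅ * D + C * (D * e₅) := by
        refine (clm_apply_sub_le (fderiv ℝ g q) (fderiv ℝ f p) _ _).trans ?_
        have i1 := hb.gradient
        have i2 := hb.field_norm
        have i3 := hb.field_sub
        gcongr
      have h2 : ‖fderiv ℝ f p (V g p - V f p - fderiv ℝ G (d2 f p) (d2 g p - d2 f p))‖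
          ≤ C * (D * e₂ ^ 2) := by
        refine ((fderiv ℝ f p).le_opNorm _).trans ?_
        have i1 := hb.taylor
        gcongr
      have e : slope g q - Y = (fderiv ℝ g q (V g q) - fderiv ℝ f p (V g p))
          + fderiv ℝ f p (V g p - V f p - fderiv ℝ G (d2 f p) (d2 g p - d2 f p)) := by
        rw [map_sub, map_sub, hslope, slope_eq, hY]
        ring
      rw [abs_sub_comm, e, ← Real.norm_eq_abs]
      refine (norm_add_le _ _).trans ((add_le_add h1 h2).trans (le_of_eq ?_))
      ring
    have hlin : |Δ + slope g q / aTilde' f p| ≤ D * e₃ * (D * e₂) :=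
      hb.linear.trans (by gcongr; exact hb.shift')
    have hmove : ‖X g x τ - q - Δ • V f p‖ ≤ D * e₂ * (D * e₂) :=
      hb.move.trans (by gcongr; exact hb.shift')
    have e : X g x τ - p + (1 / aTilde' f p * Y) • V f p
        = (X g x τ - q + (1 / aTilde' f p * Y) • V f p) + (q - p) := by abel
    rw [e, hsplit]
    have n1 := hsm hlin
    have n2 := hsm (hdiv hYψ)
    have n3 := hb.flow
    refine (norm_add_le _ _).trans ((add_le_add ((norm_add_le _ _).trans
      (add_le_add ((norm_add_le _ _).trans (add_le_add hmove n1)) n2)) n3).trans ?_)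
    have k1 : D * e₂ * (D * e₂) ≤ D * D * (e₅ + e₂ * e₃) := by
      calc D * e₂ * (D * e₂) = D * D * e₂ ^ 2 := by ring
        _ ≤ _ := by gcongr; linarith
    have k2 : D * e₃ * (D * e₂) * C ≤ D * D * C * (e₅ + e₂ * e₃) := by
      calc D * e₃ * (D * e₂) * C = D * D * C * (e₂ * e₃) := by ring
        _ ≤ _ := by gcongr; linarith
    have k3 : ((D * D + C * D) * e₅ + C * D * e₂ ^ 2) / c * C
        ≤ (D * D + C * D + C * D) / c * C * (e₅ + e₂ * e₃) := by
      have h0 : 0 ≤ e₂ * e₃ := by positivity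
      calc _ ≤ ((D * D + C * D) * (e₅ + e₂ * e₃) + C * D * (e₅ + e₂ * e₃)) / c * C := by
            gcongr <;> linarith
        _ = _ := by ring
    have k4 : D * e₅ ≤ D * (e₅ + e₂ * e₃) := by
      gcongr
      linarith [mul_nonneg he₂0 he₃0]
    have k5 : 0 ≤ e₅ + e₂ * e₃ := by positivity
    have k6 := mul_nonneg hB0 k5
    have k7 := mul_nonneg hc0 k5
    linarith
  · have hψ : |slope g q| ≤ D * e₅ * D := by
      have i1 := hb.gradient
      rw [h0, sub_zero] at i1
      have i2 := hb.field_norm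
      rw [slope_eq]
      refine ((fderiv ℝ g q).le_opNorm _).trans ?_
      gcongr
    have hΔ : |Δ| ≤ D * D * D * e₅ := by
      have i1 := hb.shift
      calc |Δ| ≤ D * |slope g q| := i1
        _ ≤ D * (D * e₅ * D) := by gcongr
        _ = _ := by ring
    have hYψ : |fderiv ℝ (fderiv ℝ f) p (q - p) (V f p) + (fderiv ℝ g q - fderiv ℝ f q) (V f p)
        - slope g q| ≤ (D * D + C * D ^ 2 * C) * (e₅ * e₂) := by
      have i1 := hb.gradient
      rw [h0, sub_zero] at i1
      have i2 := hb.field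
      have i3 := hb.flow
      rw [h0, sub_zero] at htay
      have h1 : ‖fderiv ℝ g q (V g q - V f p)‖ ≤ D * e₅ * (D * e₂) :=
        ((fderiv ℝ g q).le_opNorm _).trans (by gcongr)
      have h2 : ‖(fderiv ℝ f q - fderiv ℝ (fderiv ℝ f) p (q - p)) (V f p)‖
          ≤ C * (D * e₅) ^ 2 * C := by
        refine (ContinuousLinearMap.le_opNorm _ _).trans ?_
        refine mul_le_mul (htay.trans ?_) hVp (norm_nonneg _) (by positivity)
        gcongr
      have e : slope g q - (fderiv ℝ (fderiv ℝ f) p (q - p) (V f p)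
            + (fderiv ℝ g q - fderiv ℝ f q) (V f p))
          = fderiv ℝ g q (V g q - V f p)
            + (fderiv ℝ f q - fderiv ℝ (fderiv ℝ f) p (q - p)) (V f p) := by
        rw [map_sub (fderiv ℝ g q), slope_eq, sub_apply, sub_apply]
        ring
      rw [abs_sub_comm, e, ← Real.norm_eq_abs]
      refine (norm_add_le _ _).trans ((add_le_add h1 h2).trans ?_)
      have h3 : e₅ ^ 2 ≤ e₅ * e₂ := by rw [pow_two]; gcongr; exact h.e₅_le
      calc D * e₅ * (D * e₂) + C * (D * e₅) ^ 2 * C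
          = D * D * (e₅ * e₂) + C * D ^ 2 * C * e₅ ^ 2 := by ring
        _ ≤ D * D * (e₅ * e₂) + C * D ^ 2 * C * (e₅ * e₂) := by gcongr
        _ = _ := by ring
    have hlin : |Δ + slope g q / aTilde' f p| ≤ D * e₂ * (D * D * D * e₅) :=
      (hb.linear_of_zero h0).trans (by gcongr)
    have hmove : ‖X g x τ - q - Δ • V f p‖ ≤ D * e₂ * (D * D * D * e₅) :=
      hb.move.trans (by gcongr)
    rw [← one_div, hsplit]
    have n1 := hsm hlin
    have n2 := hsm (hdiv hYψ)
    refine (norm_add_le _ _).trans ((add_le_add ((norm_add_le _ _).trans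
      (add_le_add hmove n1)) n2).trans ?_)
    have k6 : 0 ≤ e₅ * e₂ := by positivity
    have k7 := mul_nonneg hA0 k6
    have k8 := mul_nonneg hc0 k6
    have k9 : D * e₂ * (D * D * D * e₅) + D * e₂ * (D * D * D * e₅) * C
          + (D * D + C * D ^ 2 * C) * (e₅ * e₂) / c * C
        = (D * (D * D * D) + D * (D * D * D) * C + (D * D + C * D ^ 2 * C) / c * C)
          * (e₅ * e₂) := by ring
    rw [k9]
    linarith
  · rw [abs_inv]
    have : |aTilde' f p|⁻¹ ≤ c⁻¹ := inv_anti₀ hc hcα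
    linarith

end Expansion

/-! ### Uniform concentration of empirical means -/

section Concentration

variable {Ω E : Type*} [MeasurableSpace Ω] [MeasurableSpace E] {P : Measure Ω}
  [IsProbabilityMeasure P] {μ : Measure E} {ξ : ℕ → Ω → E}

lemma integrable_of_abs_le {ν : Measure E} [IsFiniteMeasure ν] {g : E → ℝ} {b : ℝ}
    (hg : Measurable g) (hb : ∀ y, |g y| ≤ b) : Integrable g ν :=
  Integrable.of_bound hg.aestronglyMeasurable b (Eventually.of_forall hb)

/-- Chernoff's bound for bounded summands with a bound on the second moment. -/
lemma measure_sum_ge_le [IsProbabilityMeasure μ] (hξ : ∀ i, Measurable (ξ i)) (hind : iIndepFun ξ P)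
    (hlaw : ∀ i, P.map (ξ i) = μ) {g : E → ℝ} (hg : Measurable g) {b v l : ℝ}
    (hb : ∀ y, |g y| ≤ b) (hv : ∫ y, g y ^ 2 ∂μ ≤ v) (hl : 0 ≤ l) (hlb : l * b ≤ 1) (n : ℕ)
    (t : ℝ) :
    P.real {ω | t ≤ ∑ i ∈ Finset.range n, g (ξ i ω) - n * ∫ y, g y ∂μ}
      ≤ Real.exp (-(l * t) + n * (l ^ 2 * v)) := by
  set Y : ℕ → Ω → ℝ := fun i ω => g (ξ i ω) with hY
  have hYm : ∀ i, Measurable (Y i) := fun i => hg.comp (hξ i)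
  have hYind : iIndepFun Y P := hind.comp (fun _ => g) fun _ => hg
  have hexpb : ∀ y, |l * g y| ≤ 1 := fun y => by
    rw [abs_mul, abs_of_nonneg hl]
    exact (mul_le_mul_of_nonneg_left (hb y) hl).trans hlb
  have hgi : Integrable g μ := integrable_of_abs_le hg hb
  have hg2 : Integrable (fun y => g y ^ 2) μ :=
    integrable_of_abs_le (b := b ^ 2) (hg.pow_const 2) fun y => by
      rw [abs_pow]; exact pow_le_pow_left₀ (abs_nonneg _) (hb y) 2
  have hexpi : Integrable (fun y => Real.exp (l * g y)) μ :=
    integrable_of_abs_le (b := Real.exp 1) (hg.const_mul l).exp fun y => by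
      rw [abs_of_pos (Real.exp_pos _)]
      exact Real.exp_le_exp.2 ((le_abs_self _).trans (hexpb y))
  have hmgf : ∀ i, mgf (Y i) P l ≤ Real.exp (l * ∫ y, g y ∂μ + l ^ 2 * v) := by
    intro i
    have h1 : mgf (Y i) P l = ∫ y, Real.exp (l * g y) ∂μ := by
      rw [mgf, ← hlaw i, integral_map (hξ i).aemeasurable]
      exact (hg.const_mul l).exp.aestronglyMeasurable
    have h2 : ∫ y, Real.exp (l * g y) ∂μ ≤ ∫ y, (1 + l * g y + l ^ 2 * g y ^ 2) ∂μ := by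
      refine integral_mono hexpi ?_ fun y => ?_
      · exact ((integrable_const 1).add (hgi.const_mul l)).add (hg2.const_mul _)
      · have := (abs_le.1 (Real.abs_exp_sub_one_sub_id_le (hexpb y))).2
        simp only
        linarith [mul_pow l (g y) 2]
    have h3 : ∫ y, (1 + l * g y + l ^ 2 * g y ^ 2) ∂μ
        = 1 + l * ∫ y, g y ∂μ + l ^ 2 * ∫ y, g y ^ 2 ∂μ := by
      have h31 := integral_add (f := fun y => 1 + l * g y) (g := fun y => l ^ 2 * g y ^ 2)
        (μ := μ) ((integrable_const 1).add (hgi.const_mul l)) (hg2.const_mul _)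
      have h32 := integral_add (f := fun _ => (1 : ℝ)) (g := fun y => l * g y) (μ := μ)
        (integrable_const 1) (hgi.const_mul l)
      rw [h31, h32, integral_const_mul, integral_const_mul]
      simp
    rw [h1]
    refine h2.trans (h3.le.trans ?_)
    have h4 := Real.add_one_le_exp (l * ∫ y, g y ∂μ + l ^ 2 * v)
    have h5 : l ^ 2 * ∫ y, g y ^ 2 ∂μ ≤ l ^ 2 * v := by gcongr
    linarith
  have hsum : mgf (∑ i ∈ Finset.range n, Y i) P l
      ≤ Real.exp (l * ∫ y, g y ∂μ + l ^ 2 * v) ^ n := by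
    rw [hYind.mgf_sum hYm]
    calc _ ≤ ∏ i ∈ Finset.range n, Real.exp (l * ∫ y, g y ∂μ + l ^ 2 * v) :=
          Finset.prod_le_prod (fun i _ => mgf_nonneg) fun i _ => hmgf i
      _ = _ := by simp
  have hint : Integrable (fun ω => Real.exp (l * (∑ i ∈ Finset.range n, Y i) ω)) P := by
    refine integrable_of_abs_le (b := Real.exp n) ?_ fun ω => ?_
    · simp only [Finset.sum_apply]
      exact ((Finset.measurable_sum _ fun i _ => hYm i).const_mul l).exp
    · rw [abs_of_pos (Real.exp_pos _), Finset.sum_apply, Finset.mul_sum]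
      refine Real.exp_le_exp.2 ?_
      calc ∑ i ∈ Finset.range n, l * Y i ω ≤ ∑ i ∈ Finset.range n, (1 : ℝ) :=
            Finset.sum_le_sum fun i _ => (le_abs_self _).trans (hexpb (ξ i ω))
        _ = n := by simp
  have h := measure_ge_le_exp_mul_mgf (μ := P) (X := ∑ i ∈ Finset.range n, Y i)
    (t + n * ∫ y, g y ∂μ) hl hint
  have hset : {ω | t ≤ ∑ i ∈ Finset.range n, g (ξ i ω) - n * ∫ y, g y ∂μ}
      = {ω | t + n * ∫ y, g y ∂μ ≤ (∑ i ∈ Finset.range n, Y i) ω} := by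
    ext ω
    simp only [Set.mem_ofPred_eq, Finset.sum_apply, hY]
    exact le_sub_iff_add_le
  rw [hset]
  refine h.trans ?_
  calc _ ≤ Real.exp (-l * (t + n * ∫ y, g y ∂μ)) * Real.exp (l * ∫ y, g y ∂μ + l ^ 2 * v) ^ n := by
        gcongr
    _ = _ := by
      rw [← Real.exp_nat_mul, ← Real.exp_add]
      congr 1
      ring

/-- Two-sided tail bound at the scale `√(A B log n / n)`, where `B` bounds the summands and `A`
bounds their first absolute moment. -/
lemma measure_abs_mean_sub_ge_le [IsProbabilityMeasure μ] (hξ : ∀ i, Measurable (ξ i))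
    (hind : iIndepFun ξ P) (hlaw : ∀ i, P.map (ξ i) = μ) {g : E → ℝ} (hg : Measurable g)
    {A B M : ℝ} (hA : 0 < A) (hB0 : 0 < B) (hB : ∀ y, |g y| ≤ B) (hA1 : ∫ y, |g y| ∂μ ≤ A)
    {n : ℕ} (hn : 2 ≤ n) (hcond : B * Real.log n ≤ n * A) :
    P.real {ω | M * √(A * B * Real.log n / n)
        ≤ |(1 / (n : ℝ)) * ∑ i ∈ Finset.range n, g (ξ i ω) - ∫ y, g y ∂μ|}
      ≤ 2 * Real.exp (-(M - 1) * Real.log n) := by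
  have hn0 : (0 : ℝ) < n := by positivity
  have hlog : 0 < Real.log n := Real.log_pos (by exact_mod_cast hn)
  set v := A * B with hv
  have hv0 : 0 < v := by positivity
  set l := √(Real.log n / (n * v)) with hl
  have hl2 : l ^ 2 = Real.log n / (n * v) := Real.sq_sqrt (by positivity)
  have hlB : l * B ≤ 1 := by
    have h1 : (l * B) ^ 2 ≤ 1 := by
      rw [mul_pow, hl2, hv, div_mul_eq_mul_div, div_le_one (by positivity)]
      nlinarith [mul_le_mul_of_nonneg_left hcond hB0.le]
    exact (sq_le_one_iff₀ (by positivity)).1 h1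
  have hls : l * (n * √(v * Real.log n / n)) = Real.log n := by
    have h1 : l * √(v * Real.log n / n) = Real.log n / n := by
      rw [hl, ← Real.sqrt_mul (by positivity)]
      rw [show Real.log n / (n * v) * (v * Real.log n / n) = (Real.log n / n) ^ 2 by
        field_simp]
      exact Real.sqrt_sq (by positivity)
    calc l * (n * √(v * Real.log n / n)) = n * (l * √(v * Real.log n / n)) := by ring
      _ = Real.log n := by rw [h1]; field_simp
  have hnv : n * (l ^ 2 * v) = Real.log n := by rw [hl2]; field_simp
  have one : ∀ u : E → ℝ, Measurable u → (∀ y, |u y| ≤ B) → ∫ y, |u y| ∂μ ≤ A →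
      P.real {ω | n * (M * √(v * Real.log n / n))
        ≤ ∑ i ∈ Finset.range n, u (ξ i ω) - n * ∫ y, u y ∂μ}
        ≤ Real.exp (-(M - 1) * Real.log n) := by
    intro u hu huB huA
    have hui : Integrable u μ := integrable_of_abs_le hu huB
    have h2 : ∫ y, u y ^ 2 ∂μ ≤ v := by
      calc ∫ y, u y ^ 2 ∂μ ≤ ∫ y, B * |u y| ∂μ := by
            refine integral_mono ?_ (hui.abs.const_mul B) fun y => ?_
            · exact integrable_of_abs_le (b := B ^ 2) (hu.pow_const 2) fun y => by
                rw [abs_pow]; exact pow_le_pow_left₀ (abs_nonneg _) (huB y) 2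
            · simp only
              rw [← sq_abs, pow_two]
              exact mul_le_mul_of_nonneg_right (huB y) (abs_nonneg _)
        _ = B * ∫ y, |u y| ∂μ := integral_const_mul _ _
        _ ≤ v := by rw [hv, mul_comm A B]; gcongr
    refine (measure_sum_ge_le hξ hind hlaw hu huB h2 (Real.sqrt_nonneg _) hlB n _).trans ?_
    refine Real.exp_le_exp.2 (le_of_eq ?_)
    rw [hnv]
    linear_combination (-M) * hls
  have hsub : {ω | M * √(v * Real.log n / n)
        ≤ |(1 / (n : ℝ)) * ∑ i ∈ Finset.range n, g (ξ i ω) - ∫ y, g y ∂μ|}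
      ⊆ {ω | n * (M * √(v * Real.log n / n))
          ≤ ∑ i ∈ Finset.range n, g (ξ i ω) - n * ∫ y, g y ∂μ}
        ∪ {ω | n * (M * √(v * Real.log n / n))
          ≤ ∑ i ∈ Finset.range n, (-g (ξ i ω)) - n * ∫ y, (-g y) ∂μ} := by
    intro ω hω
    simp only [Set.mem_ofPred_eq, Set.mem_union] at hω ⊢
    have e : ∑ i ∈ Finset.range n, g (ξ i ω) - n * ∫ y, g y ∂μ
        = n * ((1 / (n : ℝ)) * ∑ i ∈ Finset.range n, g (ξ i ω) - ∫ y, g y ∂μ) := by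
      field_simp
    have e' : ∑ i ∈ Finset.range n, (-g (ξ i ω)) - n * ∫ y, (-g y) ∂μ
        = n * -((1 / (n : ℝ)) * ∑ i ∈ Finset.range n, g (ξ i ω) - ∫ y, g y ∂μ) := by
      rw [integral_neg, Finset.sum_neg_distrib]
      field_simp
      ring
    rw [e, e']
    rcases le_abs'.1 hω with h | h
    · right
      gcongr
      linarith
    · left
      gcongr
  calc _ ≤ _ := measureReal_mono hsub
    _ ≤ _ := measureReal_union_le _ _
    _ ≤ Real.exp (-(M - 1) * Real.log n) + Real.exp (-(M - 1) * Real.log n) := by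
      refine add_le_add (one g hg hB hA1) (one (fun y => -g y) hg.neg ?_ ?_)
      · simpa using hB
      · simpa using hA1
    _ = _ := by ring

/-- Uniform concentration of the empirical means of a family of functions whose index set is coded
by a bounded subset of `ℝᵈ` and which is Lipschitz in the index with a polynomially growing
constant: a union bound over a polynomially fine grid. -/
lemma exists_uniform_concentration [IsProbabilityMeasure μ] (hξ : ∀ i, Measurable (ξ i))
    (hind : iIndepFun ξ P) (hlaw : ∀ i, P.map (ξ i) = μ) {I : Type*} {d p : ℕ}
    (φ : I → Fin d → ℝ) {ρ : ℝ} (hφ : ∀ i k, |φ i k| ≤ ρ) (g : ℕ → I → E → ℝ)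
    (A B : ℕ → ℝ) (hg : ∀ n i, Measurable (g n i))
    (hA : ∀ᶠ n in atTop, 0 < A n) (hB0 : ∀ᶠ n in atTop, 0 < B n)
    (hB : ∀ᶠ n in atTop, ∀ i y, |g n i y| ≤ B n)
    (hA1 : ∀ᶠ n in atTop, ∀ i, ∫ y, |g n i y| ∂μ ≤ A n)
    (hcond : ∀ᶠ n : ℕ in atTop, B n * Real.log n ≤ n * A n)
    (hAB : ∀ᶠ n in atTop, 1 ≤ A n * B n)
    (hLip : ∀ᶠ n : ℕ in atTop, ∀ i j y, ∀ δ, (∀ k, |φ i k - φ j k| ≤ δ) →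
      |g n i y - g n j y| ≤ (n : ℝ) ^ p * δ) :
    ∃ M : ℝ, 0 ≤ M ∧ Tendsto (fun n : ℕ => P {ω | ∃ i, M * √(A n * B n * Real.log n / n)
      < |(1 / (n : ℝ)) * ∑ j ∈ Finset.range n, g n i (ξ j ω) - ∫ y, g n i y ∂μ|})
      atTop (𝓝 0) := by
  classical
  set q : ℕ := (p + 2) * d with hq
  refine ⟨q + 4, by positivity, ?_⟩
  have hlim : Tendsto (fun n : ℕ => ENNReal.ofReal (2 / (n : ℝ))) atTop (𝓝 0) := by
    have := ENNReal.tendsto_ofReal (tendsto_const_div_atTop_nhds_zero_nat (2 : ℝ))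
    simpa using this
  refine tendsto_of_tendsto_of_tendsto_of_le_of_le' tendsto_const_nhds hlim
    (Eventually.of_forall fun _ => zero_le) ?_
  have hbig : ∀ᶠ n : ℕ in atTop, 2 * |ρ| + 7 ≤ n := by
    obtain ⟨N, hN⟩ := exists_nat_ge (2 * |ρ| + 7)
    filter_upwards [eventually_ge_atTop N] with n hn
    exact hN.trans (by exact_mod_cast hn)
  filter_upwards [hA, hB0, hB, hA1, hcond, hAB, hLip, hbig, eventually_ge_atTop 3]
    with n hA hB0 hB hA1 hcond hAB hLip hbig hn
  have hn0 : (0 : ℝ) < n := by positivity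
  have hn1 : (1 : ℝ) ≤ n := by exact_mod_cast (by lia : 1 ≤ n)
  have hlog1 : 1 ≤ Real.log n := by
    rw [Real.le_log_iff_exp_le hn0]
    have h3 : (3 : ℝ) ≤ n := by exact_mod_cast hn
    linarith [Real.exp_one_lt_d9]
  set rate := √(A n * B n * Real.log n / n) with hrate
  have hrate1 : 1 / (n : ℝ) ≤ rate := by
    refine Real.le_sqrt_of_sq_le ?_
    rw [div_pow, one_pow, div_le_div_iff₀ (by positivity) hn0]
    nlinarith [mul_le_mul hAB hlog1 zero_le_one (by positivity)]
  -- the grid of mesh width `n ^ (-(p + 1))`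
  set w : ℝ := (n : ℝ) ^ (p + 1) with hw
  have hw1 : 1 ≤ w := one_le_pow₀ hn1
  have hw0 : 0 < w := by positivity
  set cell : I → Fin d → ℤ := fun i k => ⌊φ i k * w⌋ with hcell
  set N : ℤ := ⌈|ρ| * w⌉ + 1 with hN
  set cells : Finset (Fin d → ℤ) := Fintype.piFinset fun _ => Finset.Icc (-N) N with hcells
  have hmem : ∀ i, cell i ∈ cells := by
    intro i
    rw [hcells, Fintype.mem_piFinset]
    intro k
    have h1 : |φ i k * w| ≤ |ρ| * w := by
      rw [abs_mul, abs_of_pos hw0]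
      exact mul_le_mul_of_nonneg_right ((hφ i k).trans (le_abs_self _)) hw0.le
    have h2 := abs_le.1 h1
    have h3 : (⌈|ρ| * w⌉ : ℝ) ≥ |ρ| * w := Int.le_ceil _
    rw [Finset.mem_Icc]
    constructor
    · rw [hcell, Int.le_floor]
      push_cast [hN]
      linarith
    · have h4 : ⌊φ i k * w⌋ ≤ ⌈|ρ| * w⌉ := by
        have := (Int.floor_le (φ i k * w)).trans (h2.2.trans h3)
        exact_mod_cast this
      simp only [hcell, hN]
      lia
  have hcard : (cells.card : ℝ) ≤ (n : ℝ) ^ q := by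
    rw [hcells, Fintype.card_piFinset_const, Int.card_Icc, hq, pow_mul]
    push_cast
    gcongr
    have hN0 : 0 ≤ N := by positivity
    have h1 : ((N + 1 - -N).toNat : ℝ) = 2 * N + 1 := by
      have : ((N + 1 - -N).toNat : ℤ) = 2 * N + 1 := by rw [Int.toNat_of_nonneg (by lia)]; ring
      exact_mod_cast this
    rw [h1, hN]
    push_cast
    have h2 := Int.ceil_lt_add_one (|ρ| * w)
    calc (2 : ℝ) * (⌈|ρ| * w⌉ + 1) + 1 ≤ 2 * |ρ| * w + 5 := by linarith
      _ ≤ (2 * |ρ| + 7) * w := by nlinarith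
      _ ≤ n * w := by gcongr
      _ = (n : ℝ) ^ (p + 2) := by rw [hw]; ring
  have hfloor : ∀ i j, cell i = cell j → ∀ k, |φ i k - φ j k| ≤ 1 / w := by
    intro i j hij k
    have h1 : ⌊φ i k * w⌋ = ⌊φ j k * w⌋ := congrFun hij k
    have h2 := (Int.abs_sub_lt_one_of_floor_eq_floor h1).le
    rw [← sub_mul, abs_mul, abs_of_pos hw0] at h2
    rwa [le_div_iff₀ hw0]
  have hdiff : ∀ i j, cell i = cell j → ∀ y, |g n i y - g n j y| ≤ 1 / n := by
    intro i j hij y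
    refine (hLip i j y _ (hfloor i j hij)).trans (le_of_eq ?_)
    rw [hw, pow_succ]
    field_simp
  have hdev : ∀ i j, cell i = cell j → ∀ ω,
      |(1 / (n : ℝ)) * ∑ l ∈ Finset.range n, g n i (ξ l ω) - ∫ y, g n i y ∂μ|
        ≤ |(1 / (n : ℝ)) * ∑ l ∈ Finset.range n, g n j (ξ l ω) - ∫ y, g n j y ∂μ| + 2 * (1 / n) := by
    intro i j hij ω
    have h1 : |(1 / (n : ℝ)) * ∑ l ∈ Finset.range n, g n i (ξ l ω)
        - (1 / (n : ℝ)) * ∑ l ∈ Finset.range n, g n j (ξ l ω)| ≤ 1 / n := by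
      rw [← mul_sub, ← Finset.sum_sub_distrib, abs_mul, abs_of_pos (by positivity)]
      have : |∑ l ∈ Finset.range n, (g n i (ξ l ω) - g n j (ξ l ω))| ≤ n * (1 / n) := by
        refine (Finset.abs_sum_le_sum_abs _ _).trans ?_
        calc _ ≤ ∑ l ∈ Finset.range n, 1 / (n : ℝ) :=
              Finset.sum_le_sum fun l _ => hdiff i j hij _
          _ = _ := by simp
      calc 1 / (n : ℝ) * |∑ l ∈ Finset.range n, (g n i (ξ l ω) - g n j (ξ l ω))|
          ≤ 1 / n * (n * (1 / n)) := by gcongr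
        _ = 1 / n := by field_simp
    have h2 : |∫ y, g n i y ∂μ - ∫ y, g n j y ∂μ| ≤ 1 / n := by
      rw [← integral_sub (integrable_of_abs_le (hg n i) (hB i))
        (integrable_of_abs_le (hg n j) (hB j))]
      have := norm_integral_le_of_norm_le_const (μ := μ) (f := fun y => g n i y - g n j y)
        (C := 1 / n) (Eventually.of_forall fun y => hdiff i j hij y)
      simpa using this
    have h3 := abs_le.1 h1
    have h4 := abs_le.1 h2
    rw [abs_le]
    have h5 := neg_abs_le ((1 / (n : ℝ)) * ∑ l ∈ Finset.range n, g n j (ξ l ω) - ∫ y, g n j y ∂μ)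
    have h6 := le_abs_self ((1 / (n : ℝ)) * ∑ l ∈ Finset.range n, g n j (ξ l ω) - ∫ y, g n j y ∂μ)
    exact ⟨by linarith, by linarith⟩
  set bad : (Fin d → ℤ) → Set Ω := fun c => if h : ∃ i, cell i = c then
    {ω | ((q : ℝ) + 2) * rate
      ≤ |(1 / (n : ℝ)) * ∑ l ∈ Finset.range n, g n h.choose (ξ l ω) - ∫ y, g n h.choose y ∂μ|}
    else ∅ with hbad
  have hsub : {ω | ∃ i, ((q : ℝ) + 4) * rate
      < |(1 / (n : ℝ)) * ∑ l ∈ Finset.range n, g n i (ξ l ω) - ∫ y, g n i y ∂μ|}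
      ⊆ ⋃ c ∈ cells, bad c := by
    rintro ω ⟨i, hi⟩
    rw [Set.mem_iUnion₂]
    refine ⟨cell i, hmem i, ?_⟩
    have hex : ∃ j, cell j = cell i := ⟨i, rfl⟩
    simp only [hbad]
    rw [dif_pos hex]
    have := hdev i hex.choose hex.choose_spec.symm ω
    simp only [Set.mem_ofPred_eq]
    linarith
  have hone : ∀ c, P (bad c) ≤ ENNReal.ofReal (2 / (n : ℝ) ^ (q + 1)) := by
    intro c
    simp only [hbad]
    split_ifs with h
    · have h1 := measure_abs_mean_sub_ge_le (M := q + 2) hξ hind hlaw (hg n h.choose) hA hB0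
        (hB h.choose) (hA1 h.choose) (by lia : 2 ≤ n) hcond
      have h2 : 2 * Real.exp (-((q : ℝ) + 2 - 1) * Real.log n) = 2 / (n : ℝ) ^ (q + 1) := by
        rw [show -((q : ℝ) + 2 - 1) * Real.log n = -(((q + 1 : ℕ) : ℝ) * Real.log n) by
          push_cast; ring, Real.exp_neg, Real.exp_nat_mul, Real.exp_log hn0]
        rfl
      rw [h2] at h1
      rw [← ofReal_measureReal]
      exact ENNReal.ofReal_le_ofReal h1
    · simp
  calc _ ≤ P (⋃ c ∈ cells, bad c) := measure_mono hsub
    _ ≤ ∑ c ∈ cells, P (bad c) := measure_biUnion_finset_le _ _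
    _ ≤ ∑ c ∈ cells, ENNReal.ofReal (2 / (n : ℝ) ^ (q + 1)) := Finset.sum_le_sum fun c _ => hone c
    _ = ENNReal.ofReal (cells.card * (2 / (n : ℝ) ^ (q + 1))) := by
      rw [Finset.sum_const, nsmul_eq_mul, ENNReal.ofReal_mul (by positivity),
        ENNReal.ofReal_natCast]
    _ ≤ ENNReal.ofReal (2 / n) := by
      refine ENNReal.ofReal_le_ofReal ?_
      calc (cells.card : ℝ) * (2 / (n : ℝ) ^ (q + 1)) ≤ (n : ℝ) ^ q * (2 / (n : ℝ) ^ (q + 1)) := by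
            gcongr
        _ = 2 / n := by rw [pow_succ]; field_simp

end Concentration

/-! ### The kernel and the density estimator -/

lemma tsupport_wordD_subset (g : Plane → ℝ) (w : List (Fin 2)) :
    tsupport (wordD w g) ⊆ tsupport g := by
  induction w with
  | nil => exact subset_rfl
  | cons i w ih => exact (tsupport_fderiv_apply_subset ℝ (EuclideanSpace.single i 1)).trans ih

lemma wordD_append (w w' : List (Fin 2)) (g : Plane → ℝ) :
    wordD (w ++ w') g = wordD w (wordD w' g) := List.foldr_append

/-- Bounds and Lipschitz constants for the partial derivatives of the kernel up to the third order,
which vanish outside the unit ball. -/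
structure KernelBounds (K : Plane → ℝ) (B : ℝ) : Prop where
  one_le : 1 ≤ B
  diff : DiffUpTo 4 K
  bound : ∀ w : List (Fin 2), w.length ≤ 3 → ∀ x, |wordD w K x| ≤ B
  lip : ∀ w : List (Fin 2), w.length ≤ 3 → ∀ x y, |wordD w K x - wordD w K y| ≤ B * ‖x - y‖
  zero : ∀ (w : List (Fin 2)) x, 1 < ‖x‖ → wordD w K x = 0

lemma IsKernel.exists_bounds {K : Plane → ℝ} (hK : IsKernel K) : ∃ B, KernelBounds K B := by
  have hd : DiffUpTo 4 K := diffUpTo_four_of_iteratedFDeriv hK.contDiff hK.differentiable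
  have hzero : ∀ (w : List (Fin 2)) x, 1 < ‖x‖ → wordD w K x = 0 := fun w x hx => by
    by_contra h
    have h1 := tsupport_wordD_subset K w (subset_tsupport _ h)
    rw [hK.support, mem_closedBall_zero_iff] at h1
    linarith
  obtain ⟨D, hD0, hD⟩ := exists_word_bound (g := K) (fun _ => True) fun w hw _ => by
    rcases Nat.eq_zero_or_pos w.length with h0 | h0
    · rw [List.length_eq_zero_iff.1 h0, wordD_nil]
      have hc : HasCompactSupport K :=
        (by rw [hK.support]; exact isCompact_closedBall 0 1 : IsCompact (tsupport K))
      exact hc.exists_bound_of_continuous hK.contDiff.continuous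
    · exact BoundedPartials.wordD hK.bounded hd w h0 hw
  refine ⟨2 * D + 1, by linarith, hd, fun w hw x => ?_, fun w hw x y => ?_, hzero⟩
  · linarith [hD w (by lia) trivial x]
  · refine (abs_wordD_sub_le w (hd w (by lia)) (C := D) (fun i x => ?_) x y).trans ?_
    · exact hD (i :: w) (by simp; lia) trivial x
    · gcongr
      linarith

lemma KernelBounds.continuous {K : Plane → ℝ} {B : ℝ} (hB : KernelBounds K B) {w : List (Fin 2)}
    (hw : w.length ≤ 3) : Continuous (wordD w K) :=
  (hB.diff w (by lia)).continuous

/-- The partial derivative along `w` of the rescaled kernel `η⁻² K ((· - y) / η)` at `x`. -/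
def scaledKernel (K : Plane → ℝ) (η : ℝ) (w : List (Fin 2)) (x y : Plane) : ℝ :=
  (η ^ (2 + w.length))⁻¹ * wordD w K (η⁻¹ • (x - y))

section ScaledKernel

variable {K : Plane → ℝ} {B η : ℝ} {w : List (Fin 2)}

lemma KernelBounds.abs_scaledKernel_le (hB : KernelBounds K B) (hη : 0 < η) (hw : w.length ≤ 3)
    (x y : Plane) : |scaledKernel K η w x y| ≤ (η ^ (2 + w.length))⁻¹ * B := by
  rw [scaledKernel, abs_mul, abs_of_pos (by positivity)]
  gcongr
  exact hB.bound w hw _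

lemma KernelBounds.scaledKernel_eq_zero (hB : KernelBounds K B) (hη : 0 < η) {x y : Plane}
    (h : η < ‖x - y‖) : scaledKernel K η w x y = 0 := by
  rw [scaledKernel, hB.zero, mul_zero]
  rw [norm_smul, norm_inv, Real.norm_of_nonneg hη.le, inv_mul_eq_div, one_lt_div hη]
  exact h

lemma KernelBounds.abs_scaledKernel_sub_le (hB : KernelBounds K B) (hη : 0 < η)
    (hw : w.length ≤ 3) (x x' y : Plane) :
    |scaledKernel K η w x y - scaledKernel K η w x' y|
      ≤ (η ^ (3 + w.length))⁻¹ * B * ‖x - x'‖ := by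
  rw [scaledKernel, scaledKernel, ← mul_sub, abs_mul, abs_of_pos (by positivity)]
  have h := hB.lip w hw (η⁻¹ • (x - y)) (η⁻¹ • (x' - y))
  rw [← smul_sub, sub_sub_sub_cancel_right, norm_smul, norm_inv, Real.norm_of_nonneg hη.le] at h
  calc _ ≤ (η ^ (2 + w.length))⁻¹ * (B * (η⁻¹ * ‖x - x'‖)) := by gcongr
    _ = _ := by
      rw [show 3 + w.length = (2 + w.length) + 1 by ring, pow_succ, mul_inv]
      ring

lemma KernelBounds.continuous_scaledKernel (hB : KernelBounds K B) (hw : w.length ≤ 3) :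
    Continuous fun p : Plane × Plane => scaledKernel K η w p.1 p.2 := by
  have := hB.continuous hw
  unfold scaledKernel
  fun_prop

lemma partialD_rescaled_sum {φ : Plane → ℝ} (hφ : Differentiable ℝ φ) (i : Fin 2) (c r : ℝ) {n : ℕ}
    (y : ℕ → Plane) :
    partialD i (fun x => c * ∑ j ∈ Finset.range n, φ (r • (x - y j)))
      = fun x => (c * r) * ∑ j ∈ Finset.range n, partialD i φ (r • (x - y j)) := by
  funext x
  have h1 : ∀ j, HasFDerivAt (fun x => φ (r • (x - y j)))
      ((fderiv ℝ φ (r • (x - y j))).comp (r • ContinuousLinearMap.id ℝ Plane)) x := fun j =>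
    (hφ _).hasFDerivAt.comp x (((hasFDerivAt_id x).sub_const (y j)).const_smul r)
  have h2 : HasFDerivAt (fun x => c * ∑ j ∈ Finset.range n, φ (r • (x - y j)))
      (c • ∑ j ∈ Finset.range n,
        (fderiv ℝ φ (r • (x - y j))).comp (r • ContinuousLinearMap.id ℝ Plane)) x :=
    (HasFDerivAt.fun_sum fun j _ => h1 j).const_mul c
  rw [partialD, h2.fderiv, smul_apply, sum_apply,
    smul_eq_mul, mul_assoc, Finset.mul_sum (a := r)]
  congr 1
  refine Finset.sum_congr rfl fun j _ => ?_
  simp [partialD]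

variable {Ω : Type*} {h : ℕ → ℝ} {ξ : ℕ → Ω → Plane}

lemma KernelBounds.wordD_fHat (hB : KernelBounds K B) (n : ℕ) (ω : Ω) (hw : w.length ≤ 4) :
    wordD w (fHat K h ξ n ω) = fun x => 1 / (n : ℝ) *
      ∑ j ∈ Finset.range n, scaledKernel K (h n) w x (ξ j ω) := by
  have key : wordD w (fHat K h ξ n ω) = fun x => (1 / ((n : ℝ) * h n ^ 2) * ((h n)⁻¹) ^ w.length)
      * ∑ j ∈ Finset.range n, wordD w K ((h n)⁻¹ • (x - ξ j ω)) := by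
    induction w with
    | nil => simp only [wordD_nil, List.length_nil, pow_zero, mul_one]; rfl
    | cons i w ih =>
      rw [List.length_cons] at hw
      rw [wordD_cons, ih (by lia), partialD_rescaled_sum (hB.diff w (by lia))]
      funext x
      rw [List.length_cons, pow_succ _ w.length, mul_assoc (1 / ((n : ℝ) * h n ^ 2)), wordD_cons]
  rw [key]
  funext x
  simp only [scaledKernel, ← Finset.mul_sum, ← mul_assoc]
  congr 1
  rw [pow_add, mul_inv, inv_pow, one_div, one_div, mul_inv]
  ring

lemma contDiff_fHat (hK : ContDiff ℝ 3 K) (n : ℕ) (ω : Ω) : ContDiff ℝ 3 (fHat K h ξ n ω) := by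
  refine contDiff_const.mul (ContDiff.sum fun j _ => hK.comp ?_)
  exact (contDiff_id.sub contDiff_const).const_smul _

lemma KernelBounds.exists_wordD_fHat_le (hB : KernelBounds K B) {n : ℕ} (hh : 0 < h n) (ω : Ω)
    (hw : w.length ≤ 3) : ∃ C, ∀ x, |wordD w (fHat K h ξ n ω) x| ≤ C := by
  refine ⟨|1 / (n : ℝ)| * ∑ j ∈ Finset.range n, (h n ^ (2 + w.length))⁻¹ * B, fun x => ?_⟩
  rw [hB.wordD_fHat n ω (by lia), abs_mul]
  gcongr
  exact (Finset.abs_sum_le_sum_abs _ _).trans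
    (Finset.sum_le_sum fun j _ => hB.abs_scaledKernel_le hh hw x _)

end ScaledKernel

/-! ### The bias of the density estimator -/

/-- The distribution with density `f`. -/
def densityMeasure (f : Plane → ℝ) : Measure Plane :=
  volume.withDensity fun x => ENNReal.ofReal (f x)

lemma SmoothDensity.isProbabilityMeasure {f : Plane → ℝ} (hf : SmoothDensity f) :
    IsProbabilityMeasure (densityMeasure f) := by
  constructor
  rw [densityMeasure, withDensity_apply _ MeasurableSet.univ, Measure.restrict_univ,
    ← ofReal_integral_eq_lintegral_ofReal hf.integrable (Eventually.of_forall hf.nonneg),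
    hf.integral_eq_one, ENNReal.ofReal_one]

lemma SmoothDensity.integral_densityMeasure {f : Plane → ℝ} (hf : SmoothDensity f) (φ : Plane → ℝ) :
    ∫ y, φ y ∂densityMeasure f = ∫ y, φ y * f y := by
  rw [densityMeasure, integral_withDensity_eq_integral_toReal_smul
    hf.contDiff.continuous.measurable.ennreal_ofReal (Eventually.of_forall fun _ => by simp)]
  refine integral_congr_ae (Eventually.of_forall fun y => ?_)
  simp only [ENNReal.toReal_ofReal (hf.nonneg y), smul_eq_mul, mul_comm]

section Bias

variable {f K : Plane → ℝ} {B η : ℝ}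

lemma KernelBounds.hasCompactSupport (hB : KernelBounds K B) (w : List (Fin 2)) :
    HasCompactSupport (wordD w K) :=
  HasCompactSupport.intro (isCompact_closedBall (0 : Plane) 1) fun x hx => hB.zero w x (by
    rw [mem_closedBall_zero_iff] at hx
    exact not_le.1 hx)

lemma KernelBounds.integrable_mul (hB : KernelBounds K B) {w : List (Fin 2)} (hw : w.length ≤ 3)
    {φ : Plane → ℝ} (hφ : Continuous φ) : Integrable fun u => wordD w K u * φ u :=
  ((hB.continuous hw).mul hφ).integrable_of_hasCompactSupport (hB.hasCompactSupport w).mul_right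

lemma fderiv_comp_sub_smul {g : Plane → ℝ} (hg : Differentiable ℝ g) (x : Plane) (η : ℝ) (i : Fin 2)
    (u : Plane) : fderiv ℝ (fun u => g (x - η • u)) u (EuclideanSpace.single i 1)
      = -(η * partialD i g (x - η • u)) := by
  have h1 : HasFDerivAt (fun u => g (x - η • u))
      ((fderiv ℝ g (x - η • u)).comp (-(η • ContinuousLinearMap.id ℝ Plane))) u :=
    (hg _).hasFDerivAt.comp u (((hasFDerivAt_id u).const_smul η).const_sub x)
  rw [h1.fderiv]
  simp [partialD]

/-- Repeated integration by parts moves the derivatives from the kernel to the density. -/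
lemma KernelBounds.integral_wordD_mul (hB : KernelBounds K B) (hη : 0 < η) (x : Plane)
    (w : List (Fin 2)) (hw : w.length ≤ 3) :
    ∀ g : Plane → ℝ, ContDiff ℝ ((w.length : ℕ) : WithTop ℕ∞) g →
      (η ^ w.length)⁻¹ * ∫ u, wordD w K u * g (x - η • u)
        = ∫ u, K u * wordD w.reverse g (x - η • u) := by
  induction w with
  | nil => intro g _; simp
  | cons i w ih =>
    intro g hg
    rw [List.length_cons] at hw hg
    have hgd : Differentiable ℝ g := hg.differentiable (by simp)
    have hg' : ContDiff ℝ ((w.length : ℕ) : WithTop ℕ∞) (partialD i g) :=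
      ContDiff.wordD [i] (by simpa using hg)
    have hparts := integral_mul_fderiv_eq_neg_fderiv_mul_of_integrable (μ := volume)
      (f := fun u => g (x - η • u)) (g := wordD w K) (v := EuclideanSpace.single i 1)
      ?_ ?_ ?_ (fun u _ => ?_) (fun u _ => hB.diff w (by lia) u)
    · have e1 : ∫ u, wordD (i :: w) K u * g (x - η • u)
          = η * ∫ u, wordD w K u * partialD i g (x - η • u) := by
        calc _ = ∫ u, g (x - η • u) * fderiv ℝ (wordD w K) u (EuclideanSpace.single i 1) := by
              refine integral_congr_ae (Eventually.of_forall fun u => ?_)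
              exact mul_comm _ _
          _ = _ := by
              rw [hparts, ← integral_neg, ← integral_const_mul]
              refine integral_congr_ae (Eventually.of_forall fun u => ?_)
              simp only [fderiv_comp_sub_smul hgd]
              ring
      rw [e1, List.length_cons, pow_succ, mul_inv, mul_assoc, inv_mul_cancel_left₀ hη.ne',
        ih (by lia) _ hg', List.reverse_cons, wordD_append]
      rfl
    · simp only [fderiv_comp_sub_smul hgd]
      refine (hB.integrable_mul (w := w) (by lia)
        (φ := fun u => -(η * partialD i g (x - η • u))) ?_).congr
        (Eventually.of_forall fun u => mul_comm _ _)
      have := hg'.continuous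
      fun_prop
    · refine (hB.integrable_mul (w := i :: w) (by simpa using hw)
        (φ := fun u => g (x - η • u)) ?_).congr (Eventually.of_forall fun u => mul_comm _ _)
      have := hg.continuous
      fun_prop
    · refine (hB.integrable_mul (w := w) (by lia)
        (φ := fun u => g (x - η • u)) ?_).congr (Eventually.of_forall fun u => mul_comm _ _)
      have := hg.continuous
      fun_prop
    · exact hgd.differentiableAt.comp u (by fun_prop)

/-- The mean of the derivative of the estimator is a local average of the derivative of `f`. -/
lemma KernelBounds.integral_scaledKernel (hB : KernelBounds K B) (hf : SmoothDensity f)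
    (hη : 0 < η) (x : Plane) (w : List (Fin 2)) (hw : w.length ≤ 3) :
    ∫ y, scaledKernel K η w x y ∂densityMeasure f = ∫ u, K u * wordD w f (x - η • u) := by
  have hfw : ContDiff ℝ ((w.length : ℕ) : WithTop ℕ∞) f :=
    hf.contDiff.of_le (by exact_mod_cast (by lia : w.length ≤ 4))
  rw [hf.integral_densityMeasure]
  have h1 : ∫ y, scaledKernel K η w x y * f y
      = ∫ y, scaledKernel K η w x (x - y) * f (x - y) :=
    (integral_sub_left_eq_self (fun y => scaledKernel K η w x y * f y) volume x).symm
  have h2 := Measure.integral_comp_smul (volume : Measure Plane)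
    (fun y => scaledKernel K η w x (x - y) * f (x - y)) η
  have h3 : ∫ u, scaledKernel K η w x (x - η • u) * f (x - η • u)
      = (η ^ (2 + w.length))⁻¹ * ∫ u, wordD w K u * f (x - η • u) := by
    rw [← integral_const_mul]
    refine integral_congr_ae (Eventually.of_forall fun u => ?_)
    simp only [scaledKernel, sub_sub_cancel, inv_smul_smul₀ hη.ne', mul_assoc]
  have h4 := hB.integral_wordD_mul hη x w hw f hfw
  rw [h3, finrank_euclideanSpace_fin, abs_of_pos (by positivity), smul_eq_mul, pow_add, mul_inv,
    mul_assoc] at h2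
  have h5 := mul_left_cancel₀ (by positivity) h2
  rw [h1, ← h5, h4]
  rw [wordD_perm (List.reverse_perm w) (ContDiff.diffUpTo (by simpa using hfw))]

lemma KernelBounds.integrable (hB : KernelBounds K B) : Integrable K := by
  simpa using hB.integrable_mul (w := []) (by simp) (φ := fun _ => 1) continuous_const

/-- A local average differs from the value by at most the error of the approximation that is
integrated, provided the latter holds on the support of the kernel. -/
lemma KernelBounds.abs_integral_mul_le (hB : KernelBounds K B) (hK : IsKernel K) {φ : Plane → ℝ}
    {e : ℝ} (hφ : ∀ u, ‖u‖ ≤ 1 → |φ u| ≤ e) : |∫ u, K u * φ u| ≤ e := by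
  have h : ‖∫ u, K u * φ u‖ ≤ ∫ u, e * K u := by
    refine norm_integral_le_of_norm_le (hB.integrable.const_mul e)
      (Eventually.of_forall fun u => ?_)
    rw [Real.norm_eq_abs, abs_mul, abs_of_nonneg (hK.nonneg u), mul_comm]
    rcases le_or_gt ‖u‖ 1 with hu | hu
    · exact mul_le_mul_of_nonneg_right (hφ u hu) (hK.nonneg u)
    · have := hB.zero [] u hu
      rw [wordD_nil] at this
      simp [this]
  rwa [integral_const_mul, hK.integral_eq_one, mul_one] at h

lemma integral_mul_clm_eq_zero (hK : IsKernel K) (A : Plane →L[ℝ] ℝ) : ∫ u, K u * A u = 0 := by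
  have h := integral_neg_eq_self (fun u => K u * A u) (volume : Measure Plane)
  simp only [hK.symm, map_neg, mul_neg, integral_neg] at h
  linarith

lemma KernelBounds.integral_mul_sub (hB : KernelBounds K B) (hK : IsKernel K) {φ : Plane → ℝ}
    (hφ : Continuous φ) (c : ℝ) : (∫ u, K u * φ u) - c = ∫ u, K u * (φ u - c) := by
  have h1 : Integrable fun u => K u * φ u := by
    simpa using hB.integrable_mul (w := []) (by simp) hφ
  simp only [mul_sub]
  rw [integral_sub h1 (hB.integrable.mul_const c), integral_mul_const,
    hK.integral_eq_one, one_mul]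

/-- The bias is of the order of the bandwidth. -/
lemma KernelBounds.abs_bias_le (hB : KernelBounds K B) (hK : IsKernel K) (hf : SmoothDensity f)
    {C : ℝ≥0} (hC : SmoothBounds f C) (hη : 0 < η) (x : Plane) (w : List (Fin 2))
    (h1 : 1 ≤ w.length) (hw : w.length ≤ 3) :
    |∫ y, scaledKernel K η w x y ∂densityMeasure f - wordD w f x| ≤ C * η := by
  have hc : Continuous (wordD w f) :=
    (ContDiff.wordD (m := 0) w (hf.contDiff.of_le
      (by exact_mod_cast (by lia : 0 + w.length ≤ 4)))).continuous
  rw [hB.integral_scaledKernel hf hη x w hw, hB.integral_mul_sub hK (by fun_prop)]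
  refine hB.abs_integral_mul_le hK fun u hu => ?_
  refine (hC.word_sub w h1 hw _ _).trans ?_
  rw [sub_sub_cancel_left, norm_neg, norm_smul, Real.norm_of_nonneg hη.le]
  gcongr
  exact mul_le_of_le_one_right hη.le hu

/-- The symmetry of the kernel improves the order of the bias to the square of the bandwidth. -/
lemma KernelBounds.abs_bias_le_sq (hB : KernelBounds K B) (hK : IsKernel K) (hf : SmoothDensity f)
    {C : ℝ≥0} (hC : SmoothBounds f C) (hη : 0 < η) (x : Plane) (w : List (Fin 2))
    (hw : w.length ≤ 2) :
    |∫ y, scaledKernel K η w x y ∂densityMeasure f - wordD w f x| ≤ 2 * C * η ^ 2 := by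
  have hC1 : ContDiff ℝ 1 (wordD w f) := ContDiff.wordD (m := 1) w (hf.contDiff.of_le
      (by exact_mod_cast (by lia : 1 + w.length ≤ 4)))
  have hd : Differentiable ℝ (wordD w f) := hC1.differentiable (by norm_num)
  have hc := hC1.continuous
  obtain ⟨A, hA⟩ : ∃ A : Plane →L[ℝ] ℝ, A = -(η • fderiv ℝ (wordD w f) x) := ⟨_, rfl⟩
  have hi1 : Integrable fun u => K u * (wordD w f (x - η • u) - wordD w f x) := by
    simpa using hB.integrable_mul (w := []) (by simp)
      (φ := fun u => wordD w f (x - η • u) - wordD w f x) (by fun_prop)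
  have hi2 : Integrable fun u => K u * A u := by
    simpa using hB.integrable_mul (w := []) (by simp) (φ := fun u => A u) (by fun_prop)
  rw [hB.integral_scaledKernel hf hη x w (by lia), hB.integral_mul_sub hK (by fun_prop),
    ← sub_zero (∫ u, _), ← integral_mul_clm_eq_zero hK A, ← integral_sub hi1 hi2]
  simp only [← mul_sub]
  refine hB.abs_integral_mul_le hK fun u hu => ?_
  have hr : ‖η • u‖ ≤ η := by
    rw [norm_smul, Real.norm_of_nonneg hη.le]
    exact mul_le_of_le_one_right hη.le hu
  have hbound : ∀ z ∈ Metric.closedBall x η,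
      ‖fderiv ℝ (wordD w f) z - fderiv ℝ (wordD w f) x‖ ≤ 2 * C * η := fun z hz => by
    refine (clm_norm_le _).trans ?_
    have key : ∀ i : Fin 2, ‖(fderiv ℝ (wordD w f) z - fderiv ℝ (wordD w f) x)
        (EuclideanSpace.single i 1)‖ ≤ C * η := fun i => by
      refine (hC.word_sub (i :: w) (by simp) (by simp; lia) z x).trans ?_
      gcongr
      exact mem_closedBall_iff_norm.1 hz
    linarith [key 0, key 1]
  have h := (convex_closedBall x η).norm_image_sub_le_of_norm_fderiv_le'
    (𝕜 := ℝ) (f := wordD w f) (φ := fderiv ℝ (wordD w f) x) (fun z _ => hd z) hbound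
    (Metric.mem_closedBall_self hη.le)
    (y := x - η • u) (by rw [mem_closedBall_iff_norm, sub_sub_cancel_left, norm_neg]; exact hr)
  rw [sub_sub_cancel_left, norm_neg] at h
  have e : wordD w f (x - η • u) - wordD w f x - A u
      = wordD w f (x - η • u) - wordD w f x - fderiv ℝ (wordD w f) x (-(η • u)) := by
    rw [hA, map_neg, map_smul]
    rfl
  rw [e, ← Real.norm_eq_abs]
  refine h.trans ?_
  calc _ ≤ 2 * C * η * η := by gcongr
    _ = _ := by ring

end Bias

/-! ### Bandwidths -/

section Bandwidth

variable {h : ℕ → ℝ}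

lemma tendsto_log_natCast : Tendsto (fun n : ℕ => Real.log n) atTop atTop :=
  Real.tendsto_log_atTop.comp tendsto_natCast_atTop_atTop

lemma Bandwidth.eventually_le (hh : Bandwidth h) {c : ℝ} (hc : 0 < c) : ∀ᶠ n in atTop, h n ≤ c :=
  (hh.tendsto_zero.eventually (ge_mem_nhds hc)).mono fun _ h => h

lemma Bandwidth.eventually_mul_log_le (hh : Bandwidth h) (D : ℝ) :
    ∀ᶠ n : ℕ in atTop, D * Real.log n ^ 3 ≤ n * h n ^ 8 := by
  filter_upwards [hh.lower.eventually_ge_atTop D,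
    tendsto_log_natCast.eventually_ge_atTop 1] with n h1 h2
  exact (le_div_iff₀ (by positivity)).1 h1

/-- The sample size `n` and the bandwidth `η` are in the range that `Bandwidth` guarantees for large
`n`. -/
structure Regime (n : ℕ) (η : ℝ) : Prop where
  pos : 0 < η
  le_one : η ≤ 1
  one_le_log : 1 ≤ Real.log n
  log_le : Real.log n ^ 3 ≤ n * η ^ 8

lemma Bandwidth.eventually_regime (hh : Bandwidth h) : ∀ᶠ n : ℕ in atTop, Regime n (h n) := by
  filter_upwards [hh.eventually_le one_pos, hh.eventually_mul_log_le 1,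
    tendsto_log_natCast.eventually_ge_atTop 1] with n h1 h2 h3
  exact ⟨hh.pos n, h1, h3, by simpa using h2⟩

variable {n : ℕ} {η : ℝ}

lemma Regime.n_pos (r : Regime n η) : (0 : ℝ) < n := by
  rcases Nat.eq_zero_or_pos n with h0 | h0
  · have := r.one_le_log
    rw [h0] at this
    norm_num at this
  · exact_mod_cast h0

lemma Regime.log_le_mul_pow (r : Regime n η) {k : ℕ} (hk : k ≤ 8) :
    Real.log n ≤ n * η ^ k := by
  have hn := r.n_pos
  have h1 : Real.log n ≤ Real.log n ^ 3 := le_self_pow₀ r.one_le_log (by norm_num)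
  have h2 : η ^ 8 ≤ η ^ k := pow_le_pow_of_le_one r.pos.le r.le_one hk
  calc _ ≤ _ := h1
    _ ≤ _ := r.log_le
    _ ≤ _ := by gcongr

lemma Regime.inv_pow_le (r : Regime n η) (k : ℕ) : (η ^ k)⁻¹ ≤ (n : ℝ) ^ k := by
  have hη := r.pos
  rw [← inv_pow]
  gcongr
  rw [inv_le_iff_one_le_mul₀ hη]
  simpa using r.one_le_log.trans (r.log_le_mul_pow (k := 1) (by norm_num))

lemma Regime.one_le_inv_pow (r : Regime n η) (k : ℕ) : 1 ≤ (η ^ k)⁻¹ :=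
  (one_le_inv₀ (pow_pos r.pos k)).2 (pow_le_one₀ r.pos.le r.le_one)

end Bandwidth

/-! ### Uniform rates for the density estimator -/

section Rates

variable {Ω : Type*} [MeasurableSpace Ω] {P : Measure Ω} [IsProbabilityMeasure P]
  {f K : Plane → ℝ} {B : ℝ} {h : ℕ → ℝ} {ξ : ℕ → Ω → Plane}

lemma KernelBounds.measurable_scaledKernel (hB : KernelBounds K B) (η : ℝ) {w : List (Fin 2)}
    (hw : w.length ≤ 3) (x : Plane) : Measurable (scaledKernel K η w x) :=
  ((hB.continuous_scaledKernel hw).comp (Continuous.prodMk_right x)).measurable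

lemma KernelBounds.exists_integral_abs_le (hB : KernelBounds K B) (hf : SmoothDensity f) (R : ℝ) :
    ∃ D : ℝ, 0 ≤ D ∧ ∀ η, 0 < η → η ≤ 1 → ∀ x, ‖x‖ ≤ R → ∀ w : List (Fin 2), w.length ≤ 3 →
      ∫ y, |scaledKernel K η w x y| ∂densityMeasure f ≤ (η ^ w.length)⁻¹ * D := by
  have hB0 : 0 ≤ B := zero_le_one.trans hB.one_le
  obtain ⟨F, hF⟩ := (isCompact_closedBall (0 : Plane) (R + 1)).exists_bound_of_continuousOn
    hf.contDiff.continuous.continuousOn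
  refine ⟨B * |F| * volume.real (Metric.closedBall (0 : Plane) 1), by positivity, ?_⟩
  intro η hη hη1 x hx w hw
  rw [hf.integral_densityMeasure]
  have hzero : ∀ y ∉ Metric.closedBall x η, |scaledKernel K η w x y| * f y = 0 := fun y hy => by
    rw [mem_closedBall_iff_norm', not_le] at hy
    rw [hB.scaledKernel_eq_zero hη hy, abs_zero, zero_mul]
  rw [← setIntegral_eq_integral_of_forall_compl_eq_zero hzero]
  have hle : ∀ y ∈ Metric.closedBall x η,
      ‖|scaledKernel K η w x y| * f y‖ ≤ (η ^ (2 + w.length))⁻¹ * B * |F| := fun y hy => by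
    rw [mem_closedBall_iff_norm] at hy
    rw [norm_mul, norm_abs_eq_norm]
    have h1 := hB.abs_scaledKernel_le hη hw x y
    have h2 : ‖f y‖ ≤ |F| := (hF y (by
      rw [mem_closedBall_zero_iff]
      have := norm_le_norm_add_norm_sub x y
      rw [norm_sub_rev] at hy
      linarith)).trans (le_abs_self F)
    rw [Real.norm_eq_abs]
    gcongr
  have h3 := norm_setIntegral_le_of_norm_le_const (μ := volume)
    (isCompact_closedBall x η).measure_lt_top hle
  refine (le_abs_self _).trans (h3.trans (le_of_eq ?_))
  rw [Measure.addHaar_real_closedBall' _ x hη.le, finrank_euclideanSpace_fin, pow_add, mul_inv]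
  field_simp

/-- The rate for functions of size `D η⁻ˡ` with first absolute moment `D η⁻ᵏ`. -/
lemma sqrt_inv_pow_mul_inv_pow {D : ℝ} (hD : 0 ≤ D) (n : ℕ) (η : ℝ) (k l : ℕ) :
    √((η ^ k)⁻¹ * D * ((η ^ l)⁻¹ * D) * Real.log n / n)
      = D * √(Real.log n / (n * η ^ (k + l))) := by
  rw [← Real.sqrt_sq hD, ← Real.sqrt_mul (sq_nonneg _), Real.sqrt_sq hD]
  congr 1
  rw [pow_add, div_eq_mul_inv, div_eq_mul_inv, mul_inv, mul_inv]
  ring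

/-- The partial derivatives of the estimator, of the order `k`, concentrate around their means
at the rate `√(log n / (n h^{2 + 2k}))`, uniformly on balls. -/
lemma KernelBounds.exists_pointwise_rate (hB : KernelBounds K B) (hf : SmoothDensity f)
    (hh : Bandwidth h) (hξ : IsSample P f ξ) (R : ℝ) (w : List (Fin 2)) (hw : w.length ≤ 3) :
    ∃ M : ℝ, 0 ≤ M ∧ Tendsto (fun n : ℕ => P {ω | ∃ x : Plane, ‖x‖ ≤ R ∧
      M * √(Real.log n / (n * h n ^ (2 + 2 * w.length)))
        < |wordD w (fHat K h ξ n ω) x - ∫ y, scaledKernel K (h n) w x y ∂densityMeasure f|})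
      atTop (𝓝 0) := by
  have := hf.isProbabilityMeasure
  obtain ⟨D₀, hD₀, hD⟩ := hB.exists_integral_abs_le hf R
  have hB1 := hB.one_le
  obtain ⟨D, hDB, hDD, hD1⟩ : ∃ D, B ≤ D ∧ D₀ ≤ D ∧ 1 ≤ D :=
    ⟨B + D₀, by linarith, by linarith, by linarith⟩
  have hD0 : 0 < D := by linarith
  -- the kernel is of the size `h ^ (-(2 + k))` on a disc of area `O(h²)`, so its mean is of the
  -- order `h ^ (-k)`
  have hconc := exists_uniform_concentration (P := P) (μ := densityMeasure f)
    hξ.measurable hξ.indep hξ.law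
    (I := {x : Plane // ‖x‖ ≤ R}) (d := 2) (p := 7) (fun x k => x.1 k) (ρ := R)
    (fun x k => (abs_apply_le_norm x.1 k).trans x.2)
    (fun n x y => scaledKernel K (h n) w x.1 y) (fun n => (h n ^ w.length)⁻¹ * D)
    (fun n => (h n ^ (2 + w.length))⁻¹ * D) (fun n x => hB.measurable_scaledKernel _ hw x.1)
    (Eventually.of_forall fun n => by have := hh.pos n; positivity)
    (Eventually.of_forall fun n => by have := hh.pos n; positivity) ?_ ?_ ?_ ?_ ?_
  · obtain ⟨M, hM, hlim⟩ := hconc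
    refine ⟨M * D, by positivity, hlim.congr fun n => ?_⟩
    congr 1
    ext ω
    simp only [Set.mem_ofPred_eq, sqrt_inv_pow_mul_inv_pow hD0.le, Subtype.exists, exists_prop,
      hB.wordD_fHat n ω (w := w) (by lia)]
    rw [show w.length + (2 + w.length) = 2 + 2 * w.length by ring, mul_assoc]
  · refine Eventually.of_forall fun n x y => (hB.abs_scaledKernel_le (hh.pos n) hw x.1 y).trans ?_
    have := hh.pos n
    gcongr
  · filter_upwards [hh.eventually_regime] with n r x
    have := r.pos
    exact (hD _ r.pos r.le_one x.1 x.2 w hw).trans (by gcongr)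
  · filter_upwards [hh.eventually_regime] with n r
    have h1 := r.pos
    have h2 := r.log_le_mul_pow (k := 2) (by norm_num)
    calc _ = (h n ^ (2 + w.length))⁻¹ * D * Real.log n := rfl
      _ ≤ (h n ^ (2 + w.length))⁻¹ * D * (n * h n ^ 2) := by gcongr
      _ = _ := by rw [pow_add, mul_inv]; field_simp
  · filter_upwards [hh.eventually_regime] with n r
    have h1 := r.one_le_inv_pow w.length
    have h2 := r.one_le_inv_pow (2 + w.length)
    exact one_le_mul_of_one_le_of_one_le (one_le_mul_of_one_le_of_one_le h1 hD1)
      (one_le_mul_of_one_le_of_one_le h2 hD1)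
  · filter_upwards [hh.eventually_regime, tendsto_natCast_atTop_atTop.eventually_ge_atTop (B * 2)]
      with n r hn x x' y δ hδ
    have hδ0 : 0 ≤ δ := (abs_nonneg _).trans (hδ 0)
    have hB0 : 0 ≤ B := by linarith
    have hn1 : (1 : ℝ) ≤ n := by linarith
    have hdist : ‖x.1 - x'.1‖ ≤ 2 * δ := by
      refine (norm_plane_le _).trans ?_
      have h0 := hδ 0
      have h1 := hδ 1
      simp only [PiLp.sub_apply]
      linarith
    calc _ ≤ (h n ^ (3 + w.length))⁻¹ * B * ‖x.1 - x'.1‖ :=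
          hB.abs_scaledKernel_sub_le r.pos hw _ _ _
      _ ≤ (n : ℝ) ^ (3 + w.length) * B * (2 * δ) := by
          have := r.inv_pow_le (3 + w.length)
          gcongr
      _ ≤ (n : ℝ) ^ 6 * B * (2 * δ) := by
          gcongr
          lia
      _ = (n : ℝ) ^ 6 * (B * 2) * δ := by ring
      _ ≤ (n : ℝ) ^ 6 * n * δ := by gcongr
      _ = _ := by ring

end Rates

/-! ### The rate for averages along the integral curves -/

/-- A curve with `γ |s - t| ≤ ‖u s - u t‖` spends a time of at most `2 r / γ` within the distance
`r` of a point `y`, so a function that is bounded by `b` and vanishes at all other times has an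
integral of at most `2 b r / γ`. -/
lemma abs_integral_le_of_chord {u : ℝ → Plane} {γ a b r t : ℝ} (hγ : 0 < γ)
    (hchord : ∀ s t, |s| ≤ a → |t| ≤ a → γ * |s - t| ≤ ‖u s - u t‖) (ht : |t| ≤ a)
    (hb : 0 ≤ b) (hr : 0 ≤ r) (y : Plane) {ψ : ℝ → ℝ} (hψb : ∀ s, |s| ≤ a → |ψ s| ≤ b)
    (hψ0 : ∀ s, r < ‖u s - y‖ → ψ s = 0) :
    |∫ s in (0 : ℝ)..t, ψ s| ≤ b * (2 * r / γ) := by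
  have hmem : ∀ s ∈ Set.uIoc 0 t, |s| ≤ a := fun s hs => by
    have := Set.abs_sub_left_of_mem_uIcc (Set.uIoc_subset_uIcc hs)
    simp only [sub_zero] at this
    exact this.trans ht
  obtain ⟨S, hS⟩ : ∃ S, S = Set.uIoc 0 t ∩ {s | ‖u s - y‖ ≤ r} := ⟨_, rfl⟩
  have hvol : volume S ≤ ENNReal.ofReal (2 * r / γ) := by
    refine (Real.volume_le_diam S).trans (Metric.ediam_le fun s hs s' hs' => ?_)
    rw [hS] at hs hs'
    rw [edist_dist, Real.dist_eq]
    refine ENNReal.ofReal_le_ofReal ((le_div_iff₀' hγ).2 ?_)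
    refine (hchord s s' (hmem s hs.1) (hmem s' hs'.1)).trans ?_
    have h1 := norm_sub_le_norm_sub_add_norm_sub (u s) y (u s')
    have h2 : ‖u s - y‖ ≤ r := hs.2
    have h3 : ‖u s' - y‖ ≤ r := hs'.2
    rw [norm_sub_rev y] at h1
    linarith
  rw [← Real.norm_eq_abs, intervalIntegral.norm_integral_eq_norm_integral_uIoc,
    setIntegral_eq_of_subset_of_forall_sdiff_eq_zero (s := S) measurableSet_uIoc
      (by rw [hS]; exact Set.inter_subset_left) (fun s hs => ?_)]
  · refine (norm_setIntegral_le_of_norm_le_const (C := b)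
      (hvol.trans_lt ENNReal.ofReal_lt_top) fun s hs => ?_).trans ?_
    · rw [hS] at hs
      exact hψb s (hmem s hs.1)
    · gcongr
      exact ENNReal.toReal_le_of_le_ofReal (by positivity) hvol
  · refine hψ0 s (not_le.1 fun h => hs.2 ?_)
    rw [hS]
    exact ⟨hs.1, h⟩

lemma abs_le_of_mem_uIcc {s t u a : ℝ} (hs : |s| ≤ a) (ht : |t| ≤ a) (hu : u ∈ Set.uIcc s t) :
    |u| ≤ a := by
  rw [abs_le] at *
  exact (Set.uIcc_subset_Icc hs ht hu)

section CurveRate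

variable {Ω : Type*} [MeasurableSpace Ω] {P : Measure Ω} [IsProbabilityMeasure P]
  {f K : Plane → ℝ} {B : ℝ} {h : ℕ → ℝ} {ξ : ℕ → Ω → Plane} {H L : Set Plane} {a : ℝ} {C : ℝ≥0}

lemma Model.exists_chord (m : Model f H L a) (hC : SmoothBounds f C) :
    ∃ γ > 0, ∀ z ∈ L, ∀ s t, |s| ≤ a → |t| ≤ a → γ * |s - t| ≤ ‖X f z s - X f z t‖ := by
  obtain ⟨γ, hγ, hch⟩ := m.chord
  refine ⟨γ, hγ, fun z hz => ?_⟩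
  have key : ∀ s t, |s| ≤ a → |t| ≤ a → s < t → γ * |s - t| ≤ ‖X f z s - X f z t‖ := by
    intro s t hs ht hst
    have h1 := hch z hz s t (abs_le.1 hs).1 hst (abs_le.1 ht).2
    have hcurve := hC.isCurve z
    have hcont : Continuous fun l => V f (X f z l) :=
      hC.lipschitz_V.continuous.comp hcurve.continuous
    rw [intervalIntegral.integral_eq_sub_of_hasDerivAt (fun l _ => hcurve.2 l)
      (hcont.intervalIntegrable _ _), norm_smul, Real.norm_of_nonneg
      (by rw [one_div, inv_nonneg]; linarith), one_div, inv_mul_eq_div,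
      le_div_iff₀ (by linarith)] at h1
    rwa [abs_sub_comm, abs_of_pos (by linarith), norm_sub_rev]
  intro s t hs ht
  rcases lt_trichotomy s t with hst | rfl | hst
  · exact key s t hs ht hst
  · simp
  · rw [abs_sub_comm, norm_sub_rev]
    exact key t s ht hs hst

/-- The integral along the curve from `z` up to the time `t` of a multiple of the rescaled kernel
centred at `y`. -/
def curveKernel (f K c : Plane → ℝ) (η : ℝ) (w : List (Fin 2)) (z : Plane) (t : ℝ) (y : Plane) :
    ℝ :=
  ∫ s in (0 : ℝ)..t, c (X f z s) * scaledKernel K η w (X f z s) y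

variable {c : Plane → ℝ} {w : List (Fin 2)}

lemma KernelBounds.continuous_curveIntegrand (hB : KernelBounds K B) (hC : SmoothBounds f C)
    (hc : Continuous c) (hw : w.length ≤ 3) (η : ℝ) (z : Plane) :
    Continuous fun p : ℝ × Plane => c (X f z p.1) * scaledKernel K η w (X f z p.1) p.2 := by
  have h1 : Continuous fun p : ℝ × Plane => X f z p.1 :=
    (hC.isCurve z).continuous.comp continuous_fst
  exact (hc.comp h1).mul ((hB.continuous_scaledKernel hw).comp (h1.prodMk continuous_snd))

lemma KernelBounds.continuous_curveIntegrand_left (hB : KernelBounds K B) (hC : SmoothBounds f C)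
    (hc : Continuous c) (hw : w.length ≤ 3) (η : ℝ) (z y : Plane) :
    Continuous fun s => c (X f z s) * scaledKernel K η w (X f z s) y :=
  (hB.continuous_curveIntegrand hC hc hw η z).comp (Continuous.prodMk_left y)

lemma KernelBounds.measurable_curveKernel (hB : KernelBounds K B) (hC : SmoothBounds f C)
    (hc : Continuous c) (hw : w.length ≤ 3) (η : ℝ) (z : Plane) (t : ℝ) :
    Measurable (curveKernel f K c η w z t) := by
  refine (intervalIntegral.continuous_parametric_intervalIntegral_of_continuous'
    (f := fun y s => c (X f z s) * scaledKernel K η w (X f z s) y) ?_ 0 t).measurable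
  exact (hB.continuous_curveIntegrand hC hc hw η z).comp continuous_swap

/-- The function `c` is bounded by `b` on `S` and globally `b`-Lipschitz. -/
structure Weight (c : Plane → ℝ) (S : Set Plane) (b : ℝ) : Prop where
  one_le : 1 ≤ b
  bound : ∀ x ∈ S, |c x| ≤ b
  lip : ∀ x y, |c x - c y| ≤ b * ‖x - y‖

lemma Weight.continuous {S : Set Plane} {b : ℝ} (hc : Weight c S b) : Continuous c :=
  (LipschitzWith.of_dist_le_mul (K := ⟨b, zero_le_one.trans hc.one_le⟩) fun x y => by
    rw [Real.dist_eq, dist_eq_norm]; exact hc.lip x y).continuous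

variable {b η : ℝ} {z : Plane} {t : ℝ}

lemma KernelBounds.abs_curveIntegrand_le (hB : KernelBounds K B)
    (hc : Weight c (startSet f L a) b) (hw : w.length ≤ 3) (hη : 0 < η) (hz : z ∈ L) (y : Plane)
    {s : ℝ} (hs : |s| ≤ a) : |c (X f z s) * scaledKernel K η w (X f z s) y|
      ≤ b * ((η ^ (2 + w.length))⁻¹ * B) := by
  have := hc.one_le
  rw [abs_mul]
  exact mul_le_mul (hc.bound _ (X_mem_startSet hz hs)) (hB.abs_scaledKernel_le hη hw _ _)
    (abs_nonneg _) (by linarith)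

lemma KernelBounds.abs_curveKernel_le (hB : KernelBounds K B)
    (hc : Weight c (startSet f L a) b) (hw : w.length ≤ 3) (hη : 0 < η) (hz : z ∈ L)
    {γ : ℝ} (hγ : 0 < γ)
    (hchord : ∀ s t, |s| ≤ a → |t| ≤ a → γ * |s - t| ≤ ‖X f z s - X f z t‖)
    (ht : |t| ≤ a) (y : Plane) :
    |curveKernel f K c η w z t y| ≤ (η ^ (1 + w.length))⁻¹ * (b * B * 2 / γ) := by
  have hb := hc.one_le
  have hB1 := hB.one_le
  refine (abs_integral_le_of_chord hγ hchord ht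
    (b := b * ((η ^ (2 + w.length))⁻¹ * B)) (by positivity) hη.le y
    (fun s hs => hB.abs_curveIntegrand_le hc hw hη hz y hs) fun s hs => ?_).trans (le_of_eq ?_)
  · rw [hB.scaledKernel_eq_zero hη hs, mul_zero]
  · rw [show 2 + w.length = (1 + w.length) + 1 by ring, pow_succ, mul_inv]
    field_simp

lemma KernelBounds.integrable_curveIntegrand (hB : KernelBounds K B) (hf : SmoothDensity f)
    (hC : SmoothBounds f C) (hc : Weight c (startSet f L a) b) (hw : w.length ≤ 3) (hη : 0 < η)
    (hz : z ∈ L) {s t : ℝ} (hs : |s| ≤ a) (ht : |t| ≤ a) :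
    Integrable (Function.uncurry fun s y => c (X f z s) * scaledKernel K η w (X f z s) y)
      ((volume.restrict (Set.uIoc s t)).prod (densityMeasure f)) := by
  have := hf.isProbabilityMeasure
  have : IsFiniteMeasure (volume.restrict (Set.uIoc s t)) :=
    ⟨by rw [Measure.restrict_apply_univ, Set.uIoc]; exact measure_Ioc_lt_top⟩
  refine Integrable.of_bound
    (hB.continuous_curveIntegrand hC hc.continuous hw η z).aestronglyMeasurable
    (b * ((η ^ (2 + w.length))⁻¹ * B)) ?_
  rw [Measure.restrict_prod_eq_prod_univ]
  refine ae_restrict_of_forall_mem (measurableSet_uIoc.prod MeasurableSet.univ) fun p hp => ?_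
  refine hB.abs_curveIntegrand_le hc hw hη hz p.2 (s := p.1) ?_
  exact abs_le_of_mem_uIcc hs ht (Set.uIoc_subset_uIcc hp.1)

/-- The mean of the average along the curve is the average of the means. -/
lemma KernelBounds.integral_curveKernel (hB : KernelBounds K B) (hf : SmoothDensity f)
    (hC : SmoothBounds f C) (hc : Weight c (startSet f L a) b) (hw : w.length ≤ 3) (hη : 0 < η)
    (hz : z ∈ L) (ht : |t| ≤ a) :
    ∫ y, curveKernel f K c η w z t y ∂densityMeasure f
      = ∫ s in (0 : ℝ)..t, c (X f z s)
          * ∫ y, scaledKernel K η w (X f z s) y ∂densityMeasure f := by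
  have := hf.isProbabilityMeasure
  have h0 : |(0 : ℝ)| ≤ a := by rw [abs_zero]; exact (abs_nonneg t).trans ht
  simp only [curveKernel]
  rw [← intervalIntegral_integral_swap (hB.integrable_curveIntegrand hf hC hc hw hη hz h0 ht)]
  simp only [integral_const_mul]

lemma KernelBounds.integral_abs_curveKernel_le (hB : KernelBounds K B) (hf : SmoothDensity f)
    (hC : SmoothBounds f C) (hc : Weight c (startSet f L a) b) (hw : w.length ≤ 3) (hη : 0 < η)
    (hz : z ∈ L) (ht : |t| ≤ a) {D : ℝ}
    (hD : ∀ x ∈ startSet f L a, ∫ y, |scaledKernel K η w x y| ∂densityMeasure f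
      ≤ (η ^ w.length)⁻¹ * D) :
    ∫ y, |curveKernel f K c η w z t y| ∂densityMeasure f
      ≤ (η ^ w.length)⁻¹ * (b * D * (2 * a)) := by
  have := hf.isProbabilityMeasure
  have ha0 : 0 ≤ a := (abs_nonneg t).trans ht
  have hb := hc.one_le
  have hint := hB.integrable_curveIntegrand hf hC hc hw hη hz
    (s := -a) (t := a) (by rw [abs_neg, abs_of_nonneg ha0]) (by rw [abs_of_nonneg ha0])
  have hpt : ∀ y, |curveKernel f K c η w z t y|
      ≤ ∫ s in (-a)..a, |c (X f z s) * scaledKernel K η w (X f z s) y| := fun y => by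
    have hcont := hB.continuous_curveIntegrand_left hC hc.continuous hw η z y
    have h1 := intervalIntegral.norm_integral_le_abs_integral_norm (a := 0) (b := t) (μ := volume)
      (f := fun s => c (X f z s) * scaledKernel K η w (X f z s) y)
    have h2 := intervalIntegral.abs_integral_mono_interval (a := 0) (b := t) (c := -a) (d := a)
      (μ := volume) (f := fun s => |c (X f z s) * scaledKernel K η w (X f z s) y|)
      (Set.uIoc_subset_uIoc_of_uIcc_subset_uIcc (Set.uIcc_subset_uIcc
        (Set.mem_uIcc.2 (Or.inl ⟨by linarith, ha0⟩)) (Set.mem_uIcc.2 (Or.inl (abs_le.1 ht)))))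
      (Eventually.of_forall fun s => abs_nonneg _) (hcont.abs.intervalIntegrable _ _)
    exact h1.trans (h2.trans_eq (abs_of_nonneg
      (intervalIntegral.integral_nonneg (by linarith) fun _ _ => abs_nonneg _)))
  have hint' : Integrable (Function.uncurry fun s y =>
      |c (X f z s) * scaledKernel K η w (X f z s) y|)
      ((volume.restrict (Set.uIoc (-a) a)).prod (densityMeasure f)) := hint.abs
  have hswap := intervalIntegral_integral_swap hint'
  have hi2 : Integrable (fun y => ∫ s in (-a)..a, |c (X f z s) * scaledKernel K η w (X f z s) y|)
      (densityMeasure f) := by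
    have := hint'.integral_prod_right
    rw [Set.uIoc_of_le (by linarith)] at this
    simpa only [intervalIntegral.integral_of_le (by linarith : -a ≤ a), Function.uncurry] using this
  have hi1 : Integrable (fun y => |curveKernel f K c η w z t y|) (densityMeasure f) :=
    hi2.mono' (hB.measurable_curveKernel hC hc.continuous hw η z t).abs.aestronglyMeasurable
      (Eventually.of_forall fun y => by rw [Real.norm_eq_abs, abs_abs]; exact hpt y)
  refine (integral_mono hi1 hi2 hpt).trans ?_
  rw [← hswap]
  have h3 := intervalIntegral.norm_integral_le_of_norm_le_const (a := -a) (b := a)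
    (C := (η ^ w.length)⁻¹ * (b * D))
    (f := fun s => ∫ y, |c (X f z s) * scaledKernel K η w (X f z s) y| ∂densityMeasure f)
    fun s hs => by
      have hs' : |s| ≤ a := abs_le_of_mem_uIcc (by rw [abs_neg, abs_of_nonneg ha0])
        (by rw [abs_of_nonneg ha0]) (Set.uIoc_subset_uIcc hs)
      have hx := X_mem_startSet (f := f) hz hs'
      rw [Real.norm_of_nonneg (integral_nonneg fun _ => abs_nonneg _)]
      simp only [abs_mul, integral_const_mul]
      calc _ ≤ b * ((η ^ w.length)⁻¹ * D) :=
            mul_le_mul (hc.bound _ hx) (hD _ hx) (integral_nonneg fun _ => abs_nonneg _)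
              (by linarith)
        _ = _ := by ring
  refine (le_abs_self _).trans (h3.trans (le_of_eq ?_))
  rw [abs_of_nonneg (by linarith)]
  ring

lemma KernelBounds.abs_curveKernel_sub_le (hB : KernelBounds K B)
    (hC : SmoothBounds f C) (hc : Weight c (startSet f L a) b) (hw : w.length ≤ 3) (hη : 0 < η)
    (hη1 : η ≤ 1) {z z' : Plane} (hz : z ∈ L) (hz' : z' ∈ L) {t t' : ℝ} (ht : |t| ≤ a)
    (ht' : |t'| ≤ a) (y : Plane) :
    |curveKernel f K c η w z t y - curveKernel f K c η w z' t' y|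
      ≤ (η ^ (3 + w.length))⁻¹ * (2 * b * B * Real.exp (C * a) * a * ‖z - z'‖
        + b * B * |t - t'|) := by
  have hb := hc.one_le
  have hB1 := hB.one_le
  have ha0 : 0 ≤ a := (abs_nonneg t).trans ht
  have hcont := fun z => hB.continuous_curveIntegrand_left hC hc.continuous hw η z y
  have hpow : (η ^ (2 + w.length))⁻¹ ≤ (η ^ (3 + w.length))⁻¹ := by
    gcongr ?_⁻¹
    exact pow_le_pow_of_le_one hη.le hη1 (by lia)
  have hspace : ∀ s, |s| ≤ a → |c (X f z s) * scaledKernel K η w (X f z s) y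
      - c (X f z' s) * scaledKernel K η w (X f z' s) y|
      ≤ (η ^ (3 + w.length))⁻¹ * (2 * b * B * Real.exp (C * a)) * ‖z - z'‖ := by
    intro s hs
    have h1 := hc.bound _ (X_mem_startSet (f := f) hz hs)
    have h2 := hc.lip (X f z s) (X f z' s)
    have h3 := hB.abs_scaledKernel_sub_le hη hw (X f z s) (X f z' s) y
    have h4 := hB.abs_scaledKernel_le hη hw (X f z' s) y
    have h5 : ‖X f z s - X f z' s‖ ≤ ‖z - z'‖ * Real.exp (C * a) :=
      (hC.norm_X_sub_X z z' s).trans (by gcongr)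
    obtain ⟨D, hD⟩ : ∃ D, D = ‖X f z s - X f z' s‖ := ⟨_, rfl⟩
    rw [← hD] at h2 h3 h5
    have hD0 : 0 ≤ D := hD ▸ norm_nonneg _
    calc _ = |c (X f z s) * (scaledKernel K η w (X f z s) y - scaledKernel K η w (X f z' s) y)
            + (c (X f z s) - c (X f z' s)) * scaledKernel K η w (X f z' s) y| := by
          congr 1; ring
      _ ≤ b * ((η ^ (3 + w.length))⁻¹ * B * D) + (b * D) * ((η ^ (3 + w.length))⁻¹ * B) := by
          refine (abs_add_le _ _).trans ?_
          rw [abs_mul, abs_mul]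
          gcongr
          exact h4.trans (by gcongr)
      _ = (η ^ (3 + w.length))⁻¹ * (2 * b * B) * D := by ring
      _ ≤ (η ^ (3 + w.length))⁻¹ * (2 * b * B) * (‖z - z'‖ * Real.exp (C * a)) := by gcongr
      _ = _ := by ring
  have hsplit : curveKernel f K c η w z t y - curveKernel f K c η w z' t' y
      = (∫ s in (0 : ℝ)..t, (c (X f z s) * scaledKernel K η w (X f z s) y
          - c (X f z' s) * scaledKernel K η w (X f z' s) y))
        + ∫ s in t'..t, c (X f z' s) * scaledKernel K η w (X f z' s) y := by
    rw [intervalIntegral.integral_sub ((hcont z).intervalIntegrable _ _)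
      ((hcont z').intervalIntegrable _ _),
      ← intervalIntegral.integral_interval_sub_left ((hcont z').intervalIntegrable 0 t)
      ((hcont z').intervalIntegrable 0 t'), curveKernel, curveKernel]
    ring
  have hi1 := intervalIntegral.norm_integral_le_of_norm_le_const (a := 0) (b := t)
    (f := fun s => c (X f z s) * scaledKernel K η w (X f z s) y
      - c (X f z' s) * scaledKernel K η w (X f z' s) y) fun s hs =>
    hspace s (abs_le_of_mem_uIcc (by simpa using ha0) ht (Set.uIoc_subset_uIcc hs))
  have hi2 := intervalIntegral.norm_integral_le_of_norm_le_const (a := t') (b := t)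
    (f := fun s => c (X f z' s) * scaledKernel K η w (X f z' s) y) fun s hs =>
    hB.abs_curveIntegrand_le hc hw hη hz' y
      (abs_le_of_mem_uIcc ht' ht (Set.uIoc_subset_uIcc hs))
  rw [sub_zero] at hi1
  rw [hsplit]
  refine (abs_add_le _ _).trans ((add_le_add hi1 hi2).trans ?_)
  calc _ ≤ (η ^ (3 + w.length))⁻¹ * (2 * b * B * Real.exp (C * a)) * ‖z - z'‖ * a
        + b * ((η ^ (3 + w.length))⁻¹ * B) * |t - t'| := by gcongr
    _ = _ := by ring

/-- Averages of second derivatives of the estimator along the integral curves concentrate around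
their means at the rate `√(log n / (n h⁵))`. Averaging along a curve gains the factor `√h` over
the pointwise rate. -/
lemma KernelBounds.exists_curve_rate (hB : KernelBounds K B) (m : Model f H L a)
    (hC : SmoothBounds f C) (hc : Weight c (startSet f L a) b)
    (hh : Bandwidth h) (hξ : IsSample P f ξ) (w : List (Fin 2)) (hw : w.length = 2) :
    ∃ M : ℝ, 0 ≤ M ∧ Tendsto (fun n : ℕ => P {ω | ∃ z ∈ L, ∃ t : ℝ, |t| ≤ a ∧
      M * √(Real.log n / (n * h n ^ 5))
        < |(∫ s in (0 : ℝ)..t, c (X f z s) * wordD w (fHat K h ξ n ω) (X f z s))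
          - ∫ s in (0 : ℝ)..t, c (X f z s)
            * ∫ y, scaledKernel K (h n) w (X f z s) y ∂densityMeasure f|}) atTop (𝓝 0) := by
  have hf := m.smooth
  have := hf.isProbabilityMeasure
  have ha := m.filament.a_pos
  have hw3 : w.length ≤ 3 := by lia
  obtain ⟨γ, hγ, hchord⟩ := m.exists_chord hC
  obtain ⟨R, hR⟩ := (m.isCompact_startSet hC).isBounded.exists_norm_le
  obtain ⟨D₀, hD₀, hD⟩ := hB.exists_integral_abs_le hf R
  have hB1 := hB.one_le
  have hb1 := hc.one_le
  have hR0 : 0 ≤ max R a := le_max_of_le_right ha.le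
  obtain ⟨D, hDB, hDD, hD1⟩ : ∃ D, b * B * 2 / γ ≤ D ∧ b * D₀ * (2 * a) ≤ D ∧ 1 ≤ D := by
    have h1 : 0 ≤ b * B * 2 / γ := by positivity
    have h2 : 0 ≤ b * D₀ * (2 * a) := by positivity
    exact ⟨b * B * 2 / γ + b * D₀ * (2 * a) + 1, by linarith, by linarith, by linarith⟩
  have hD0 : 0 < D := by linarith
  -- `curveKernel` is bounded by `O(h⁻³)` instead of `O(h⁻⁴)`, the bound on the kernel, since the
  -- curve stays in the support of the kernel for a time `O(h)` only
  have hconc := exists_uniform_concentration (P := P) (μ := densityMeasure f)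
    hξ.measurable hξ.indep hξ.law
    (I := {p : Plane × ℝ // p.1 ∈ L ∧ |p.2| ≤ a}) (d := 3) (p := 6)
    (fun i => ![i.1.1 0, i.1.1 1, i.1.2]) (ρ := max R a)
    (fun i k => by
      have h1 : ‖i.1.1‖ ≤ R := hR _ (m.mem_startSet hC i.2.1)
      fin_cases k
      · exact ((abs_apply_le_norm i.1.1 0).trans h1).trans (le_max_left _ _)
      · exact ((abs_apply_le_norm i.1.1 1).trans h1).trans (le_max_left _ _)
      · exact i.2.2.trans (le_max_right _ _))
    (fun n i y => curveKernel f K c (h n) w i.1.1 i.1.2 y) (fun n => (h n ^ 2)⁻¹ * D)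
    (fun n => (h n ^ 3)⁻¹ * D)
    (fun n i => hB.measurable_curveKernel hC hc.continuous hw3 _ _ _)
    (Eventually.of_forall fun n => by have := hh.pos n; positivity)
    (Eventually.of_forall fun n => by have := hh.pos n; positivity) ?_ ?_ ?_ ?_ ?_
  · obtain ⟨M, hM, hlim⟩ := hconc
    refine ⟨M * D, by positivity, hlim.congr fun n => ?_⟩
    have hsum : ∀ ω z t, 1 / (n : ℝ) * ∑ j ∈ Finset.range n, curveKernel f K c (h n) w z t (ξ j ω)
        = ∫ s in (0 : ℝ)..t, c (X f z s) * wordD w (fHat K h ξ n ω) (X f z s) := by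
      intro ω z t
      rw [hB.wordD_fHat n ω (by lia)]
      simp only [curveKernel]
      rw [← intervalIntegral.integral_finsetSum fun j _ =>
        (hB.continuous_curveIntegrand_left hC hc.continuous hw3 _ z _).intervalIntegrable _ _,
        ← intervalIntegral.integral_const_mul]
      congr 1
      funext s
      rw [← Finset.mul_sum]
      ring
    congr 1
    ext ω
    simp only [Set.mem_ofPred_eq, sqrt_inv_pow_mul_inv_pow hD0.le, Subtype.exists, Prod.exists,
      hsum, exists_prop]
    simp only [mul_assoc]
    constructor
    · rintro ⟨z, t, ⟨hz, ht⟩, hlt⟩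
      rw [hB.integral_curveKernel hf hC hc hw3 (hh.pos n) hz ht] at hlt
      exact ⟨z, hz, t, ht, hlt⟩
    · rintro ⟨z, hz, t, ht, hlt⟩
      rw [← hB.integral_curveKernel hf hC hc hw3 (hh.pos n) hz ht] at hlt
      exact ⟨z, t, ⟨hz, ht⟩, hlt⟩
  · refine Eventually.of_forall fun n i y => (hB.abs_curveKernel_le hc hw3 (hh.pos n) i.2.1 hγ
      (hchord _ i.2.1) i.2.2 y).trans ?_
    have := hh.pos n
    rw [hw]
    gcongr
  · filter_upwards [hh.eventually_regime] with n r i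
    have := r.pos
    refine (hB.integral_abs_curveKernel_le hf hC hc hw3 r.pos i.2.1 i.2.2 (D := D₀)
      fun x hx => hD _ r.pos r.le_one x (hR x hx) w hw3).trans ?_
    rw [hw]
    gcongr
  · filter_upwards [hh.eventually_regime] with n r
    have h1 := r.pos
    have h2 := r.log_le_mul_pow (k := 1) (by norm_num)
    calc _ = (h n ^ 3)⁻¹ * D * Real.log n := rfl
      _ ≤ (h n ^ 3)⁻¹ * D * (n * h n ^ 1) := by gcongr
      _ = _ := by field_simp
  · filter_upwards [hh.eventually_regime] with n r
    have h1 := r.one_le_inv_pow 2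
    have h2 := r.one_le_inv_pow 3
    exact one_le_mul_of_one_le_of_one_le (one_le_mul_of_one_le_of_one_le h1 hD1)
      (one_le_mul_of_one_le_of_one_le h2 hD1)
  · obtain ⟨E, hE⟩ : ∃ E, E = 2 * b * B * Real.exp (C * a) * a * 2 + b * B := ⟨_, rfl⟩
    filter_upwards [hh.eventually_regime, tendsto_natCast_atTop_atTop.eventually_ge_atTop E]
      with n r hn i i' y δ hδ
    have hδ0 : 0 ≤ δ := (abs_nonneg _).trans (hδ 0)
    have hE0 : 0 ≤ E := by rw [hE]; positivity
    have hdist : ‖i.1.1 - i'.1.1‖ ≤ 2 * δ := by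
      refine (norm_plane_le _).trans ?_
      have h0 : |i.1.1 0 - i'.1.1 0| ≤ δ := hδ 0
      have h1 : |i.1.1 1 - i'.1.1 1| ≤ δ := hδ 1
      simp only [PiLp.sub_apply]
      linarith
    have hdist2 : |i.1.2 - i'.1.2| ≤ δ := hδ 2
    have hpow := r.inv_pow_le 5
    have hη := r.pos
    calc _ ≤ (h n ^ (3 + w.length))⁻¹ * (2 * b * B * Real.exp (C * a) * a * ‖i.1.1 - i'.1.1‖
          + b * B * |i.1.2 - i'.1.2|) :=
          hB.abs_curveKernel_sub_le hC hc hw3 r.pos r.le_one i.2.1 i'.2.1 i.2.2 i'.2.2 y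
      _ ≤ (n : ℝ) ^ 5 * (2 * b * B * Real.exp (C * a) * a * (2 * δ) + b * B * δ) := by
          rw [hw]
          gcongr
      _ = (n : ℝ) ^ 5 * E * δ := by rw [hE]; ring
      _ ≤ (n : ℝ) ^ 5 * n * δ := by gcongr
      _ = _ := by ring

end CurveRate

/-! ### Means of the estimators -/

section Means

variable {Ω : Type*} [MeasurableSpace Ω] {P : Measure Ω} [IsProbabilityMeasure P]
  {f K : Plane → ℝ} {B : ℝ} {h : ℕ → ℝ} {ξ : ℕ → Ω → Plane} {n : ℕ}

/-- The mean of the partial derivative along `w` of the kernel estimator with bandwidth `η`. -/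
def meanD (f K : Plane → ℝ) (η : ℝ) (w : List (Fin 2)) (x : Plane) : ℝ :=
  ∫ y, scaledKernel K η w x y ∂densityMeasure f

lemma KernelBounds.integrable_wordD_fHat (hB : KernelBounds K B) (hξ : IsSample P f ξ)
    (hh : 0 < h n) {w : List (Fin 2)} (hw : w.length ≤ 3) (x : Plane) :
    Integrable (fun ω => wordD w (fHat K h ξ n ω) x) P := by
  simp only [hB.wordD_fHat n _ (w := w) (by lia)]
  refine (integrable_finsetSum _ fun j _ => ?_).const_mul _
  exact integrable_of_abs_le ((hB.measurable_scaledKernel _ hw x).comp (hξ.measurable j))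
    fun ω => hB.abs_scaledKernel_le hh hw x _

lemma KernelBounds.integral_wordD_fHat (hB : KernelBounds K B) (hξ : IsSample P f ξ)
    (hh : 0 < h n) (hn : (0 : ℝ) < n) {w : List (Fin 2)} (hw : w.length ≤ 3) (x : Plane) :
    ∫ ω, wordD w (fHat K h ξ n ω) x ∂P = meanD f K (h n) w x := by
  simp only [hB.wordD_fHat n _ (w := w) (by lia)]
  rw [integral_const_mul, integral_finsetSum _ fun j _ => ?_]
  · have : ∀ j, ∫ ω, scaledKernel K (h n) w x (ξ j ω) ∂P = meanD f K (h n) w x := fun j => by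
      rw [meanD, densityMeasure, ← hξ.law j, integral_map (hξ.measurable j).aemeasurable]
      exact (hB.measurable_scaledKernel _ hw x).aestronglyMeasurable
    simp only [this, Finset.sum_const, Finset.card_range, nsmul_eq_mul]
    field_simp
  · exact integrable_of_abs_le ((hB.measurable_scaledKernel _ hw x).comp (hξ.measurable j))
      fun ω => hB.abs_scaledKernel_le hh hw x _

lemma gradient_eq (g : Plane → ℝ) (x : Plane) :
    gradient g x = !₂[wordD [0] g x, wordD [1] g x] := by
  refine ext_inner_right ℝ fun v => ?_
  rw [inner_gradient, fderiv_apply_eq, inner_plane]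
  simp [wordD_cons]
  ring

/-- The vector `𝔼 d² f̂`. -/
def meanD2 (f K : Plane → ℝ) (η : ℝ) (x : Plane) : Space3 :=
  !₂[meanD f K η [0, 0] x, meanD f K η [0, 1] x, meanD f K η [1, 1] x]

lemma KernelBounds.integral_d2_fHat (hB : KernelBounds K B) (hξ : IsSample P f ξ)
    (hh : 0 < h n) (hn : (0 : ℝ) < n) (x : Plane) :
    ∫ ω, d2 (fHat K h ξ n ω) x ∂P = meanD2 f K (h n) x := by
  have h3 : ∀ i : Fin 3, Integrable (fun ω => d2 (fHat K h ξ n ω) x i) P := by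
    intro i
    fin_cases i
    · exact hB.integrable_wordD_fHat hξ hh (w := [0, 0]) (by simp) x
    · exact hB.integrable_wordD_fHat hξ hh (w := [0, 1]) (by simp) x
    · exact hB.integrable_wordD_fHat hξ hh (w := [1, 1]) (by simp) x
  ext i
  rw [eval_integral_piLp h3]
  fin_cases i
  · exact hB.integral_wordD_fHat hξ hh hn (w := [0, 0]) (by simp) x
  · exact hB.integral_wordD_fHat hξ hh hn (w := [0, 1]) (by simp) x
  · exact hB.integral_wordD_fHat hξ hh hn (w := [1, 1]) (by simp) x

lemma KernelBounds.gradBias_eq (hB : KernelBounds K B) (hξ : IsSample P f ξ)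
    (hh : 0 < h n) (hn : (0 : ℝ) < n) (x : Plane) :
    gradBias P f K h ξ n x
      = !₂[meanD f K (h n) [0] x - wordD [0] f x, meanD f K (h n) [1] x - wordD [1] f x] := by
  have h2 : ∀ i : Fin 2, Integrable (fun ω => gradient (fHat K h ξ n ω) x i) P := by
    intro i
    simp only [gradient_eq]
    fin_cases i
    · exact hB.integrable_wordD_fHat hξ hh (w := [0]) (by simp) x
    · exact hB.integrable_wordD_fHat hξ hh (w := [1]) (by simp) x
  ext i
  rw [gradBias, PiLp.sub_apply, eval_integral_piLp h2]
  simp only [gradient_eq]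
  fin_cases i
  · exact congrArg (· - _) (hB.integral_wordD_fHat hξ hh hn (w := [0]) (by simp) x)
  · exact congrArg (· - _) (hB.integral_wordD_fHat hξ hh hn (w := [1]) (by simp) x)

end Means

/-! ### Matrix notation -/

lemma toEuclideanLin_PV (f : Plane → ℝ) (x v : Plane) :
    Matrix.toEuclideanLin (PV f x) v = inner ℝ v (V f x) • V f x := by
  rw [inner_plane]
  ext i
  fin_cases i <;>
  · simp [PV, Matrix.toEuclideanLin, Matrix.mulVec, dotProduct, Matrix.vecMulVec_apply,
      Fin.sum_univ_two]
    ring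

lemma inner_hess {f : Plane → ℝ} (hf : ContDiff ℝ 2 f) (x v w : Plane) :
    inner ℝ (Matrix.toEuclideanLin (hess f x) v) w = fderiv ℝ (fderiv ℝ f) x v w := by
  rw [fderiv_fderiv_apply hf, inner_plane]
  simp [hess, d2, Matrix.toEuclideanLin, Matrix.mulVec, dotProduct, Fin.sum_univ_two]
  ring

lemma toEuclideanLin_Gam {f : Plane → ℝ} (hf : ContDiff ℝ 2 f) (x v : Plane) :
    Matrix.toEuclideanLin (Gam f x) v
      = ((aTilde' f x)⁻¹ * fderiv ℝ (fderiv ℝ f) x v (V f x)) • V f x - v := by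
  have h1 : Matrix.toEuclideanLin (PV f x * hess f x) v
      = Matrix.toEuclideanLin (PV f x) (Matrix.toEuclideanLin (hess f x) v) := by
    simp [Matrix.toEuclideanLin]
  have h2 : Matrix.toEuclideanLin (1 : Matrix (Fin 2) (Fin 2) ℝ) v = v := by
    simp [Matrix.toEuclideanLin]
  rw [Gam, map_sub, map_smul, LinearMap.sub_apply, LinearMap.smul_apply, h1, h2, toEuclideanLin_PV,
    inner_hess hf, smul_smul]

/-! ### Weights along the curves -/

/-- The words of the second derivatives that enter `d²`. -/
def secondWord : Fin 3 → List (Fin 2) := ![[0, 0], [0, 1], [1, 1]]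

lemma length_secondWord (l : Fin 3) : (secondWord l).length = 2 := by
  fin_cases l <;> rfl

lemma d2_apply (g : Plane → ℝ) (x : Plane) (l : Fin 3) : d2 g x l = wordD (secondWord l) g x := by
  fin_cases l <;> rfl

/-- The entries of `∇G (d² f)` agree on the curves with bounded Lipschitz functions. -/
lemma Model.exists_weight {f : Plane → ℝ} {H L : Set Plane} {a : ℝ} {C : ℝ≥0} (m : Model f H L a)
    (hC : SmoothBounds f C) (j : Fin 2) (l : Fin 3) : ∃ (c : Plane → ℝ) (b : ℝ),
      Weight c (startSet f L a) b ∧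
      ∀ x ∈ startSet f L a, c x = fderiv ℝ G (d2 f x) (EuclideanSpace.single l 1) j := by
  have hS := m.isCompact_startSet hC
  have hq : ∀ x ∈ startSet f L a, ContDiffAt ℝ 1
      (fun x => fderiv ℝ G (d2 f x) (EuclideanSpace.single l 1) j) x := fun x hx => by
    have h1 : ContDiffAt ℝ 1 (fderiv ℝ G) (d2 f x) :=
      (contDiffAt_G (m.gap hx) 2).fderiv_right (by norm_num)
    have h2 : ContDiffAt ℝ 1 (d2 f) x :=
      ((contDiff_d2 (m := 1) (by exact_mod_cast hC.contDiff)).contDiffAt)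
    have h3 : ContDiffAt ℝ 1 (fun x => fderiv ℝ G (d2 f x) (EuclideanSpace.single l 1)) x :=
      (h1.comp x h2).clm_apply contDiffAt_const
    exact (EuclideanSpace.proj j : Plane →L[ℝ] ℝ).contDiff.contDiffAt.comp x h3
  obtain ⟨k, hk⟩ := LocallyLipschitzOn.exists_lipschitzOnWith_of_compact hS
    (f := fun x => fderiv ℝ G (d2 f x) (EuclideanSpace.single l 1) j) fun x hx => by
      obtain ⟨k, t, ht, hk⟩ := (hq x hx).exists_lipschitzOnWith
      exact ⟨k, t, mem_nhdsWithin_of_mem_nhds ht, hk⟩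
  obtain ⟨b, hb⟩ := hS.exists_bound_of_continuousOn hk.continuousOn
  obtain ⟨c, hc, heq⟩ := hk.extend_real
  refine ⟨c, 1 + |b| + k, ⟨?_, fun x hx => ?_, fun x y => ?_⟩, fun x hx => (heq hx).symm⟩
  · have := k.2
    have := abs_nonneg b
    linarith [k.2]
  · rw [← heq hx]
    have := hb x hx
    rw [Real.norm_eq_abs] at this
    linarith [le_abs_self b, k.2]
  · have := hc.dist_le_mul x y
    rw [Real.dist_eq, dist_eq_norm] at this
    refine this.trans ?_
    gcongr
    linarith [abs_nonneg b]

/-! ### The comparison of the rates -/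

/-- The rate `√(log n / (n ηᵏ))`. -/
def rate (n : ℕ) (η : ℝ) (k : ℕ) : ℝ := √(Real.log n / (n * η ^ k))

section Rate

variable {n : ℕ} {η : ℝ}

lemma rate_nonneg (k : ℕ) : 0 ≤ rate n η k := Real.sqrt_nonneg _

lemma Regime.rate_mono (r : Regime n η) {k l : ℕ} (hkl : k ≤ l) : rate n η k ≤ rate n η l := by
  have h1 := r.pos
  have h2 := r.n_pos
  have h3 := r.one_le_log
  refine Real.sqrt_le_sqrt ?_
  have := pow_le_pow_of_le_one r.pos.le r.le_one hkl
  gcongr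

lemma Regime.rate_mul (r : Regime n η) (k l : ℕ) :
    rate n η k * rate n η l = Real.log n / (n * √(η ^ (k + l))) := by
  have h1 := r.pos
  have h2 := r.n_pos
  have h3 := r.one_le_log
  rw [rate, rate, ← Real.sqrt_mul (by positivity), Real.sqrt_eq_iff_mul_self_eq (by positivity)
    (by positivity), div_mul_div_comm, div_mul_div_comm]
  congr 1
  have hs := Real.mul_self_sqrt (pow_nonneg h1.le (k + l))
  rw [mul_mul_mul_comm _ √_, hs, pow_add]
  ring

/-- The upper bound on the bandwidth, `n h⁹ = O(1)`, compares a single rate to a product. -/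
lemma Regime.rate_le (r : Regime n η) {β : ℝ} (hβ : n * η ^ 9 ≤ β) {k i j : ℕ}
    (hk : i + j = k + 9) : rate n η k ≤ √β * (rate n η i * rate n η j) := by
  have h1 := r.pos
  have h2 := r.n_pos
  have h3 := r.one_le_log
  have hβ0 : 0 ≤ β := le_trans (by positivity) hβ
  rw [rate, rate, rate, ← Real.sqrt_mul (by positivity), ← Real.sqrt_mul hβ0]
  refine Real.sqrt_le_sqrt ?_
  rw [div_mul_div_comm, mul_div_assoc', div_le_div_iff₀ (by positivity) (by positivity)]
  calc Real.log n * (n * η ^ i * (n * η ^ j))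
      = (n * η ^ 9) * (Real.log n * 1) * (n * η ^ k) := by
        rw [show n * η ^ i * (n * η ^ j) = n * n * η ^ (i + j) by rw [pow_add]; ring, hk, pow_add]
        ring
    _ ≤ β * (Real.log n * Real.log n) * (n * η ^ k) := by gcongr

lemma Regime.pow_le_rate (r : Regime n η) {β : ℝ} (hβ : n * η ^ 9 ≤ β) {i k : ℕ}
    (hik : 9 ≤ 2 * i + k) : η ^ i ≤ √β * rate n η k := by
  have h1 := r.pos
  have h2 := r.n_pos
  have h3 := r.one_le_log
  have hβ0 : 0 ≤ β := le_trans (by positivity) hβ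
  rw [rate, ← Real.sqrt_mul hβ0]
  refine Real.le_sqrt_of_sq_le ?_
  rw [mul_div_assoc', le_div_iff₀ (by positivity)]
  calc (η ^ i) ^ 2 * (n * η ^ k) = n * η ^ (2 * i + k) := by rw [← pow_mul, pow_add]; ring
    _ ≤ n * η ^ 9 := by
      gcongr n * ?_
      exact pow_le_pow_of_le_one r.pos.le r.le_one hik
    _ ≤ β * 1 := by rw [mul_one]; exact hβ
    _ ≤ β * Real.log n := by gcongr

lemma Bandwidth.eventually_rate_le {h : ℕ → ℝ} (hh : Bandwidth h) {k : ℕ} (hk : k ≤ 8) {ε : ℝ}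
    (hε : 0 < ε) : ∀ᶠ n : ℕ in atTop, rate n (h n) k ≤ ε := by
  filter_upwards [hh.eventually_regime, hh.eventually_mul_log_le (ε⁻¹ ^ 2)] with n r h1
  refine (r.rate_mono hk).trans ?_
  have h2 := r.pos
  have h3 := r.n_pos
  refine Real.sqrt_le_iff.2 ⟨hε.le, ?_⟩
  rw [div_le_iff₀ (by positivity)]
  calc Real.log n ≤ Real.log n ^ 3 := le_self_pow₀ r.one_le_log (by norm_num)
    _ = ε ^ 2 * (ε⁻¹ ^ 2 * Real.log n ^ 3) := by field_simp
    _ ≤ _ := by gcongr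

lemma Bandwidth.exists_eventually_mul_pow_le {h : ℕ → ℝ} (hh : Bandwidth h) :
    ∃ β : ℝ, ∀ᶠ n : ℕ in atTop, n * h n ^ 9 ≤ β := by
  obtain ⟨β, -, hβ⟩ := hh.upper
  exact ⟨β + 1, (hβ.eventually (ge_mem_nhds (lt_add_one β))).mono fun _ h => h⟩

end Rate

/-! ### The event of uniform closeness -/

/-- Finitely many uniform rates hold simultaneously, with a common constant. -/
lemma exists_common_rate {Ω : Type*} [MeasurableSpace Ω] {P : Measure Ω} {ι : Type*}
    (s : Finset ι) {A : ι → Type*} (S : ∀ i, Set (A i))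
    (Y : ∀ i, ℕ → Ω → A i → ℝ) (r : ι → ℕ → ℝ) (hr : ∀ i n, 0 ≤ r i n)
    (h : ∀ i ∈ s, ∃ M : ℝ, 0 ≤ M ∧
      Tendsto (fun n => P {ω | ∃ x ∈ S i, M * r i n < Y i n ω x}) atTop (𝓝 0)) :
    ∃ M : ℝ, 0 ≤ M ∧ ∃ bad : ℕ → Set Ω, Tendsto (fun n => P (bad n)) atTop (𝓝 0) ∧
      ∀ n, ∀ ω ∉ bad n, ∀ i ∈ s, ∀ x ∈ S i, Y i n ω x ≤ M * r i n := by
  classical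
  choose! M hM0 hM using h
  refine ⟨∑ i ∈ s, M i, Finset.sum_nonneg hM0,
    fun n => ⋃ i ∈ s, {ω | ∃ x ∈ S i, M i * r i n < Y i n ω x}, ?_, ?_⟩
  · have hlim : Tendsto (fun n => ∑ i ∈ s, P {ω | ∃ x ∈ S i, M i * r i n < Y i n ω x}) atTop
        (𝓝 0) := by
      simpa using tendsto_finsetSum s hM
    exact tendsto_of_tendsto_of_tendsto_of_le_of_le tendsto_const_nhds hlim (fun n => zero_le)
      fun n => measure_biUnion_finset_le _ _
  · intro n ω hω i hi x hx
    by_contra hlt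
    rw [not_le] at hlt
    refine hω (Set.mem_biUnion hi ⟨x, hx, lt_of_le_of_lt ?_ hlt⟩)
    exact mul_le_mul_of_nonneg_right (Finset.single_le_sum hM0 hi) (hr i n)

section GoodEvent

variable {Ω : Type*} [MeasurableSpace Ω] {P : Measure Ω} [IsProbabilityMeasure P]
  {f K : Plane → ℝ} {B : ℝ} {h : ℕ → ℝ} {ξ : ℕ → Ω → Plane} {H L : Set Plane} {a : ℝ} {C : ℝ≥0}

/-- The deviations of `g`, a realization of the estimator with the bandwidth `η`, from its mean:
pointwise, and for the averages along the curves with the weights `c`. -/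
structure Deviation (f K g : Plane → ℝ) (c : Fin 2 × Fin 3 → Plane → ℝ) (L : Set Plane)
    (a R M : ℝ) (n : ℕ) (η : ℝ) : Prop where
  pointwise : ∀ w : List (Fin 2), w.length ≤ 3 → ∀ x, ‖x‖ ≤ R →
    |wordD w g x - meanD f K η w x| ≤ M * rate n η (2 + 2 * w.length)
  curve : ∀ k : Fin 2 × Fin 3, ∀ z ∈ L, ∀ t, |t| ≤ a →
    |(∫ s in (0 : ℝ)..t, c k (X f z s) * wordD (secondWord k.2) g (X f z s))
      - ∫ s in (0 : ℝ)..t, c k (X f z s) * meanD f K η (secondWord k.2) (X f z s)|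
      ≤ M * rate n η 5

lemma KernelBounds.exists_deviation (hB : KernelBounds K B) (m : Model f H L a)
    (hC : SmoothBounds f C) (hh : Bandwidth h) (hξ : IsSample P f ξ) (R : ℝ)
    {c : Fin 2 × Fin 3 → Plane → ℝ} {b : Fin 2 × Fin 3 → ℝ}
    (hc : ∀ k, Weight (c k) (startSet f L a) (b k)) :
    ∃ M : ℝ, 0 ≤ M ∧ ∃ bad : ℕ → Set Ω, Tendsto (fun n => P (bad n)) atTop (𝓝 0) ∧
      ∀ n, ∀ ω ∉ bad n, Deviation f K (fHat K h ξ n ω) c L a R M n (h n) := by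
  obtain ⟨M₁, hM₁, bad₁, hlim₁, h₁⟩ := exists_common_rate (P := P)
    (shortWords.filter fun w => w.length ≤ 3) (A := fun _ => Plane) (fun _ => {x | ‖x‖ ≤ R})
    (fun w n ω x => |wordD w (fHat K h ξ n ω) x - meanD f K (h n) w x|)
    (fun w n => rate n (h n) (2 + 2 * w.length)) (fun _ _ => rate_nonneg _) fun w hw =>
      hB.exists_pointwise_rate m.smooth hh hξ R w (Finset.mem_filter.1 hw).2
  obtain ⟨M₂, hM₂, bad₂, hlim₂, h₂⟩ := exists_common_rate (P := P)
    (Finset.univ : Finset (Fin 2 × Fin 3)) (A := fun _ => Plane × ℝ)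
    (fun _ => {p | p.1 ∈ L ∧ |p.2| ≤ a})
    (fun k n ω p =>
      |(∫ s in (0 : ℝ)..p.2, c k (X f p.1 s) * wordD (secondWord k.2) (fHat K h ξ n ω) (X f p.1 s))
      - ∫ s in (0 : ℝ)..p.2, c k (X f p.1 s) * meanD f K (h n) (secondWord k.2) (X f p.1 s)|)
    (fun _ n => rate n (h n) 5) (fun _ _ => rate_nonneg _) fun k _ => by
      obtain ⟨M, hM, hlim⟩ := hB.exists_curve_rate m hC (hc k) hh hξ (secondWord k.2)
        (length_secondWord _)
      refine ⟨M, hM, hlim.congr fun n => ?_⟩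
      congr 1
      ext ω
      simp only [Set.mem_ofPred_eq, Prod.exists, and_assoc, exists_and_left, rate, meanD]
  refine ⟨M₁ + M₂, by positivity, fun n => bad₁ n ∪ bad₂ n, ?_, fun n ω hω => ⟨?_, ?_⟩⟩
  · have hlim := hlim₁.add hlim₂
    rw [add_zero] at hlim
    exact tendsto_of_tendsto_of_tendsto_of_le_of_le tendsto_const_nhds hlim (fun n => zero_le)
      fun n => measure_union_le _ _
  · intro w hw x hx
    refine (h₁ n ω (fun h => hω (Or.inl h)) w
      (Finset.mem_filter.2 ⟨mem_shortWords.2 (by lia), hw⟩) x hx).trans ?_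
    exact mul_le_mul_of_nonneg_right (by linarith) (rate_nonneg _)
  · intro k z hz t ht
    refine (h₂ n ω (fun h => hω (Or.inr h)) k (Finset.mem_univ _) (z, t) ⟨hz, ht⟩).trans ?_
    exact mul_le_mul_of_nonneg_right (by linarith) (rate_nonneg _)

lemma KernelBounds.continuous_meanD (hB : KernelBounds K B) (hf : SmoothDensity f) {η : ℝ}
    (hη : 0 < η) {w : List (Fin 2)} (hw : w.length ≤ 3) : Continuous (meanD f K η w) := by
  have := hf.isProbabilityMeasure
  have hB0 : 0 ≤ B := zero_le_one.trans hB.one_le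
  refine (LipschitzWith.of_dist_le_mul (K := ⟨(η ^ (3 + w.length))⁻¹ * B, by positivity⟩)
    fun x y => ?_).continuous
  have hi : ∀ x, Integrable (scaledKernel K η w x) (densityMeasure f) := fun x =>
    integrable_of_abs_le (hB.measurable_scaledKernel η hw x) fun y =>
      hB.abs_scaledKernel_le hη hw x y
  rw [Real.dist_eq, dist_eq_norm, meanD, meanD, ← integral_sub (hi x) (hi y)]
  have h := norm_integral_le_of_norm_le_const (μ := densityMeasure f)
    (f := fun u => scaledKernel K η w x u - scaledKernel K η w y u)
    (Eventually.of_forall fun u => hB.abs_scaledKernel_sub_le hη hw x y u)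
  rw [probReal_univ, mul_one] at h
  exact h

/-- The linearized error of the vector field, integrated along a curve, in terms of the weights. -/
lemma SmoothBounds.norm_integral_le (hC : SmoothBounds f C) {g : Plane → ℝ}
    (hg : ContDiff ℝ 3 g) {c : Fin 2 × Fin 3 → Plane → ℝ} {b : Fin 2 × Fin 3 → ℝ}
    (hc : ∀ k, Weight (c k) (startSet f L a) (b k))
    (hcG : ∀ k, ∀ x ∈ startSet f L a,
      c k x = fderiv ℝ G (d2 f x) (EuclideanSpace.single k.2 1) k.1)
    {z : Plane} (hz : z ∈ L) {t : ℝ} (ht : |t| ≤ a) {e : ℝ}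
    (he : ∀ k : Fin 2 × Fin 3, |∫ s in (0 : ℝ)..t, c k (X f z s)
      * (wordD (secondWord k.2) g (X f z s) - wordD (secondWord k.2) f (X f z s))| ≤ e) :
    ‖∫ s in (0 : ℝ)..t, fderiv ℝ G (d2 f (X f z s)) (d2 g (X f z s) - d2 f (X f z s))‖
      ≤ 6 * e := by
  have hXc : Continuous (X f z) := (hC.isCurve z).continuous
  have hw : ∀ {u : Plane → ℝ}, ContDiff ℝ 3 u → ∀ l, Continuous (wordD (secondWord l) u) :=
    fun hu l => (ContDiff.wordD (m := 1) (secondWord l)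
      (by rw [length_secondWord]; exact_mod_cast hu)).continuous
  have hcont : ∀ k : Fin 2 × Fin 3, Continuous fun s => c k (X f z s)
      * (wordD (secondWord k.2) g (X f z s) - wordD (secondWord k.2) f (X f z s)) := fun k =>
    ((hc k).continuous.comp hXc).mul
      (((hw hg k.2).comp hXc).sub ((hw hC.contDiff k.2).comp hXc))
  have heq : ∫ s in (0 : ℝ)..t, fderiv ℝ G (d2 f (X f z s)) (d2 g (X f z s) - d2 f (X f z s))
      = ∫ s in (0 : ℝ)..t, ∑ k : Fin 2 × Fin 3, (c k (X f z s)
        * (wordD (secondWord k.2) g (X f z s) - wordD (secondWord k.2) f (X f z s)))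
        • (EuclideanSpace.single k.1 1 : Plane) := by
    refine intervalIntegral.integral_congr fun s hs => ?_
    have hs' : |s| ≤ a := abs_le_of_mem_uIcc (by rw [abs_zero]; exact (abs_nonneg t).trans ht) ht hs
    have hx := X_mem_startSet (f := f) hz hs'
    obtain ⟨v, hv⟩ : ∃ v, v = d2 g (X f z s) - d2 f (X f z s) := ⟨_, rfl⟩
    have hvl : ∀ l, v l = wordD (secondWord l) g (X f z s) - wordD (secondWord l) f (X f z s) :=
      fun l => by rw [hv, PiLp.sub_apply, d2_apply, d2_apply]
    have hsum : v = ∑ l, v l • (EuclideanSpace.single l 1 : Space3) := by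
      ext i
      fin_cases i <;> simp [Fin.sum_univ_three]
    simp only [← hv, ← hvl]
    rw [Fintype.sum_prod_type]
    simp only [hcG _ _ hx]
    conv_lhs => rw [hsum, map_sum]
    ext j
    simp only [map_smul, PiLp.smul_apply, smul_eq_mul, WithLp.ofLp_sum, Finset.sum_apply,
      ← Finset.sum_smul]
    fin_cases j <;> simp [mul_comm]
  have hint : ∀ k : Fin 2 × Fin 3, IntervalIntegrable (fun s => (c k (X f z s)
      * (wordD (secondWord k.2) g (X f z s) - wordD (secondWord k.2) f (X f z s)))
      • (EuclideanSpace.single k.1 1 : Plane)) volume 0 t := fun k =>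
    ((hcont k).smul continuous_const).intervalIntegrable _ _
  rw [heq, intervalIntegral.integral_finsetSum fun k _ => hint k]
  refine (norm_sum_le _ _).trans ?_
  calc _ ≤ ∑ k : Fin 2 × Fin 3, e := Finset.sum_le_sum fun k _ => by
        rw [intervalIntegral.integral_smul_const, norm_smul]
        simpa using he k
    _ = _ := by simp

end GoodEvent

/-! ### From the uniform deviations to the expansions -/

section Assembly

variable {f K g : Plane → ℝ} {B M R β : ℝ} {H L : Set Plane} {a : ℝ} {C : ℝ≥0}
  {c : Fin 2 × Fin 3 → Plane → ℝ} {b : Fin 2 × Fin 3 → ℝ} {n : ℕ} {η : ℝ}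

/-- Deviation and bias of the derivatives of the order `k ≤ 2`, compared to the rate of the
deviation or a slower one. -/
lemma Deviation.abs_wordD_sub_le (hd : Deviation f K g c L a R M n η) (hB : KernelBounds K B)
    (hK : IsKernel K) (hf : SmoothDensity f) (hC : SmoothBounds f C) (r : Regime n η)
    (hβ : n * η ^ 9 ≤ β) (hM : 0 ≤ M) {w : List (Fin 2)} (h2 : w.length ≤ 2)
    {k : ℕ} (hk5 : 5 ≤ k) (hk : 2 + 2 * w.length ≤ k) {x : Plane} (hx : ‖x‖ ≤ R) :
    |wordD w g x - wordD w f x| ≤ (M + 2 * C * √β) * rate n η k := by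
  have e1 := hd.pointwise w (by lia) x hx
  have e2 : |meanD f K η w x - wordD w f x| ≤ 2 * C * η ^ 2 :=
    hB.abs_bias_le_sq hK hf hC r.pos x w h2
  have e3 := r.pow_le_rate hβ (i := 2) (k := k) (by lia)
  have e4 := r.rate_mono hk
  calc _ ≤ _ := abs_sub_le _ (meanD f K η w x) _
    _ ≤ M * rate n η k + 2 * C * (√β * rate n η k) :=
        add_le_add (e1.trans (by gcongr)) (e2.trans (by gcongr))
    _ = _ := by ring

lemma Deviation.abs_wordD_sub_le_three (hd : Deviation f K g c L a R M n η)
    (hB : KernelBounds K B) (hK : IsKernel K) (hf : SmoothDensity f) (hC : SmoothBounds f C)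
    (r : Regime n η) (hβ : n * η ^ 9 ≤ β) {w : List (Fin 2)} (hw : w.length = 3)
    {x : Plane} (hx : ‖x‖ ≤ R) :
    |wordD w g x - wordD w f x| ≤ (M + 2 * C * √β) * rate n η 8 := by
  have e1 := hd.pointwise w (by lia) x hx
  rw [hw] at e1
  have e2 : |meanD f K η w x - wordD w f x| ≤ C * η :=
    hB.abs_bias_le hK hf hC r.pos x w (by lia) (by lia)
  have e3 := r.pow_le_rate hβ (i := 1) (k := 8) (by lia)
  rw [pow_one] at e3
  have hC0 : (0 : ℝ) ≤ C * (√β * rate n η 8) :=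
    mul_nonneg C.2 (mul_nonneg (Real.sqrt_nonneg _) (rate_nonneg _))
  calc _ ≤ _ := abs_sub_le _ (meanD f K η w x) _
    _ ≤ M * rate n η 8 + C * (√β * rate n η 8) := add_le_add e1 (e2.trans (by gcongr))
    _ ≤ (M + 2 * C * √β) * rate n η 8 := by linarith

lemma Deviation.abs_curve_le (hd : Deviation f K g c L a R M n η) (hg : ContDiff ℝ 3 g)
    (hB : KernelBounds K B) (hK : IsKernel K) (m : Model f H L a) (hC : SmoothBounds f C)
    (hc : ∀ k, Weight (c k) (startSet f L a) (b k)) (r : Regime n η) (hβ : n * η ^ 9 ≤ β)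
    (k : Fin 2 × Fin 3) {z : Plane} (hz : z ∈ L) {t : ℝ} (ht : |t| ≤ a) :
    |∫ s in (0 : ℝ)..t, c k (X f z s)
      * (wordD (secondWord k.2) g (X f z s) - wordD (secondWord k.2) f (X f z s))|
      ≤ (M + b k * (2 * C * √β) * a) * rate n η 5 := by
  have hXc : Continuous (X f z) := (hC.isCurve z).continuous
  have hw : ∀ {u : Plane → ℝ}, ContDiff ℝ 3 u → ∀ l, Continuous (wordD (secondWord l) u) :=
    fun hu l => (ContDiff.wordD (m := 1) (secondWord l)
      (by rw [length_secondWord]; exact_mod_cast hu)).continuous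
  have hl := length_secondWord k.2
  have hcc := (hc k).continuous.comp hXc
  have hi : ∀ {u : Plane → ℝ}, Continuous u →
      IntervalIntegrable (fun s => c k (X f z s) * u (X f z s)) volume 0 t := fun hu =>
    (hcc.mul (hu.comp hXc)).intervalIntegrable _ _
  have hmean := hB.continuous_meanD m.smooth r.pos (w := secondWord k.2) (by lia)
  have hsplit : ∫ s in (0 : ℝ)..t, c k (X f z s)
      * (wordD (secondWord k.2) g (X f z s) - wordD (secondWord k.2) f (X f z s))
      = ((∫ s in (0 : ℝ)..t, c k (X f z s) * wordD (secondWord k.2) g (X f z s))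
        - ∫ s in (0 : ℝ)..t, c k (X f z s) * meanD f K η (secondWord k.2) (X f z s))
        + ∫ s in (0 : ℝ)..t, c k (X f z s)
          * (meanD f K η (secondWord k.2) (X f z s) - wordD (secondWord k.2) f (X f z s)) := by
    simp only [mul_sub]
    rw [intervalIntegral.integral_sub (hi (hw hg _)) (hi (hw hC.contDiff _)),
      intervalIntegral.integral_sub (hi hmean) (hi (hw hC.contDiff _))]
    ring
  have hb1 := (hc k).one_le
  have hC0 := C.2
  have hbias := intervalIntegral.norm_integral_le_of_norm_le_const (a := 0) (b := t)
    (C := b k * (2 * C * η ^ 2)) (f := fun s => c k (X f z s)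
      * (meanD f K η (secondWord k.2) (X f z s) - wordD (secondWord k.2) f (X f z s)))
    fun s hs => by
      have hs' : |s| ≤ a := abs_le_of_mem_uIcc
        (by rw [abs_zero]; exact (abs_nonneg t).trans ht) ht (Set.uIoc_subset_uIcc hs)
      rw [norm_mul]
      exact mul_le_mul ((hc k).bound _ (X_mem_startSet hz hs'))
        (hB.abs_bias_le_sq hK m.smooth hC r.pos _ _ hl.le) (norm_nonneg _) (by linarith)
  rw [sub_zero, Real.norm_eq_abs] at hbias
  have e3 := r.pow_le_rate hβ (i := 2) (k := 5) (by lia)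
  have hb0 : 0 ≤ b k := zero_le_one.trans hb1
  have hp : 0 ≤ b k * (2 * C * (√β * rate n η 5)) :=
    mul_nonneg hb0 (mul_nonneg (by positivity) (mul_nonneg (Real.sqrt_nonneg _) (rate_nonneg _)))
  rw [hsplit]
  calc _ ≤ _ := abs_add_le _ _
    _ ≤ M * rate n η 5 + b k * (2 * C * (√β * rate n η 5)) * a :=
        add_le_add (hd.curve k z hz t ht) (hbias.trans (by gcongr))
    _ = _ := by ring

/-- On the event of small deviations the estimator is close to the density, at the rates
`√(log n / (n h⁶))` and `√(log n / (n h⁸))` for the second and third derivatives. -/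
lemma Deviation.near (hd : Deviation f K g c L a R M n η) (hg : ContDiff ℝ 3 g)
    (hgV : ∃ M K : ℝ≥0, (∀ x, ‖V g x‖ ≤ M) ∧ LipschitzWith K (V g))
    (hB : KernelBounds K B) (hK : IsKernel K) (m : Model f H L a) (hC : SmoothBounds f C)
    (hc : ∀ k, Weight (c k) (startSet f L a) (b k))
    (hcG : ∀ k, ∀ x ∈ startSet f L a,
      c k x = fderiv ℝ G (d2 f x) (EuclideanSpace.single k.2 1) k.1)
    (r : Regime n η) (hβ : n * η ^ 9 ≤ β) (hM : 0 ≤ M) {E : ℝ}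
    (hE : E = 6 * (M + 2 * C * √β + (∑ k, b k) * (2 * C * √β) * a)) (hE7 : E * rate n η 7 ≤ 1) :
    Near f g L a R (E * rate n η 5) (E * rate n η 5) (E * rate n η 6) (E * rate n η 8) := by
  have ha := m.filament.a_pos
  have hC0 := C.2
  have hb0 : ∀ k, 0 ≤ b k := fun k => zero_le_one.trans (hc k).one_le
  have hsum0 : 0 ≤ (∑ k, b k) * (2 * C * √β) * a := by
    have := Finset.sum_nonneg fun k (_ : k ∈ Finset.univ) => hb0 k
    positivity
  have hD0 : 0 ≤ M + 2 * C * √β := by positivity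
  have hE0 : 0 ≤ E := by rw [hE]; linarith
  have hr5 := rate_nonneg (n := n) (η := η) 5
  have hr6 := rate_nonneg (n := n) (η := η) 6
  have hr8 := rate_nonneg (n := n) (η := η) 8
  refine ⟨hg, hgV, fun y hy => ?_, fun y hy => ?_, fun y hy => ?_, fun z hz t ht => ?_,
    mul_nonneg hE0 hr5, le_rfl, ?_, ?_, ?_⟩
  · refine (norm_fderiv_sub_le fun w hw => hd.abs_wordD_sub_le hB hK m.smooth hC r hβ hM
      (by lia) (k := 5) le_rfl (by lia) hy).trans ?_
    rw [← mul_assoc]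
    exact mul_le_mul_of_nonneg_right (by rw [hE]; linarith) hr5
  · refine (norm_d2_sub_le fun w hw => hd.abs_wordD_sub_le hB hK m.smooth hC r hβ hM
      (by lia) (k := 6) (by norm_num) (by lia) hy).trans ?_
    rw [← mul_assoc]
    exact mul_le_mul_of_nonneg_right (by rw [hE]; linarith) hr6
  · refine (norm_fderiv_d2_sub_le hg hC.contDiff fun w hw =>
      hd.abs_wordD_sub_le_three hB hK m.smooth hC r hβ hw hy).trans ?_
    rw [← mul_assoc]
    exact mul_le_mul_of_nonneg_right (by rw [hE]; linarith) hr8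
  · refine (hC.norm_integral_le hg hc hcG hz ht (e := E / 6 * rate n η 5) fun k =>
      (hd.abs_curve_le hg hB hK m hC hc r hβ k hz ht).trans ?_).trans (le_of_eq (by ring))
    refine mul_le_mul_of_nonneg_right ?_ hr5
    have hbk : b k ≤ ∑ k, b k := Finset.single_le_sum (fun k _ => hb0 k) (Finset.mem_univ k)
    have h1 : b k * (2 * C * √β) * a ≤ (∑ k, b k) * (2 * C * √β) * a := by gcongr
    have h2 : (0 : ℝ) ≤ 2 * C * √β := by positivity
    rw [hE]
    linarith
  · exact mul_le_mul_of_nonneg_left (r.rate_mono (by norm_num)) hE0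
  · exact mul_le_mul_of_nonneg_left (r.rate_mono (by norm_num)) hE0
  · have h1 : rate n η 6 * rate n η 6 = rate n η 5 * rate n η 7 := by
      rw [r.rate_mul, r.rate_mul]
    calc (E * rate n η 6) ^ 2 = (E * rate n η 7) * (E * rate n η 5) := by
          rw [mul_pow, pow_two (rate n η 6), h1]; ring
      _ ≤ 1 * (E * rate n η 5) := mul_le_mul_of_nonneg_right hE7 (mul_nonneg hE0 hr5)
      _ = _ := one_mul _

lemma Regime.rate_six_mul_eight (r : Regime n η) :
    rate n η 6 * rate n η 8 = Real.log n / (n * η ^ 7) := by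
  rw [r.rate_mul, show 6 + 8 = 7 * 2 by norm_num, pow_mul, Real.sqrt_sq (pow_nonneg r.pos.le 7)]

lemma Regime.rate_six_mul_seven (r : Regime n η) :
    rate n η 6 * rate n η 7 = Real.log n / (n * η ^ (13 / 2 : ℝ)) := by
  rw [r.rate_mul, Real.sqrt_eq_rpow, ← Real.rpow_natCast, ← Real.rpow_mul r.pos.le]
  norm_num


end Assembly

/-! ### The remainders of the two expansions -/

section Remainders

variable {f K g : Plane → ℝ} {B M R β k₀ E : ℝ} {H L : Set Plane} {a : ℝ} {C : ℝ≥0}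
  {c : Fin 2 × Fin 3 → Plane → ℝ} {n : ℕ} {η : ℝ} {p q T : Plane}

/-- In the first expansion `d² f̂ - d² f` may be replaced by `d² f̂ - 𝔼 d² f̂`: the bias is of the
order of the remainder. -/
lemma norm_expansion_le (hB : KernelBounds K B) (hK : IsKernel K) (hf : SmoothDensity f)
    (hC : SmoothBounds f C) (r : Regime n η) (hβ : n * η ^ 9 ≤ β) (hE : 0 ≤ E) (hk0 : 0 ≤ k₀)
    (hk : |(aTilde' f p)⁻¹| ≤ k₀)
    (h : ‖T - p + (1 / aTilde' f p
      * fderiv ℝ f p (fderiv ℝ G (d2 f p) (d2 g p - d2 f p))) • V f p‖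
      ≤ k₀ * (E * rate n η 5 + E * rate n η 6 * (E * rate n η 8))) :
    ‖T - p + (1 / aTilde' f p
      * fderiv ℝ f p (fderiv ℝ G (d2 f p) (d2 g p - meanD2 f K η p))) • V f p‖
      ≤ (k₀ * (E * √β + E ^ 2) + k₀ * (C * (C * (6 * C * (√β * √β)))) * C)
        * (Real.log n / (n * η ^ 7)) := by
  rw [← r.rate_six_mul_eight]
  obtain ⟨ρ, hρ⟩ : ∃ ρ, ρ = rate n η 6 * rate n η 8 := ⟨_, rfl⟩
  have hρ0 : 0 ≤ ρ := hρ ▸ mul_nonneg (rate_nonneg _) (rate_nonneg _)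
  have h5 : rate n η 5 ≤ √β * ρ := hρ ▸ r.rate_le hβ (by norm_num)
  have hη2 : η ^ 2 ≤ √β * (√β * ρ) :=
    (r.pow_le_rate hβ (i := 2) (k := 5) (by lia)).trans (by gcongr)
  have hbias : ‖meanD2 f K η p - d2 f p‖ ≤ 6 * C * (√β * √β) * ρ := by
    have hw : ∀ w : List (Fin 2), w.length ≤ 2 →
        |meanD f K η w p - wordD w f p| ≤ 2 * C * η ^ 2 :=
      fun w hw => hB.abs_bias_le_sq hK hf hC r.pos p w hw
    have h0 := hw [0, 0] le_rfl
    have h1 := hw [0, 1] le_rfl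
    have h2 := hw [1, 1] le_rfl
    refine (norm_space3_le _).trans ?_
    rw [d2_eq, meanD2]
    simp
    calc _ ≤ 2 * C * η ^ 2 + 2 * C * η ^ 2 + 2 * C * η ^ 2 := add_le_add (add_le_add h0 h1) h2
      _ = 6 * C * η ^ 2 := by ring
      _ ≤ 6 * C * (√β * (√β * ρ)) := by gcongr
      _ = _ := by ring
  have hsplit : T - p + (1 / aTilde' f p
      * fderiv ℝ f p (fderiv ℝ G (d2 f p) (d2 g p - meanD2 f K η p))) • V f p
      = (T - p + (1 / aTilde' f p
          * fderiv ℝ f p (fderiv ℝ G (d2 f p) (d2 g p - d2 f p))) • V f p)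
        - ((aTilde' f p)⁻¹
          * fderiv ℝ f p (fderiv ℝ G (d2 f p) (meanD2 f K η p - d2 f p))) • V f p := by
    rw [show d2 g p - meanD2 f K η p = (d2 g p - d2 f p) - (meanD2 f K η p - d2 f p) by abel,
      map_sub, map_sub, one_div, mul_sub, sub_smul]
    abel
  have herr : ‖((aTilde' f p)⁻¹
      * fderiv ℝ f p (fderiv ℝ G (d2 f p) (meanD2 f K η p - d2 f p))) • V f p‖
      ≤ k₀ * (C * (C * (6 * C * (√β * √β) * ρ))) * C := by
    rw [norm_smul, norm_mul, Real.norm_eq_abs]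
    have h1 := (fderiv ℝ G (d2 f p)).le_of_opNorm_le_of_le (norm_fderiv_G_le hC _) hbias
    have h2 := (fderiv ℝ f p).le_of_opNorm_le_of_le (hC.norm_fderiv p) h1
    exact mul_le_mul (mul_le_mul hk h2 (norm_nonneg _) hk0) (hC.norm_V p) (norm_nonneg _)
      (by positivity)
  have hmain : k₀ * (E * rate n η 5 + E * rate n η 6 * (E * rate n η 8))
      ≤ k₀ * (E * (√β * ρ) + E ^ 2 * ρ) := by
    rw [show E * rate n η 6 * (E * rate n η 8) = E ^ 2 * (rate n η 6 * rate n η 8) by ring, ← hρ]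
    gcongr
  rw [hsplit, ← hρ]
  calc _ ≤ _ := norm_sub_le _ _
    _ ≤ _ := add_le_add (h.trans hmain) herr
    _ = _ := by ring

/-- In the second expansion the error of the gradient may be replaced by its bias: the deviation
of the gradient, of the order `√(log n / (n h⁴))`, is absorbed by the remainder. -/
lemma norm_flat_expansion_le (hd : Deviation f K g c L a R M n η) (hC : SmoothBounds f C)
    (r : Regime n η) (hβ : n * η ^ 9 ≤ β) (hM : 0 ≤ M)
    (hk0 : 0 ≤ k₀) (hk : |(aTilde' f p)⁻¹| ≤ k₀) (hq : ‖q‖ ≤ R)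
    (h : ‖T - q + ((aTilde' f p)⁻¹ * (fderiv ℝ (fderiv ℝ f) p (q - p) (V f p)
      + (fderiv ℝ g q - fderiv ℝ f q) (V f p))) • V f p‖
      ≤ k₀ * (E * rate n η 5 * (E * rate n η 6))) {v : Plane}
    (hv : v = !₂[meanD f K η [0] q - wordD [0] f q, meanD f K η [1] q - wordD [1] f q]) :
    ‖T - p + Matrix.toEuclideanLin (Gam f p) (q - p)
      + (aTilde' f p)⁻¹ • Matrix.toEuclideanLin (PV f p) v‖
      ≤ (k₀ * E ^ 2 + k₀ * (2 * M * √β * C) * C) * (Real.log n / (n * η ^ (13 / 2 : ℝ))) := by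
  rw [← r.rate_six_mul_seven]
  obtain ⟨ρ, hρ⟩ : ∃ ρ, ρ = rate n η 6 * rate n η 7 := ⟨_, rfl⟩
  have hρ0 : 0 ≤ ρ := hρ ▸ mul_nonneg (rate_nonneg _) (rate_nonneg _)
  have h4 : rate n η 4 ≤ √β * ρ := hρ ▸ r.rate_le hβ (by norm_num)
  have h56 : rate n η 5 * rate n η 6 ≤ ρ := by
    rw [hρ, mul_comm]
    exact mul_le_mul_of_nonneg_left (r.rate_mono (by norm_num)) (rate_nonneg _)
  have hdev : |(fderiv ℝ g q - fderiv ℝ f q) (V f p) - inner ℝ v (V f p)|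
      ≤ 2 * M * √β * C * ρ := by
    have e : (fderiv ℝ g q - fderiv ℝ f q) (V f p) - inner ℝ v (V f p)
        = V f p 0 * (wordD [0] g q - meanD f K η [0] q)
          + V f p 1 * (wordD [1] g q - meanD f K η [1] q) := by
      rw [sub_apply, fderiv_apply_eq, fderiv_apply_eq, inner_plane, hv]
      simp [wordD_cons]
      ring
    have hw : ∀ i : Fin 2, |wordD [i] g q - meanD f K η [i] q| ≤ M * (√β * ρ) := fun i =>
      (hd.pointwise [i] (by simp) q hq).trans (by
        simp only [List.length_cons, List.length_nil]
        norm_num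
        gcongr)
    have hVi : ∀ i, |V f p i| ≤ C := fun i => (abs_apply_le_norm _ i).trans (hC.norm_V p)
    rw [e]
    calc _ ≤ _ := abs_add_le _ _
      _ ≤ C * (M * (√β * ρ)) + C * (M * (√β * ρ)) := by
          rw [abs_mul, abs_mul]
          exact add_le_add (mul_le_mul (hVi 0) (hw 0) (abs_nonneg _) C.2)
            (mul_le_mul (hVi 1) (hw 1) (abs_nonneg _) C.2)
      _ = _ := by ring
  have hsplit : T - p + Matrix.toEuclideanLin (Gam f p) (q - p)
      + (aTilde' f p)⁻¹ • Matrix.toEuclideanLin (PV f p) v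
      = (T - q + ((aTilde' f p)⁻¹ * (fderiv ℝ (fderiv ℝ f) p (q - p) (V f p)
          + (fderiv ℝ g q - fderiv ℝ f q) (V f p))) • V f p)
        - ((aTilde' f p)⁻¹
          * ((fderiv ℝ g q - fderiv ℝ f q) (V f p) - inner ℝ v (V f p))) • V f p := by
    rw [toEuclideanLin_Gam (hC.contDiff.of_le (by norm_num)), toEuclideanLin_PV, smul_smul]
    module
  have herr : ‖((aTilde' f p)⁻¹
      * ((fderiv ℝ g q - fderiv ℝ f q) (V f p) - inner ℝ v (V f p))) • V f p‖
      ≤ k₀ * (2 * M * √β * C * ρ) * C := by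
    rw [norm_smul, norm_mul, Real.norm_eq_abs, Real.norm_eq_abs]
    exact mul_le_mul (mul_le_mul hk hdev (abs_nonneg _) hk0) (hC.norm_V p) (norm_nonneg _)
      (by positivity)
  have hmain : k₀ * (E * rate n η 5 * (E * rate n η 6)) ≤ k₀ * (E ^ 2 * ρ) := by
    rw [show E * rate n η 5 * (E * rate n η 6) = E ^ 2 * (rate n η 5 * rate n η 6) by ring]
    gcongr
  rw [hsplit, ← hρ]
  calc _ ≤ _ := norm_sub_le _ _
    _ ≤ _ := add_le_add (h.trans hmain) herr
    _ = _ := by ring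

/-- A bound that holds, for large `n`, off events whose probabilities tend to zero, is a bound in
probability. -/
lemma UnifBigOp.of_bad {Ω : Type*} [MeasurableSpace Ω] {P : Measure Ω} {S : Set Plane}
    {Z : ℕ → Ω → Plane → Plane} {r : ℕ → ℝ} {bad : ℕ → Set Ω}
    (hbad : Tendsto (fun n => P (bad n)) atTop (𝓝 0)) (D : ℝ)
    (h : ∀ᶠ n in atTop, ∀ ω ∉ bad n, ∀ x ∈ S, ‖Z n ω x‖ ≤ D * r n) : UnifBigOp P S Z r := by
  intro ε hε
  refine ⟨D, ?_⟩
  filter_upwards [h, hbad.eventually (ge_mem_nhds (ENNReal.ofReal_pos.2 hε))] with n h1 h2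
  refine (measure_mono fun ω hω => ?_).trans h2
  obtain ⟨x, hx, hlt⟩ := hω
  by_contra hn
  exact absurd (h1 ω hn x hx) (not_le.2 hlt)

lemma Model.exists_radius (m : Model f H L a) (hC : SmoothBounds f C) :
    ∃ R : ℝ, ∀ x ∈ startSet f L a, ∀ t, |t| ≤ a + 1 → ‖X f x t‖ + 1 ≤ R := by
  have hc := ((m.isCompact_startSet hC).prod
    (isCompact_Icc (a := -(a + 1)) (b := a + 1))).image hC.continuous_X
  obtain ⟨R, hR⟩ := hc.isBounded.exists_norm_le
  exact ⟨R + 1, fun x hx t ht => by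
    linarith [hR _ ⟨(x, t), ⟨hx, abs_le.1 ht⟩, rfl⟩]⟩

end Remainders

end Filament

end

theorem theorem3p5 {Ω : Type*} [MeasurableSpace Ω] (P : Measure Ω) [IsProbabilityMeasure P]
    (f K : Filament.Plane → ℝ) (H L : Set Filament.Plane) (a : ℝ) (h : ℕ → ℝ)
    (ξ : ℕ → Ω → Filament.Plane) (θhat : ℕ → Ω → Filament.Plane → ℝ)
    (hf : Filament.SmoothDensity f)
    (hH : Filament.Region f H)
    (hL : Filament.IsFilament f H L a)
    (hchord : Filament.ChordBound f L a)
    (htrans : Filament.Transversal f L)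
    (hdeg : Filament.NoDegenerate f H L a)
    (hK : Filament.IsKernel K)
    (hKR : Filament.FiniteEnergy K)
    (hh : Filament.Bandwidth h)
    (hξ : Filament.IsSample P f ξ)
    (hθ : ∀ n ω, ∀ x₀ ∈ Filament.startSet f L a,
      Filament.IsHatTheta (Filament.hitTimes (Filament.fHat K h ξ n ω) x₀) (θhat n ω x₀)) :
    Filament.UnifBigOp P (Filament.startSet f L a)
      (fun n ω x₀ =>
        Filament.X (Filament.fHat K h ξ n ω) x₀ (θhat n ω x₀)
          - Filament.X f x₀ (Filament.theta f x₀)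
          + Filament.phi1 P f K h ξ n ω (Filament.X f x₀ (Filament.theta f x₀)) •
              Filament.V f (Filament.X f x₀ (Filament.theta f x₀)))
      (fun n => Real.log n / (n * h n ^ 7)) ∧
    ((∀ x₀ ∈ Filament.startSet f L a,
        ‖gradient f (Filament.X f x₀ (Filament.theta f x₀))‖ = 0) →
      Filament.UnifBigOp P (Filament.startSet f L a)
        (fun n ω x₀ =>
          Filament.X (Filament.fHat K h ξ n ω) x₀ (θhat n ω x₀)
            - Filament.X f x₀ (Filament.theta f x₀)
            + Matrix.toEuclideanLin (Filament.Gam f (Filament.X f x₀ (Filament.theta f x₀)))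
                (Filament.X (Filament.fHat K h ξ n ω) x₀ (Filament.theta f x₀)
                  - Filament.X f x₀ (Filament.theta f x₀))
            + (Filament.aTilde' f (Filament.X f x₀ (Filament.theta f x₀)))⁻¹ •
                Matrix.toEuclideanLin (Filament.PV f (Filament.X f x₀ (Filament.theta f x₀)))
                  (Filament.gradBias P f K h ξ n
                    (Filament.X (Filament.fHat K h ξ n ω) x₀ (Filament.theta f x₀))))
        (fun n => Real.log n / (n * h n ^ (13 / 2 : ℝ)))) := by
  have m : Filament.Model f H L a := ⟨hf, hH, hL, hchord, htrans, hdeg⟩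
  obtain ⟨C, hC⟩ := hf.exists_bounds
  obtain ⟨B, hB⟩ := hK.exists_bounds
  obtain ⟨R, hR⟩ := m.exists_radius hC
  obtain ⟨ε, hε, k₀, hk₀, hexp⟩ := m.exists_expansion hC hR
  choose c b hc hcG using fun k : Fin 2 × Fin 3 => m.exists_weight hC k.1 k.2
  obtain ⟨M, hM, bad, hbad, hdev⟩ := hB.exists_deviation m hC hh hξ R hc
  obtain ⟨β, hβ⟩ := hh.exists_eventually_mul_pow_le
  obtain ⟨E, hE⟩ : ∃ E, E = 6 * (M + 2 * C * √β + (∑ k, b k) * (2 * C * √β) * a) := ⟨_, rfl⟩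
  have hE0 : 0 ≤ E := by
    have h1 := Finset.sum_nonneg fun k (_ : k ∈ Finset.univ) =>
      zero_le_one.trans (hc k).one_le
    have h2 := hL.a_pos
    rw [hE]
    positivity
  have hev : ∀ᶠ n : ℕ in atTop, Filament.Regime n (h n) ∧ n * h n ^ 9 ≤ β ∧
      E * Filament.rate n (h n) 7 ≤ 1 ∧ E * Filament.rate n (h n) 8 ≤ ε := by
    filter_upwards [hh.eventually_regime, hβ,
      hh.eventually_rate_le (k := 7) (by norm_num) (ε := 1 / (E + 1)) (by positivity),
      hh.eventually_rate_le (k := 8) (by norm_num) (ε := ε / (E + 1)) (by positivity)]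
      with n h1 h2 h3 h4
    rw [le_div_iff₀ (by positivity)] at h3 h4
    have h5 := Filament.rate_nonneg (n := n) (η := h n) 7
    have h6 := Filament.rate_nonneg (n := n) (η := h n) 8
    exact ⟨h1, h2, by linarith, by linarith⟩
  have hnear : ∀ n, Filament.Regime n (h n) → n * h n ^ 9 ≤ β →
      E * Filament.rate n (h n) 7 ≤ 1 → ∀ ω ∉ bad n,
      Filament.Near f (Filament.fHat K h ξ n ω) L a R (E * Filament.rate n (h n) 5)
        (E * Filament.rate n (h n) 5) (E * Filament.rate n (h n) 6)
        (E * Filament.rate n (h n) 8) := fun n r hn h7 ω hω =>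
    (hdev n ω hω).near (Filament.contDiff_fHat hK.contDiff n ω)
      (Filament.exists_V_bounds (Filament.contDiff_fHat hK.contDiff n ω) fun w _ hw =>
        hB.exists_wordD_fHat_le (hh.pos n) ω hw)
      hB hK m hC hc hcG r hn hM hE h7
  refine ⟨Filament.UnifBigOp.of_bad hbad
    (k₀ * (E * √β + E ^ 2) + k₀ * (C * (C * (6 * C * (√β * √β)))) * C) ?_, fun hflat =>
    Filament.UnifBigOp.of_bad hbad (k₀ * E ^ 2 + k₀ * (2 * M * √β * C) * C) ?_⟩
  · filter_upwards [hev] with n hn ω hω x hx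
    obtain ⟨r, hn9, h7, h8⟩ := hn
    obtain ⟨h1, -, -, hk⟩ := hexp _ _ _ _ _ (hnear n r hn9 h7 ω hω) h8 x hx (θhat n ω x)
      (hθ n ω x hx) _ _ rfl rfl
    have h2 := Filament.norm_expansion_le hB hK hf hC r hn9 hE0 hk₀ hk h1
    rwa [Filament.phi1, Filament.inner_gradient, hB.integral_d2_fHat hξ (hh.pos n) r.n_pos]
  · filter_upwards [hev] with n hn ω hω x hx
    obtain ⟨r, hn9, h7, h8⟩ := hn
    obtain ⟨-, h1, hq, hk⟩ := hexp _ _ _ _ _ (hnear n r hn9 h7 ω hω) h8 x hx (θhat n ω x)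
      (hθ n ω x hx) _ _ rfl rfl
    have hp : fderiv ℝ f (Filament.X f x (Filament.theta f x)) = 0 := by
      ext v
      rw [← Filament.inner_gradient, norm_eq_zero.1 (hflat x hx), inner_zero_left]
      rfl
    exact Filament.norm_flat_expansion_le (hdev n ω hω) hC r hn9 hM hk₀ hk hq (h1 hp)
      (hB.gradBias_eq hξ (hh.pos n) r.n_pos _)
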